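/- Let $\mathcal G\rightrightarrows M$ be a Lie groupoid with source $s$, target $t$, multiplication $m$, unit $u$, inversion $i$ and division map $\bar m(p,q)=pq^{-1}$ (for $s(p)=s(q)$). Let $\mathcal G^{(k)}$ be the space of strings $(g_1,\dots,g_k)$ with $s(g_i)=t(g_{i+1})$, $\mathcal G^{(0)}=M$. Let $r_g,l_g$ be the differentials of right and left translation by $g$, $A=\ker(ds)|_M$ the Lie algebroid, $\rho=dt|_A$ its anchor, and for $\alpha\in\Gamma(A)$ put $\overrightarrow\alpha(g)=r_g\alpha_{t(g)}$, $\overleftarrow\alpha(g)=l_g\,di(\alpha_{s(g)})$. For a vector bundle $E\to M$ let $C^k(\mathcal G,E)$ be the space of smooth maps $u$ on $\mathcal G^{(k)}$ with $u(g_1,\dots,g_k)\in E_{t(g_1)}$. Given linear maps $\lambda_g:E_{s(g)}\to E_{t(g)}$ put $$(\delta_\lambda u)(g_1,\dots,g_{k+1})=\lambda_{g_1}u(g_2,\dots,g_{k+1})+\sum_{i=1}^k(-1)^iu(\dots,g_ig_{i+1},\dots)+(-1)^{k+1}u(g_1,\dots,g_k).$$ Let $(C(\mathcal G),\delta)$ be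 the differential graded algebra obtained from the trivial line bundle with trivial action, with the cup product $(u\cdot f)(g_1,\dots,g_{k+l})=u(g_1,\dots,g_k)f(g_{k+1},\dots,g_{k+l})$; the same formula makes each $C(\mathcal G,E)$ a right $C(\mathcal G)$-module. The deformation complex $(C_{\mathrm{def}}(\mathcal G),\delta)$ has $C^0_{\mathrm{def}}(\mathcal G)=\Gamma(A)$ and, for $k\ge1$, $C^k_{\mathrm{def}}(\mathcal G)$ is the space of smooth $c:\mathcal G^{(k)}\to T\mathcal G$ with $c(g_1,\dots,g_k)\in T_{g_1}\mathcal G$ and such that $ds(c(g_1,\dots,g_k))$ does not depend on $g_1$. Its differential is $$(\delta c)(g_1,\dots,g_{k+1})=-d\bar m\big(c(g_1g_2,\dots,g_{k+1}),c(g_2,\dots,g_{k+1})\big)+\sum_{i=2}^k(-1)^ic(\dots,g_ig_{i+1},\dots)+(-1)^{k+1}c(g_1,\dots,g_k)$$ for $k\ge1$ and $\delta\alpha=-(\overrightarrow\alpha+\overleftarrow\alpha)$ for $\alpha\in\Gamma(A)$. It is a right $C(\mathcal G)$-module by the cup product formula, where for $\alpha\in\Gamma(A)$ and $f\in C^l(\mathcal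 G)$, $l\ge1$, $(\alpha\cdot f)(g_1,\dots,g_l)=f(g_1,\dots,g_l)\,r_{g_1}\alpha_{t(g_1)}$. Let $\sigma$ be an Ehresmann connection on $\mathcal G$: a smooth, fibrewise linear right inverse $\sigma:s^*TM\to T\mathcal G$ of $ds$ that equals $du$ at the units. Put $\omega_g(X)=r_{g^{-1}}(X-\sigma_g\,ds(X))$ and $$\lambda_g(X)=dt(\sigma_g(X))\ (X\in T_{s(g)}M),\qquad \lambda_g(\alpha)=-\omega_g(\overleftarrow\alpha(g))\ (\alpha\in A_{s(g)}).$$ Then: 1. These $\lambda_g$ are smooth quasi-actions $T_{s(g)}M\to T_{t(g)}M$ and $A_{s(g)}\to A_{t(g)}$, and there are linear maps $K(g,h):T_{s(h)}M\to A_{t(g)}$ (the basic curvature), smooth in all variables, characterised for composable $(g,h)$ by $r_{gh}(K(g,h)v)=\sigma_{gh}(v)-dm(\sigma_g(\lambda_h(v)),\sigma_h(v))$. 2. $(C_{\mathrm{def}}(\mathcal G),\delta)$ is a right differential graded module over $(C(\mathcal G),\delta)$. 3. There are linear isomorphisms $I_\sigma:C^k_{\mathrm{def}}(\mathcal G)\cong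 C(\mathcal G,A\oplus TM)^k=C^k(\mathcal G,A)\oplus C^{k-1}(\mathcal G,TM)$, $c\leftrightarrow(u,v)$, for all $k\ge 0$ (with $C^{-1}=0$), characterised by $c(g_1,\dots,g_k)=r_{g_1}(u(g_1,\dots,g_k))-\sigma_{g_1}(v(g_2,\dots,g_k))$ for $k\ge1$ and $c=u$ for $k=0$; they form an isomorphism of right $C(\mathcal G)$-modules. 4. There is a unique operator $D_\sigma$ of degree $1$ on $C(\mathcal G,A\oplus TM)$ that makes it a right differential graded module over $(C(\mathcal G),\delta)$ (i.e. makes $Ad_\sigma=A\oplus TM$, with $A$ in degree $0$ and $TM$ in degree $1$, a representation up to homotopy) and satisfies $I_\sigma\delta=D_\sigma I_\sigma$. It is given by $$D_\sigma(u,v)=(\delta_\lambda u+K\cdot v,\ -\delta_\lambda v+\rho(u)),\qquad (K\cdot v)(g_1,\dots,g_{k+1})=K(g_1,g_2)\,v(g_3,\dots,g_{k+1})$$ (and $D_\sigma u=(\delta_\lambda u,\rho(u))$ in degree $0$). 5. Hence $I_\sigma$ induces isomorphisms $H^k_{\mathrm{def}}(\mathcal G)\cong H^k(\mathcal G,Ad_\sigma)$,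 $[c]\mapsto[I_\sigma c]$, for all $k\ge0$. -/

import Mathlib

open scoped Manifold ContDiff Bundle

/-! ### Lie groupoids -/

/-- A Lie groupoid `G ⇉ M`. The manifolds are finite dimensional, smooth and without boundary; `G`
need not be Hausdorff. Arrows compose as `mul g h : s h ⟶ t g` whenever `s g = t h`. The
multiplication is written as a total function, but only its values on composable pairs matter
(every axiom and every construction below uses these values only). -/
structure LieGroupoid (EG EM G M : Type*)
    [NormedAddCommGroup EG] [NormedSpace ℝ EG] [NormedAddCommGroup EM] [NormedSpace ℝ EM]
    [TopologicalSpace G] [ChartedSpace EG G] [TopologicalSpace M] [ChartedSpace EM M] where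
  /-- source -/
  s : C^∞⟮𝓘(ℝ, EG), G; 𝓘(ℝ, EM), M⟯
  /-- target -/
  t : C^∞⟮𝓘(ℝ, EG), G; 𝓘(ℝ, EM), M⟯
  /-- unit -/
  u : C^∞⟮𝓘(ℝ, EM), M; 𝓘(ℝ, EG), G⟯
  /-- inversion -/
  inv : C^∞⟮𝓘(ℝ, EG), G; 𝓘(ℝ, EG), G⟯
  /-- multiplication -/
  mul : G → G → G
  s_submersion : Manifold.IsSubmersion 𝓘(ℝ, EG) 𝓘(ℝ, EM) ∞ s
  mul_smooth : ContMDiffOn (𝓘(ℝ, EG).prod 𝓘(ℝ, EG)) 𝓘(ℝ, EG) ∞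
    (fun p : G × G => mul p.1 p.2) {p | s p.1 = t p.2}
  s_u : ∀ x, s (u x) = x
  t_u : ∀ x, t (u x) = x
  s_mul : ∀ g h, s g = t h → s (mul g h) = s h
  t_mul : ∀ g h, s g = t h → t (mul g h) = t g
  mul_assoc : ∀ g h k, s g = t h → s h = t k → mul (mul g h) k = mul g (mul h k)
  u_mul : ∀ g, mul (u (t g)) g = g
  mul_u : ∀ g, mul g (u (s g)) = g
  s_inv : ∀ g, s (inv g) = t g
  t_inv : ∀ g, t (inv g) = s g
  inv_mul : ∀ g, mul (inv g) g = u (s g)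
  mul_inv : ∀ g, mul g (inv g) = u (t g)

/-- Transport of a vector along an equality of base points (the identity map). -/
def transport {B : Type*} (E : B → Type*) [∀ x, AddCommGroup (E x)] [∀ x, Module ℝ (E x)]
    {x y : B} (h : x = y) : E x →ₗ[ℝ] E y :=
  h ▸ LinearMap.id

/-- The sum of two smooth families of tangent vectors along the same base points is smooth. -/
theorem contMDiff_add_along {E N E' N' : Type*}
    [NormedAddCommGroup E] [NormedSpace ℝ E] [TopologicalSpace N] [ChartedSpace E N]
    [IsManifold 𝓘(ℝ, E) ∞ N]
    [NormedAddCommGroup E'] [NormedSpace ℝ E'] [TopologicalSpace N'] [ChartedSpace E' N']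
    {b : N' → N} {v w : ∀ z, TangentSpace 𝓘(ℝ, E) (b z)}
    (hv : ContMDiff 𝓘(ℝ, E') 𝓘(ℝ, E).tangent ∞
      (fun z => (⟨b z, v z⟩ : TangentBundle 𝓘(ℝ, E) N)))
    (hw : ContMDiff 𝓘(ℝ, E') 𝓘(ℝ, E).tangent ∞
      (fun z => (⟨b z, w z⟩ : TangentBundle 𝓘(ℝ, E) N))) :
    ContMDiff 𝓘(ℝ, E') 𝓘(ℝ, E).tangent ∞
      (fun z => (⟨b z, v z + w z⟩ : TangentBundle 𝓘(ℝ, E) N)) := by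
  intro z₀
  have hv' := Bundle.contMDiffAt_totalSpace.1 (hv z₀)
  have hw' := Bundle.contMDiffAt_totalSpace.1 (hw z₀)
  refine Bundle.contMDiffAt_totalSpace.2 ⟨hv'.1, ?_⟩
  have hb : ContMDiffAt 𝓘(ℝ, E') 𝓘(ℝ, E) ∞ b z₀ := hv'.1
  set e := trivializationAt E (TangentSpace 𝓘(ℝ, E) : N → Type _) (b z₀) with he
  refine (hv'.2.add hw'.2).congr_of_eventuallyEq ?_
  filter_upwards [hb.continuousAt.preimage_mem_nhds
    (e.open_baseSet.mem_nhds (FiberBundle.mem_baseSet_trivializationAt' (b z₀)))] with z hz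
  exact (e.linear ℝ hz).1 (v z) (w z)

/-- A constant multiple of a smooth family of tangent vectors is smooth. -/
theorem contMDiff_smul_along {E N E' N' : Type*}
    [NormedAddCommGroup E] [NormedSpace ℝ E] [TopologicalSpace N] [ChartedSpace E N]
    [IsManifold 𝓘(ℝ, E) ∞ N]
    [NormedAddCommGroup E'] [NormedSpace ℝ E'] [TopologicalSpace N'] [ChartedSpace E' N']
    {b : N' → N} {v : ∀ z, TangentSpace 𝓘(ℝ, E) (b z)} (a : ℝ)
    (hv : ContMDiff 𝓘(ℝ, E') 𝓘(ℝ, E).tangent ∞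
      (fun z => (⟨b z, v z⟩ : TangentBundle 𝓘(ℝ, E) N))) :
    ContMDiff 𝓘(ℝ, E') 𝓘(ℝ, E).tangent ∞
      (fun z => (⟨b z, a • v z⟩ : TangentBundle 𝓘(ℝ, E) N)) := by
  intro z₀
  have hv' := Bundle.contMDiffAt_totalSpace.1 (hv z₀)
  refine Bundle.contMDiffAt_totalSpace.2 ⟨hv'.1, ?_⟩
  have hb : ContMDiffAt 𝓘(ℝ, E') 𝓘(ℝ, E) ∞ b z₀ := hv'.1
  set e := trivializationAt E (TangentSpace 𝓘(ℝ, E) : N → Type _) (b z₀) with he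
  refine ((contMDiffAt_const (I' := 𝓘(ℝ, ℝ)) (c := a)).smul hv'.2).congr_of_eventuallyEq ?_
  filter_upwards [hb.continuousAt.preimage_mem_nhds
    (e.open_baseSet.mem_nhds (FiberBundle.mem_baseSet_trivializationAt' (b z₀)))] with z hz
  exact (e.linear ℝ hz).2 a (v z)

/-- The zero vectors along a smooth family of base points form a smooth family. -/
theorem contMDiff_zero_along {E N E' N' : Type*}
    [NormedAddCommGroup E] [NormedSpace ℝ E] [TopologicalSpace N] [ChartedSpace E N]
    [IsManifold 𝓘(ℝ, E) ∞ N]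
    [NormedAddCommGroup E'] [NormedSpace ℝ E'] [TopologicalSpace N'] [ChartedSpace E' N']
    {b : N' → N} (hb : ContMDiff 𝓘(ℝ, E') 𝓘(ℝ, E) ∞ b) :
    ContMDiff 𝓘(ℝ, E') 𝓘(ℝ, E).tangent ∞
      (fun z => (⟨b z, 0⟩ : TangentBundle 𝓘(ℝ, E) N)) :=
  (Bundle.contMDiff_zeroSection ℝ (TangentSpace 𝓘(ℝ, E) : N → Type _)).comp hb

noncomputable section

namespace LieGroupoid

variable {EG EM G M : Type*}
  [NormedAddCommGroup EG] [NormedSpace ℝ EG] [NormedAddCommGroup EM] [NormedSpace ℝ EM]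
  [TopologicalSpace G] [ChartedSpace EG G] [TopologicalSpace M] [ChartedSpace EM M]
  (𝒢 : LieGroupoid EG EM G M)

/-! ### Differentials of the structure maps

The maps `m`, `m̄`, `R_g`, `L_g` live on submanifolds (fibre products and fibres of submersions).
Their differentials are the derivatives within these submanifolds; they are only ever applied to
vectors tangent to the submanifold, where such a derivative is unambiguous. -/

/-- `(ds)_g : T_g G → T_{s(g)} M` -/
def ds (g : G) : TangentSpace 𝓘(ℝ, EG) g →ₗ[ℝ] TangentSpace 𝓘(ℝ, EM) (𝒢.s g) :=
  (mfderiv 𝓘(ℝ, EG) 𝓘(ℝ, EM) 𝒢.s g).toLinearMap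

/-- `(dt)_g : T_g G → T_{t(g)} M` -/
def dt (g : G) : TangentSpace 𝓘(ℝ, EG) g →ₗ[ℝ] TangentSpace 𝓘(ℝ, EM) (𝒢.t g) :=
  (mfderiv 𝓘(ℝ, EG) 𝓘(ℝ, EM) 𝒢.t g).toLinearMap

/-- `(du)_x : T_x M → T_{1_x} G` -/
def du (x : M) : TangentSpace 𝓘(ℝ, EM) x →ₗ[ℝ] TangentSpace 𝓘(ℝ, EG) (𝒢.u x) :=
  (mfderiv 𝓘(ℝ, EM) 𝓘(ℝ, EG) 𝒢.u x).toLinearMap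

/-- `(di)_g : T_g G → T_{g⁻¹} G` -/
def di (g : G) : TangentSpace 𝓘(ℝ, EG) g →ₗ[ℝ] TangentSpace 𝓘(ℝ, EG) (𝒢.inv g) :=
  (mfderiv 𝓘(ℝ, EG) 𝓘(ℝ, EG) 𝒢.inv g).toLinearMap

/-- `(dm)_{g,h} (a, b) ∈ T_{gh} G`, for `a ∈ T_g G`, `b ∈ T_h G` with `ds a = dt b`. -/
def dm (g h : G) : (TangentSpace 𝓘(ℝ, EG) g × TangentSpace 𝓘(ℝ, EG) h) →ₗ[ℝ]
    TangentSpace 𝓘(ℝ, EG) (𝒢.mul g h) :=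
  (mfderivWithin (𝓘(ℝ, EG).prod 𝓘(ℝ, EG)) 𝓘(ℝ, EG) (fun p : G × G => 𝒢.mul p.1 p.2)
    {p | 𝒢.s p.1 = 𝒢.t p.2} (g, h)).toLinearMap

/-- The division map `m̄ (p, q) = p q⁻¹`, used for `s p = s q`. -/
def div (p q : G) : G := 𝒢.mul p (𝒢.inv q)

/-- `(dm̄)_{p,q} (a, b) ∈ T_{p q⁻¹} G`, for `a ∈ T_p G`, `b ∈ T_q G` with `ds a = ds b`. -/
def ddiv (p q : G) : (TangentSpace 𝓘(ℝ, EG) p × TangentSpace 𝓘(ℝ, EG) q) →ₗ[ℝ]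
    TangentSpace 𝓘(ℝ, EG) (𝒢.div p q) :=
  (mfderivWithin (𝓘(ℝ, EG).prod 𝓘(ℝ, EG)) 𝓘(ℝ, EG) (fun r : G × G => 𝒢.div r.1 r.2)
    {r | 𝒢.s r.1 = 𝒢.s r.2} (p, q)).toLinearMap

/-- The differential `r_g : T_h s⁻¹(t(g)) → T_{hg} s⁻¹(s(g))` at `h` of the right translation
`R_g`. -/
def rightTrans (g h : G) : TangentSpace 𝓘(ℝ, EG) h →ₗ[ℝ] TangentSpace 𝓘(ℝ, EG) (𝒢.mul h g) :=
  (mfderivWithin 𝓘(ℝ, EG) 𝓘(ℝ, EG) (fun h' => 𝒢.mul h' g) {h' | 𝒢.s h' = 𝒢.t g} h).toLinearMap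

/-- The differential `l_g : T_h t⁻¹(s(g)) → T_{gh} t⁻¹(t(g))` at `h` of the left translation
`L_g`. -/
def leftTrans (g h : G) : TangentSpace 𝓘(ℝ, EG) h →ₗ[ℝ] TangentSpace 𝓘(ℝ, EG) (𝒢.mul g h) :=
  (mfderivWithin 𝓘(ℝ, EG) 𝓘(ℝ, EG) (fun h' => 𝒢.mul g h') {h' | 𝒢.t h' = 𝒢.s g} h).toLinearMap

/-! ### The Lie algebroid

`A` is a subbundle of `u^* TG`. Vectors of `A_x` are written as vectors of the ambient space
`T_{1_x} G`, together with the condition that they lie in `A_x`. -/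

/-- The ambient space `T_{1_x} G` of `A_x`. -/
abbrev TU (x : M) : Type _ := TangentSpace 𝓘(ℝ, EG) (𝒢.u x)

/-- The fibre `A_x = Ker (ds)_{1_x}` of the Lie algebroid of `G`. -/
def A (x : M) : Submodule ℝ (𝒢.TU x) := LinearMap.ker (𝒢.ds (𝒢.u x))

/-- The anchor `ρ : A_x → T_x M`, the differential of `t`. -/
def anchor (x : M) : 𝒢.TU x →ₗ[ℝ] TangentSpace 𝓘(ℝ, EM) x :=
  transport (TangentSpace 𝓘(ℝ, EM) (M := M)) (𝒢.t_u x) ∘ₗ 𝒢.dt (𝒢.u x)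

/-- `r_g : A_{t(g)} → T_g G`, right translation from the unit at `t(g)`. -/
def r (g : G) : 𝒢.TU (𝒢.t g) →ₗ[ℝ] TangentSpace 𝓘(ℝ, EG) g :=
  transport (TangentSpace 𝓘(ℝ, EG) (M := G)) (𝒢.u_mul g) ∘ₗ 𝒢.rightTrans g (𝒢.u (𝒢.t g))

/-- `r_{g⁻¹} : T_g s⁻¹(s(g)) → A_{t(g)}`, right translation back to the unit. -/
def rInv (g : G) : TangentSpace 𝓘(ℝ, EG) g →ₗ[ℝ] 𝒢.TU (𝒢.t g) :=
  transport (TangentSpace 𝓘(ℝ, EG) (M := G)) (𝒢.mul_inv g) ∘ₗ 𝒢.rightTrans (𝒢.inv g) g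

theorem inv_u (x : M) : 𝒢.inv (𝒢.u x) = 𝒢.u x := by
  have h1 := 𝒢.u_mul (𝒢.inv (𝒢.u x))
  have h2 := 𝒢.mul_inv (𝒢.u x)
  rw [𝒢.t_inv, 𝒢.s_u] at h1
  rw [𝒢.t_u] at h2
  exact h1.symm.trans h2

/-- `α ∈ A_{s(g)} ↦ l_g (di α) ∈ T_g G`, the value at `g` of left invariant vector fields. -/
def leftInv (g : G) : 𝒢.TU (𝒢.s g) →ₗ[ℝ] TangentSpace 𝓘(ℝ, EG) g :=
  transport (TangentSpace 𝓘(ℝ, EG) (M := G)) (𝒢.mul_u g) ∘ₗ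
    𝒢.leftTrans g (𝒢.u (𝒢.s g)) ∘ₗ
    transport (TangentSpace 𝓘(ℝ, EG) (M := G)) (𝒢.inv_u (𝒢.s g)) ∘ₗ 𝒢.di (𝒢.u (𝒢.s g))

/-! ### Strings of composable arrows -/

/-- The space `G^{(k)}` of strings `x₀ ⟵ x₁ ⟵ ⋯ ⟵ x_k` of `k` composable arrows. The objects are
recorded as well (for `k ≥ 1` they are determined by the arrows), so that `G^{(0)} = M`. -/
@[ext]
structure Strings (k : ℕ) where
  obj : Fin (k + 1) → M
  arr : Fin k → G
  t_arr : ∀ i, 𝒢.t (arr i) = obj i.castSucc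
  s_arr : ∀ i, 𝒢.s (arr i) = obj i.succ

variable {𝒢}

/-- An object, as a string of length zero. -/
def Strings.pt (x : M) : 𝒢.Strings 0 where
  obj := fun _ => x
  arr := Fin.elim0
  t_arr := fun i => i.elim0
  s_arr := fun i => i.elim0

/-- `(g₁, …, g_{k+1}) ↦ (g₂, …, g_{k+1})` -/
def Strings.tail {k : ℕ} (p : 𝒢.Strings (k + 1)) : 𝒢.Strings k where
  obj := fun i => p.obj i.succ
  arr := fun i => p.arr i.succ
  t_arr := fun i => p.t_arr i.succ
  s_arr := fun i => p.s_arr i.succ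

theorem Strings.comp {k : ℕ} (p : 𝒢.Strings k) {i j : Fin k} (h : (j : ℕ) = i + 1) :
    𝒢.s (p.arr i) = 𝒢.t (p.arr j) := by
  rw [p.s_arr, p.t_arr]
  congr 1
  ext
  simp [h]

/-- With `j` counted from zero: `(g₁, …, g_{k+1}) ↦ (g₁, …, g_{j+1} g_{j+2}, …, g_{k+1})` for
`j < k`, and `(g₁, …, g_{k+1}) ↦ (g₁, …, g_k)` for `j = k`. -/
def Strings.contract {k : ℕ} (j : Fin (k + 1)) (p : 𝒢.Strings (k + 1)) : 𝒢.Strings k where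
  obj := fun i => p.obj (j.succ.succAbove i)
  arr := j.contractNth 𝒢.mul p.arr
  t_arr := by
    intro i
    rcases lt_trichotomy (i : ℕ) (j : ℕ) with h | h | h
    · rw [Fin.contractNth_apply_of_lt _ _ _ _ h, p.t_arr]
      congr 1
      rw [Fin.succAbove_of_castSucc_lt]
      rw [Fin.lt_def]; simp; omega
    · rw [Fin.contractNth_apply_of_eq _ _ _ _ h, 𝒢.t_mul _ _ (p.comp (by simp)), p.t_arr]
      congr 1
      rw [Fin.succAbove_of_castSucc_lt]
      rw [Fin.lt_def]; simp; omega
    · rw [Fin.contractNth_apply_of_gt _ _ _ _ h, p.t_arr]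
      congr 1
      rw [Fin.succAbove_of_le_castSucc]
      · rfl
      · rw [Fin.le_def]; simp; omega
  s_arr := by
    intro i
    rcases lt_trichotomy (i : ℕ) (j : ℕ) with h | h | h
    · rw [Fin.contractNth_apply_of_lt _ _ _ _ h, p.s_arr]
      congr 1
      rw [Fin.succAbove_of_castSucc_lt]
      · rfl
      · rw [Fin.lt_def]; simp; omega
    · rw [Fin.contractNth_apply_of_eq _ _ _ _ h, 𝒢.s_mul _ _ (p.comp (by simp)), p.s_arr]
      congr 1
      rw [Fin.succAbove_of_le_castSucc]
      rw [Fin.le_def]; simp; omega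
    · rw [Fin.contractNth_apply_of_gt _ _ _ _ h, p.s_arr]
      congr 1
      rw [Fin.succAbove_of_le_castSucc]
      rw [Fin.le_def]; simp; omega

/-- `(g₁, …, g_{k+l}) ↦ (g₁, …, g_k)` -/
def Strings.front {k l m : ℕ} (h : k + l = m) (p : 𝒢.Strings m) : 𝒢.Strings k where
  obj := fun i => p.obj ⟨i, by omega⟩
  arr := fun i => p.arr ⟨i, by omega⟩
  t_arr := fun i => p.t_arr ⟨i, by omega⟩
  s_arr := fun i => p.s_arr ⟨i, by omega⟩

/-- `(g₁, …, g_{k+l}) ↦ (g_{k+1}, …, g_{k+l})` -/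
def Strings.back {k l m : ℕ} (h : k + l = m) (p : 𝒢.Strings m) : 𝒢.Strings l where
  obj := fun i => p.obj ⟨k + i, by omega⟩
  arr := fun i => p.arr ⟨k + i, by omega⟩
  t_arr := fun i => p.t_arr ⟨k + i, by omega⟩
  s_arr := fun i => p.s_arr ⟨k + i, by omega⟩

theorem Strings.t_zero {k : ℕ} (p : 𝒢.Strings (k + 1)) : 𝒢.t (p.arr 0) = p.obj 0 := p.t_arr 0

theorem Strings.s_zero {k : ℕ} (p : 𝒢.Strings (k + 1)) : 𝒢.s (p.arr 0) = p.tail.obj 0 :=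
  p.s_arr 0

theorem Strings.contract_obj_zero {k : ℕ} (j : Fin (k + 1)) (p : 𝒢.Strings (k + 1)) :
    (p.contract j).obj 0 = p.obj 0 := by
  show p.obj (j.succ.succAbove 0) = p.obj 0
  rw [Fin.succ_succAbove_zero]

theorem Strings.contract_succ_arr_zero {k : ℕ} (j : Fin (k + 1)) (p : 𝒢.Strings (k + 2)) :
    (p.contract j.succ).arr 0 = p.arr 0 :=
  Fin.contractNth_apply_of_lt j.succ 𝒢.mul p.arr 0 (by simp)

theorem Strings.div_contract {k : ℕ} (p : 𝒢.Strings (k + 2)) :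
    𝒢.div ((p.contract 0).arr 0) (p.tail.arr 0) = p.arr 0 := by
  have h0 : (p.contract 0).arr 0 = 𝒢.mul (p.arr 0) (p.arr 1) :=
    Fin.contractNth_apply_of_eq 0 𝒢.mul p.arr 0 (by simp)
  have h1 : p.tail.arr 0 = p.arr 1 := rfl
  have h : 𝒢.s (p.arr 0) = 𝒢.t (p.arr 1) := p.comp (by simp)
  rw [h0, h1, div, 𝒢.mul_assoc _ _ _ h (𝒢.t_inv _).symm, 𝒢.mul_inv, ← h, 𝒢.mul_u]

/-- A smooth family of strings, parametrised by `ℝⁿ`: a smooth map `ℝⁿ → G^{(k)}`. -/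
def IsSmoothFamily {k n : ℕ} (φ : EuclideanSpace ℝ (Fin n) → 𝒢.Strings k) : Prop :=
  (∀ i, ContMDiff 𝓘(ℝ, EuclideanSpace ℝ (Fin n)) 𝓘(ℝ, EM) ∞ (fun z => (φ z).obj i)) ∧
  (∀ i, ContMDiff 𝓘(ℝ, EuclideanSpace ℝ (Fin n)) 𝓘(ℝ, EG) ∞ (fun z => (φ z).arr i))

/-- Smoothness of a map `f : G^{(k)} → N` into a manifold: `f` is smooth along every smooth map
`ℝⁿ → G^{(k)}`. As `G^{(k)}` is an embedded submanifold of a product of copies of `G` and `M`,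
parametrised locally by open balls, this is smoothness in the usual sense. -/
def SmoothOnStrings {E H N : Type*} [NormedAddCommGroup E] [NormedSpace ℝ E]
    [TopologicalSpace H] [TopologicalSpace N] [ChartedSpace H N] (J : ModelWithCorners ℝ E H)
    {k : ℕ} (f : 𝒢.Strings k → N) : Prop :=
  ∀ (n : ℕ) (φ : EuclideanSpace ℝ (Fin n) → 𝒢.Strings k), IsSmoothFamily φ →
    ContMDiff 𝓘(ℝ, EuclideanSpace ℝ (Fin n)) J ∞ (fun z => f (φ z))

variable (𝒢)

/-! ### Cochains with values in a family of vector spaces -/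

/-- All (not necessarily smooth) cochains `(g₁, …, g_k) ↦ E_{t(g₁)}`. -/
abbrev Raw (E : M → Type*) (k : ℕ) : Type _ := ∀ p : 𝒢.Strings k, E (p.obj 0)

/-- The trivial line bundle. -/
abbrev Line (_x : M) : Type := ℝ

section
variable (E : M → Type*) [∀ x, AddCommGroup (E x)] [∀ x, Module ℝ (E x)]

/-- The operator `δ_λ` induced by maps `λ_g : E_{s(g)} → E_{t(g)}`:
`(δ_λ u)(g₁, …, g_{k+1}) = λ_{g₁} u(g₂, …, g_{k+1}) + ∑_{i=1}^{k} (-1)^i u(…, g_i g_{i+1}, …)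
  + (-1)^{k+1} u(g₁, …, g_k)`. -/
def deltaOp (lam : ∀ g, E (𝒢.s g) →ₗ[ℝ] E (𝒢.t g)) (k : ℕ) :
    𝒢.Raw E k →ₗ[ℝ] 𝒢.Raw E (k + 1) where
  toFun u p :=
    transport E p.t_zero (lam (p.arr 0) (transport E p.s_zero.symm (u p.tail))) +
      ∑ j : Fin (k + 1), (-1 : ℝ) ^ ((j : ℕ) + 1) •
        transport E (p.contract_obj_zero j) (u (p.contract j))
  map_add' u v := by
    funext p
    simp only [Pi.add_apply, map_add, smul_add, Finset.sum_add_distrib]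
    abel
  map_smul' a u := by
    funext p
    simp only [Pi.smul_apply, map_smul, RingHom.id_apply, smul_add, Finset.smul_sum]
    congr 1
    exact Finset.sum_congr rfl fun j _ => smul_comm _ _ _

/-- The cup product
`(u · f)(g₁, …, g_{k+l}) = f(g_{k+1}, …, g_{k+l}) u(g₁, …, g_k)`. -/
def cup {k l m : ℕ} (h : k + l = m) :
    𝒢.Raw E k →ₗ[ℝ] 𝒢.Raw (Line (M := M)) l →ₗ[ℝ] 𝒢.Raw E m :=
  LinearMap.mk₂ ℝ (fun u f p => f (p.back h) • (u (p.front h) : E (p.obj 0)))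
    (fun _ _ _ => by funext p; exact smul_add _ _ _)
    (fun _ _ _ => by funext p; exact smul_comm _ _ _)
    (fun _ _ _ => by funext p; exact add_smul _ _ _)
    (fun _ _ _ => by funext p; exact mul_smul _ _ _)

end

/-- The differential of `C(G)`. -/
def delta (k : ℕ) : 𝒢.Raw (Line (M := M)) k →ₗ[ℝ] 𝒢.Raw (Line (M := M)) (k + 1) :=
  𝒢.deltaOp (Line (M := M)) (fun _ => LinearMap.id) k

/-- The differentiable cochains `C^k(G)`. -/
def C (k : ℕ) : Submodule ℝ (𝒢.Raw (Line (M := M)) k) where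
  carrier := {f | SmoothOnStrings 𝓘(ℝ, ℝ) (fun p => f p)}
  zero_mem' := fun _ _ _ => contMDiff_const
  add_mem' := fun hf hg n φ hφ => (hf n φ hφ).add (hg n φ hφ)
  smul_mem' := fun a _ hf n φ hφ => (contMDiff_const (I' := 𝓘(ℝ, ℝ)) (c := a)).smul (hf n φ hφ)

variable [IsManifold 𝓘(ℝ, EG) ∞ G] [IsManifold 𝓘(ℝ, EM) ∞ M]

/-- The differentiable cochains `C^k(G, TM)`. -/
def CTM (k : ℕ) : Submodule ℝ (𝒢.Raw (TangentSpace 𝓘(ℝ, EM)) k) where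
  carrier := {v | SmoothOnStrings 𝓘(ℝ, EM).tangent
    (fun p => (⟨p.obj 0, v p⟩ : TangentBundle 𝓘(ℝ, EM) M))}
  zero_mem' := fun _ _ hφ => contMDiff_zero_along (hφ.1 0)
  add_mem' := fun hf hg n φ hφ => contMDiff_add_along (hf n φ hφ) (hg n φ hφ)
  smul_mem' := fun a _ hf n φ hφ => contMDiff_smul_along a (hf n φ hφ)

/-- The differentiable cochains `C^k(G, A)`: smooth maps to `A ⊆ TG` with values in `A_{t(g₁)}`. -/
def CA (k : ℕ) : Submodule ℝ (𝒢.Raw 𝒢.TU k) where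
  carrier := {u | (∀ p, u p ∈ 𝒢.A (p.obj 0)) ∧ SmoothOnStrings 𝓘(ℝ, EG).tangent
    (fun p => (⟨𝒢.u (p.obj 0), u p⟩ : TangentBundle 𝓘(ℝ, EG) G))}
  zero_mem' := ⟨fun _ => Submodule.zero_mem _,
    fun _ _ hφ => contMDiff_zero_along (𝒢.u.contMDiff.comp (hφ.1 0))⟩
  add_mem' := fun hf hg => ⟨fun p => Submodule.add_mem _ (hf.1 p) (hg.1 p),
    fun n φ hφ => contMDiff_add_along (hf.2 n φ hφ) (hg.2 n φ hφ)⟩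
  smul_mem' := fun a _ hf => ⟨fun p => Submodule.smul_mem _ a (hf.1 p),
    fun n φ hφ => contMDiff_smul_along a (hf.2 n φ hφ)⟩

/-! ### The deformation complex -/

/-- All (not necessarily smooth or projectable) deformation cochains: maps
`(g₁, …, g_k) ↦ T_{g₁} G` for `k ≥ 1`, and sections of the ambient bundle of `A` for `k = 0`. -/
def RawDef : ℕ → Type _
  | 0 => 𝒢.Raw 𝒢.TU 0
  | k + 1 => ∀ p : 𝒢.Strings (k + 1), TangentSpace 𝓘(ℝ, EG) (p.arr 0)

instance : ∀ k, AddCommGroup (𝒢.RawDef k)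
  | 0 => inferInstanceAs (AddCommGroup (𝒢.Raw 𝒢.TU 0))
  | k + 1 => inferInstanceAs
      (AddCommGroup (∀ p : 𝒢.Strings (k + 1), TangentSpace 𝓘(ℝ, EG) (p.arr 0)))

instance : ∀ k, Module ℝ (𝒢.RawDef k)
  | 0 => inferInstanceAs (Module ℝ (𝒢.Raw 𝒢.TU 0))
  | k + 1 => inferInstanceAs
      (Module ℝ (∀ p : 𝒢.Strings (k + 1), TangentSpace 𝓘(ℝ, EG) (p.arr 0)))

/-- The deformation cochains in positive degree: smooth maps `c : G^{(k+1)} → TG` with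
`c(g₁, …, g_{k+1}) ∈ T_{g₁} G` which are `s`-projectable, i.e. `ds (c(g₁, …, g_{k+1}))` is a
function `s_c(g₂, …, g_{k+1})`. -/
def CDefPos (k : ℕ) : Submodule ℝ (∀ p : 𝒢.Strings (k + 1), TangentSpace 𝓘(ℝ, EG) (p.arr 0)) where
  carrier := {c |
    SmoothOnStrings 𝓘(ℝ, EG).tangent (fun p => (⟨p.arr 0, c p⟩ : TangentBundle 𝓘(ℝ, EG) G)) ∧
    ∃ sc : 𝒢.Raw (TangentSpace 𝓘(ℝ, EM)) k, ∀ p : 𝒢.Strings (k + 1),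
      transport (TangentSpace 𝓘(ℝ, EM) (M := M)) p.s_zero (𝒢.ds (p.arr 0) (c p)) = sc p.tail}
  zero_mem' := ⟨fun _ _ hφ => contMDiff_zero_along (hφ.2 0), 0, fun _ => by simp⟩
  add_mem' := by
    rintro c c' ⟨hc, sc, h⟩ ⟨hc', sc', h'⟩
    refine ⟨fun n φ hφ => contMDiff_add_along (hc n φ hφ) (hc' n φ hφ), sc + sc', fun p => ?_⟩
    simp [h p, h' p]
  smul_mem' := by
    rintro a c ⟨hc, sc, h⟩
    refine ⟨fun n φ hφ => contMDiff_smul_along a (hc n φ hφ), a • sc, fun p => ?_⟩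
    simp [h p]

/-- The deformation cochains `C^k_def(G)`; for `k = 0` these are the sections of `A`. -/
def CDef : ∀ k, Submodule ℝ (𝒢.RawDef k)
  | 0 => 𝒢.CA 0
  | k + 1 => 𝒢.CDefPos k

/-- The differential of the deformation complex in degree zero: `α ↦ -(α⃗ + α⃖)`. The sign is the one
for which the Leibniz rule holds in all degrees (it affects neither kernel nor image). -/
def deformDiffZero : 𝒢.Raw 𝒢.TU 0 →ₗ[ℝ] (∀ p : 𝒢.Strings 1, TangentSpace 𝓘(ℝ, EG) (p.arr 0)) where
  toFun α p :=
    -(𝒢.r (p.arr 0) (α (Strings.pt (𝒢.t (p.arr 0)))) +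
      𝒢.leftInv (p.arr 0) (α (Strings.pt (𝒢.s (p.arr 0)))))
  map_add' α β := by
    funext p
    refine Eq.trans (congrArg₂ (fun a b => -(a + b)) (map_add _ _ _) (map_add _ _ _)) ?_
    rw [add_add_add_comm, neg_add]
    rfl
  map_smul' a α := by
    funext p
    refine Eq.trans (congrArg₂ (fun a b => -(a + b)) (map_smul _ _ _) (map_smul _ _ _)) ?_
    rw [← smul_add, ← smul_neg]
    rfl

/-- The differential of the deformation complex in positive degree:
`(δc)(g₁, …, g_{k+1}) = - dm̄(c(g₁g₂, g₃, …, g_{k+1}), c(g₂, …, g_{k+1}))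
  + ∑_{i=2}^{k} (-1)^i c(g₁, …, g_i g_{i+1}, …, g_{k+1}) + (-1)^{k+1} c(g₁, …, g_k)`
(with `k + 1` in place of `k`, and `i = j + 2`, the last summand being the last term). -/
def deformDiffPos (k : ℕ) :
    (∀ p : 𝒢.Strings (k + 1), TangentSpace 𝓘(ℝ, EG) (p.arr 0)) →ₗ[ℝ]
      (∀ p : 𝒢.Strings (k + 2), TangentSpace 𝓘(ℝ, EG) (p.arr 0)) where
  toFun c p :=
    -transport (TangentSpace 𝓘(ℝ, EG) (M := G)) p.div_contract
        (𝒢.ddiv ((p.contract 0).arr 0) (p.tail.arr 0) (c (p.contract 0), c p.tail)) +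
      ∑ j : Fin (k + 1), (-1 : ℝ) ^ ((j : ℕ) + 2) •
        transport (TangentSpace 𝓘(ℝ, EG) (M := G)) (p.contract_succ_arr_zero j)
          (c (p.contract j.succ))
  map_add' c c' := by
    funext p
    simp only [Pi.add_apply, ← Prod.mk_add_mk, map_add, smul_add, Finset.sum_add_distrib, neg_add]
    abel
  map_smul' a c := by
    funext p
    simp only [Pi.smul_apply, ← Prod.smul_mk, map_smul, RingHom.id_apply, smul_add, smul_neg,
      Finset.smul_sum]
    congr 1
    exact Finset.sum_congr rfl fun j _ => smul_comm _ _ _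

/-- The formula for the differential of the deformation complex. -/
def deformDiff : ∀ k, 𝒢.RawDef k →ₗ[ℝ] 𝒢.RawDef (k + 1)
  | 0 => 𝒢.deformDiffZero
  | k + 1 => 𝒢.deformDiffPos k

/-- The right action of `C(G)` on deformation cochains, given by the formula of the cup product;
for a section `α` of `A` and `f` of positive degree, `α` is translated to `g₁`:
`(α · f)(g₁, …, g_l) = f(g₁, …, g_l) r_{g₁}(α_{t(g₁)})`. -/
def actDef : ∀ {k l m : ℕ}, k + l = m →
    𝒢.RawDef k →ₗ[ℝ] 𝒢.Raw (Line (M := M)) l →ₗ[ℝ] 𝒢.RawDef m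
  | 0, _, 0, h => 𝒢.cup 𝒢.TU h
  | 0, _, m + 1, h =>
    (LinearMap.compr₂ (𝒢.cup 𝒢.TU h)
      (LinearMap.pi fun p : 𝒢.Strings (m + 1) => 𝒢.r (p.arr 0) ∘ₗ
        transport 𝒢.TU p.t_zero.symm ∘ₗ LinearMap.proj p) :
      𝒢.Raw 𝒢.TU 0 →ₗ[ℝ] 𝒢.Raw (Line (M := M)) _ →ₗ[ℝ]
        (∀ p : 𝒢.Strings (m + 1), TangentSpace 𝓘(ℝ, EG) (p.arr 0)))
  | k + 1, _, 0, h => absurd h (by omega)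
  | k + 1, l, m + 1, h =>
    (LinearMap.mk₂ ℝ
      (fun (c : ∀ p : 𝒢.Strings (k + 1), TangentSpace 𝓘(ℝ, EG) (p.arr 0))
        (f : 𝒢.Raw (Line (M := M)) l) (p : 𝒢.Strings (m + 1)) =>
          f (p.back h) • (c (p.front h) : TangentSpace 𝓘(ℝ, EG) (p.arr 0)))
      (fun _ _ _ => by funext p; exact smul_add _ _ _)
      (fun _ _ _ => by funext p; exact smul_comm _ _ _)
      (fun _ _ _ => by funext p; exact add_smul _ _ _)
      (fun _ _ _ => by funext p; exact mul_smul _ _ _))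

/-! ### The graded vector bundle `Ad = A ⊕ TM` -/

/-- Cochains of degree `k - 1` with values in `TM`; there are none for `k = 0`. -/
def RawShift : ℕ → Type _
  | 0 => PUnit
  | k + 1 => 𝒢.Raw (TangentSpace 𝓘(ℝ, EM)) k

instance : ∀ k, AddCommGroup (𝒢.RawShift k)
  | 0 => inferInstanceAs (AddCommGroup PUnit)
  | k + 1 => inferInstanceAs (AddCommGroup (𝒢.Raw (TangentSpace 𝓘(ℝ, EM)) k))

instance : ∀ k, Module ℝ (𝒢.RawShift k)
  | 0 =>
    { smul := fun _ _ => PUnit.unit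
      one_smul := fun _ => rfl
      mul_smul := fun _ _ _ => rfl
      smul_zero := fun _ => rfl
      smul_add := fun _ _ _ => rfl
      add_smul := fun _ _ _ => rfl
      zero_smul := fun _ => rfl }
  | k + 1 => inferInstanceAs (Module ℝ (𝒢.Raw (TangentSpace 𝓘(ℝ, EM)) k))

/-- `C^{k-1}(G, TM)`, which is zero for `k = 0`. -/
def CShift : ∀ k, Submodule ℝ (𝒢.RawShift k)
  | 0 => ⊤
  | k + 1 => 𝒢.CTM k

/-- All cochains of total degree `k` with values in `A ⊕ TM`, `A` in degree `0`, `TM` in degree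
`1`. -/
abbrev RawAd (k : ℕ) : Type _ := 𝒢.Raw 𝒢.TU k × 𝒢.RawShift k

/-- `C(G, A ⊕ TM)^k = C^k(G, A) ⊕ C^{k-1}(G, TM)` -/
def CAd (k : ℕ) : Submodule ℝ (𝒢.RawAd k) := (𝒢.CA k).prod (𝒢.CShift k)

/-- The cup product `C^{k-1}(G, TM) × C^l(G) → C^{k+l-1}(G, TM)`. -/
def cupShift : ∀ {k l m : ℕ}, k + l = m →
    𝒢.RawShift k →ₗ[ℝ] 𝒢.Raw (Line (M := M)) l →ₗ[ℝ] 𝒢.RawShift m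
  | 0, _, _, _ => 0
  | k + 1, _, 0, h => absurd h (by omega)
  | k + 1, l, m + 1, h => 𝒢.cup (TangentSpace 𝓘(ℝ, EM)) (by omega : k + l = m)

/-- The right action of `C(G)` on `C(G, A ⊕ TM)` by cup products. -/
def actAd {k l m : ℕ} (h : k + l = m) :
    𝒢.RawAd k →ₗ[ℝ] 𝒢.Raw (Line (M := M)) l →ₗ[ℝ] 𝒢.RawAd m :=
  LinearMap.mk₂ ℝ (fun w f => (𝒢.cup 𝒢.TU h w.1 f, 𝒢.cupShift h w.2 f))
    (fun _ _ _ => by simp) (fun _ _ _ => by simp) (fun _ _ _ => by simp) (fun _ _ _ => by simp)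

/-! ### Differential graded modules over `(C(G), δ)` -/

/-- `(S, d)` is a right differential graded module over the differential graded algebra
`(C(G), δ)`. Here `S k` is a space of cochains inside a space `N k` on which the action is given by
a formula. -/
structure IsRightDGModule {N : ℕ → Type*} [∀ k, AddCommGroup (N k)] [∀ k, Module ℝ (N k)]
    (S : ∀ k, Submodule ℝ (N k))
    (act : ∀ {k l m : ℕ}, k + l = m → N k →ₗ[ℝ] 𝒢.Raw (Line (M := M)) l →ₗ[ℝ] N m)
    (d : ∀ k, S k →ₗ[ℝ] S (k + 1)) : Prop where
  act_mem : ∀ {k l m : ℕ} (h : k + l = m) (n : S k) (f : 𝒢.C l),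
    act h (n : N k) (f : 𝒢.Raw (Line (M := M)) l) ∈ S m
  act_one : ∀ {k : ℕ} (n : S k), act (Nat.add_zero k) (n : N k) (fun _ => (1 : ℝ)) = n
  act_act : ∀ {k l l' a b m : ℕ} (h₁ : k + l = a) (h₂ : a + l' = m) (h₃ : l + l' = b)
    (h₄ : k + b = m) (n : S k) (f : 𝒢.C l) (f' : 𝒢.C l'),
    act h₂ (act h₁ (n : N k) (f : 𝒢.Raw (Line (M := M)) l)) (f' : 𝒢.Raw (Line (M := M)) l') =
      act h₄ (n : N k) (𝒢.cup (Line (M := M)) h₃ f f')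
  d_d : ∀ (k : ℕ) (n : S k), d (k + 1) (d k n) = 0
  leibniz : ∀ {k l m : ℕ} (h : k + l = m) (n : S k) (f : 𝒢.C l),
    (d m ⟨act h (n : N k) (f : 𝒢.Raw (Line (M := M)) l), act_mem h n f⟩ : N (m + 1)) =
      act (by omega : k + 1 + l = m + 1) (d k n : N (k + 1)) (f : 𝒢.Raw (Line (M := M)) l) +
      (-1 : ℝ) ^ k • act (by omega : k + (l + 1) = m + 1) (n : N k) (𝒢.delta l f)

/-- `D` is the structure operator of a representation up to homotopy on the graded vector bundle
`A ⊕ TM`: it makes `C(G, A ⊕ TM)` into a right DG module over `(C(G), δ)`. -/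
def IsRepUpToHomotopyAd (D : ∀ k, 𝒢.CAd k →ₗ[ℝ] 𝒢.CAd (k + 1)) : Prop :=
  𝒢.IsRightDGModule 𝒢.CAd 𝒢.actAd D

/-! ### Ehresmann connections, quasi-actions and basic curvature -/

/-- An Ehresmann connection on `G`: a smooth right inverse `σ : s^*TM → TG` of `ds`, linear on
fibres, over the identity of `G`, and equal to `du` at the units. -/
structure EhresmannConnection where
  σ : ∀ g, TangentSpace 𝓘(ℝ, EM) (𝒢.s g) →ₗ[ℝ] TangentSpace 𝓘(ℝ, EG) g
  ds_σ : ∀ g v, 𝒢.ds g (σ g v) = v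
  σ_u : ∀ (x : M) (v : TangentSpace 𝓘(ℝ, EM) x),
    σ (𝒢.u x) (transport (TangentSpace 𝓘(ℝ, EM) (M := M)) (𝒢.s_u x).symm v) = 𝒢.du x v
  smooth : ContMDiff (𝓘(ℝ, EG).prod 𝓘(ℝ, EM)) 𝓘(ℝ, EG).tangent ∞
    (fun p : Bundle.TotalSpace EM (𝒢.s *ᵖ (TangentSpace 𝓘(ℝ, EM) : M → Type _)) =>
      (⟨p.1, σ p.1 p.2⟩ : TangentBundle 𝓘(ℝ, EG) G))

namespace EhresmannConnection

variable {𝒢}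
variable (σ : 𝒢.EhresmannConnection)

/-- The left splitting `ω_g (X) = r_{g⁻¹}(X - σ_g (ds X)) ∈ A_{t(g)}`. -/
def leftSplit (g : G) : TangentSpace 𝓘(ℝ, EG) g →ₗ[ℝ] 𝒢.TU (𝒢.t g) :=
  𝒢.rInv g ∘ₗ (LinearMap.id - σ.σ g ∘ₗ 𝒢.ds g)

/-- The quasi-action on `TM`: `λ_g (X) = dt (σ_g (X))`. -/
def lamTM (g : G) : TangentSpace 𝓘(ℝ, EM) (𝒢.s g) →ₗ[ℝ] TangentSpace 𝓘(ℝ, EM) (𝒢.t g) :=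
  𝒢.dt g ∘ₗ σ.σ g

/-- The quasi-action on `A`: `λ_g (α) = - ω_g (α⃖(g))`. -/
def lamA (g : G) : 𝒢.TU (𝒢.s g) →ₗ[ℝ] 𝒢.TU (𝒢.t g) :=
  -(σ.leftSplit g ∘ₗ 𝒢.leftInv g)

/-- For composable `(g, h)`, the map
`v ↦ σ_{gh}(v) - dm(σ_g(λ_h(v)), σ_h(v)) ∈ T_{gh} G`, `v ∈ T_{s(h)} M`. -/
def curvDefect (g h : G) (hgh : 𝒢.s g = 𝒢.t h) :
    TangentSpace 𝓘(ℝ, EM) (𝒢.s h) →ₗ[ℝ] TangentSpace 𝓘(ℝ, EG) (𝒢.mul g h) :=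
  σ.σ (𝒢.mul g h) ∘ₗ
      transport (TangentSpace 𝓘(ℝ, EM) (M := M)) (𝒢.s_mul g h hgh).symm -
    𝒢.dm g h ∘ₗ LinearMap.prod
      (σ.σ g ∘ₗ transport (TangentSpace 𝓘(ℝ, EM) (M := M)) hgh.symm ∘ₗ σ.lamTM h) (σ.σ h)

/-- The basic curvature `K(g, h) : T_{s(h)} M → A_{t(g)}`, characterised by
`r_{gh}(K(g, h) v) = σ_{gh}(v) - dm(σ_g(λ_h(v)), σ_h(v))`. -/
def K (g h : G) (hgh : 𝒢.s g = 𝒢.t h) :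
    TangentSpace 𝓘(ℝ, EM) (𝒢.s h) →ₗ[ℝ] 𝒢.TU (𝒢.t g) :=
  transport 𝒢.TU (𝒢.t_mul g h hgh) ∘ₗ 𝒢.rInv (𝒢.mul g h) ∘ₗ σ.curvDefect g h hgh

/-- `(K · v)(g₁, …, g_{k+2}) = K(g₁, g₂) (v(g₃, …, g_{k+2}))` -/
def curvCup (k : ℕ) : 𝒢.Raw (TangentSpace 𝓘(ℝ, EM)) k →ₗ[ℝ] 𝒢.Raw 𝒢.TU (k + 2) :=
  LinearMap.pi fun p =>
    transport 𝒢.TU p.t_zero ∘ₗ σ.K (p.arr 0) (p.arr 1) (p.comp (by simp)) ∘ₗ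
      transport (TangentSpace 𝓘(ℝ, EM) (M := M)) p.tail.s_zero.symm ∘ₗ LinearMap.proj p.tail.tail

/-- Composition of `A`-valued cochains with the anchor. -/
def _root_.LieGroupoid.anchorOp (𝒢 : LieGroupoid EG EM G M) (k : ℕ) :
    𝒢.Raw 𝒢.TU k →ₗ[ℝ] 𝒢.Raw (TangentSpace 𝓘(ℝ, EM)) k :=
  LinearMap.pi fun p => 𝒢.anchor (p.obj 0) ∘ₗ LinearMap.proj p

/-- `K · v` for `v` of degree `k - 1`. -/
def curvCupShift : ∀ k, 𝒢.RawShift k →ₗ[ℝ] 𝒢.Raw 𝒢.TU (k + 1)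
  | 0 => 0
  | k + 1 => σ.curvCup k

/-- `δ_λ v` for `v` of degree `k - 1`. -/
def deltaShift : ∀ k, 𝒢.RawShift k →ₗ[ℝ] 𝒢.Raw (TangentSpace 𝓘(ℝ, EM)) k
  | 0 => 0
  | k + 1 => 𝒢.deltaOp (TangentSpace 𝓘(ℝ, EM)) σ.lamTM k

/-- `D_σ (u, v) = (δ_λ u + K · v, - δ_λ v + ρ(u))` for `u ∈ C^k(G, A)`, `v ∈ C^{k-1}(G, TM)`. -/
def structureOp (k : ℕ) : 𝒢.RawAd k →ₗ[ℝ] 𝒢.RawAd (k + 1) :=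
  LinearMap.prod
    (𝒢.deltaOp 𝒢.TU σ.lamA k ∘ₗ LinearMap.fst ℝ _ _ + σ.curvCupShift k ∘ₗ LinearMap.snd ℝ _ _)
    (-(σ.deltaShift k ∘ₗ LinearMap.snd ℝ _ _) + 𝒢.anchorOp k ∘ₗ LinearMap.fst ℝ _ _ :
      𝒢.RawAd k →ₗ[ℝ] 𝒢.Raw (TangentSpace 𝓘(ℝ, EM)) k)

/-- The deformation cochain with components `(u, v)`:
`c(g₁, …, g_k) = r_{g₁}(u(g₁, …, g_k)) - σ_{g₁}(v(g₂, …, g_k))`; in degree zero `c = u`. -/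
def assemble : ∀ k, 𝒢.RawAd k → 𝒢.RawDef k
  | 0, w => w.1
  | _ + 1, w => fun p =>
      𝒢.r (p.arr 0) (transport 𝒢.TU p.t_zero.symm (w.1 p)) -
        σ.σ (p.arr 0) (transport (TangentSpace 𝓘(ℝ, EM) (M := M)) p.s_zero.symm (w.2 p.tail))

/-- The maps `λ_g` on `A` are a quasi-action: they map `A_{s(g)}` to `A_{t(g)}`, smoothly in all
variables. -/
def IsQuasiActionA (𝒢 : LieGroupoid EG EM G M) (lam : ∀ g, 𝒢.TU (𝒢.s g) →ₗ[ℝ] 𝒢.TU (𝒢.t g)) :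
    Prop :=
  (∀ g, ∀ α ∈ 𝒢.A (𝒢.s g), lam g α ∈ 𝒢.A (𝒢.t g)) ∧
  ∀ (n : ℕ) (γ : EuclideanSpace ℝ (Fin n) → G) (α : ∀ z, 𝒢.TU (𝒢.s (γ z))),
    (∀ z, α z ∈ 𝒢.A (𝒢.s (γ z))) →
    ContMDiff 𝓘(ℝ, EuclideanSpace ℝ (Fin n)) 𝓘(ℝ, EG) ∞ γ →
    ContMDiff 𝓘(ℝ, EuclideanSpace ℝ (Fin n)) 𝓘(ℝ, EG).tangent ∞
      (fun z => (⟨𝒢.u (𝒢.s (γ z)), α z⟩ : TangentBundle 𝓘(ℝ, EG) G)) →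
    ContMDiff 𝓘(ℝ, EuclideanSpace ℝ (Fin n)) 𝓘(ℝ, EG).tangent ∞
      (fun z => (⟨𝒢.u (𝒢.t (γ z)), lam (γ z) (α z)⟩ : TangentBundle 𝓘(ℝ, EG) G))

/-- The maps `λ_g : T_{s(g)} M → T_{t(g)} M` are a quasi-action on `TM`: they depend smoothly on all
variables. -/
def IsQuasiActionTM (𝒢 : LieGroupoid EG EM G M)
    (lam : ∀ g, TangentSpace 𝓘(ℝ, EM) (𝒢.s g) →ₗ[ℝ] TangentSpace 𝓘(ℝ, EM) (𝒢.t g)) : Prop :=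
  ∀ (n : ℕ) (γ : EuclideanSpace ℝ (Fin n) → G) (v : ∀ z, TangentSpace 𝓘(ℝ, EM) (𝒢.s (γ z))),
    ContMDiff 𝓘(ℝ, EuclideanSpace ℝ (Fin n)) 𝓘(ℝ, EG) ∞ γ →
    ContMDiff 𝓘(ℝ, EuclideanSpace ℝ (Fin n)) 𝓘(ℝ, EM).tangent ∞
      (fun z => (⟨𝒢.s (γ z), v z⟩ : TangentBundle 𝓘(ℝ, EM) M)) →
    ContMDiff 𝓘(ℝ, EuclideanSpace ℝ (Fin n)) 𝓘(ℝ, EM).tangent ∞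
      (fun z => (⟨𝒢.t (γ z), lam (γ z) (v z)⟩ : TangentBundle 𝓘(ℝ, EM) M))

/-- The maps `K(g, h) : T_{s(h)} M → A_{t(g)}` form a smooth section. -/
def IsCurvatureTerm (𝒢 : LieGroupoid EG EM G M)
    (K : ∀ g h, 𝒢.s g = 𝒢.t h → TangentSpace 𝓘(ℝ, EM) (𝒢.s h) →ₗ[ℝ] 𝒢.TU (𝒢.t g)) : Prop :=
  (∀ g h hgh v, K g h hgh v ∈ 𝒢.A (𝒢.t g)) ∧
  ∀ (n : ℕ) (γ η : EuclideanSpace ℝ (Fin n) → G) (h : ∀ z, 𝒢.s (γ z) = 𝒢.t (η z))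
    (v : ∀ z, TangentSpace 𝓘(ℝ, EM) (𝒢.s (η z))),
    ContMDiff 𝓘(ℝ, EuclideanSpace ℝ (Fin n)) 𝓘(ℝ, EG) ∞ γ →
    ContMDiff 𝓘(ℝ, EuclideanSpace ℝ (Fin n)) 𝓘(ℝ, EG) ∞ η →
    ContMDiff 𝓘(ℝ, EuclideanSpace ℝ (Fin n)) 𝓘(ℝ, EM).tangent ∞
      (fun z => (⟨𝒢.s (η z), v z⟩ : TangentBundle 𝓘(ℝ, EM) M)) →
    ContMDiff 𝓘(ℝ, EuclideanSpace ℝ (Fin n)) 𝓘(ℝ, EG).tangent ∞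
      (fun z => (⟨𝒢.u (𝒢.t (γ z)), K (γ z) (η z) (h z) (v z)⟩ : TangentBundle 𝓘(ℝ, EG) G))

end EhresmannConnection

end LieGroupoid

/-! ### Cohomology of a cochain complex of real vector spaces in degrees `0, 1, 2, …` -/

section Cohomology

variable {S : ℕ → Type*} [∀ k, AddCommGroup (S k)] [∀ k, Module ℝ (S k)]
  (d : ∀ k, S k →ₗ[ℝ] S (k + 1))

/-- Coboundaries: the image of the previous differential. -/
def coboundaries : ∀ k, Submodule ℝ (S k)
  | 0 => ⊥
  | k + 1 => LinearMap.range (d k)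

/-- The cohomology `Ker d / Im d` in degree `k`. -/
abbrev Cohomology (k : ℕ) : Type _ :=
  LinearMap.ker (d k) ⧸ (coboundaries d k).comap (LinearMap.ker (d k)).subtype

end Cohomology

end

/-! Applying the tangent functor to `G ⇉ M` gives a groupoid `TG ⇉ TM` (`tangent`), and every
differential in the statement is a product or a quotient in it: `r_g α = α · 0_g`, `l_g (di α) = 0_g
· α⁻¹` and `dm̄(X, Y) = X · Y⁻¹`. The maps `m`, `m̄`, `R_g`, `L_g` live on subsets such as `{s p = t
q}`, so their derivatives are compared along curves: a pointwise identity between curves gives an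
identity between velocities (`IsVelocity.unique`). Composable tangent vectors are velocities of
composable curves because `s` is a submersion, which near a point admits a smooth projection onto
its fibres (`exists_fibre_projection`). The same argument with parameters shows that the tangent
product of two smooth composable families is smooth (`contMDiff_Tm`), and smoothness of all
constructions follows from this.

Once this is available, `δ² = 0` has two sources. The faces away from `g₁` cancel by the simplicial
identities, and the terms with `dm̄` cancel by `(X Z⁻¹)(Y Z⁻¹)⁻¹ = X Y⁻¹` in the tangent groupoid.

The connection splits `T_g G` as `r_g A ⊕ σ_g TM`. Hence a projectable cochain is `c = r u - σ v`
for a unique pair: `u = ω(c)`, and `-v` is the `s`-projection of `c`, recovered smoothly by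
evaluating on strings that start with a unit. The formula for `D_σ` comes from one computation
(`transport_ddiv_assemble`): `dm̄` of two assembled vectors splits into three pieces. The first is
`dm̄(r α, 0) = r α`. The second is `dm̄(0, r β)`, the left invariant vector of `β`, which equals
`σ(ρ β) - r(λ β)`. The third is `dm̄(σ_{gh} v, σ_h v) = r K(g,h) v + σ_g(λ_h v)`, by the definition
of `K`.

The module structures are then exchanged along the isomorphism. `D² = 0` is inherited from `δ² = 0`,
so no identities between `λ`, `K` and `ρ` have to be proved. In the other direction, the Leibniz
rule is checked for the explicit `D_σ`, where it is a statement about cup products (`deltaOp_cup`),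
and is carried to the deformation complex. Uniqueness of `D_σ` and the isomorphism in cohomology
follow because `I_σ` is bijective and intertwines the differentials. -/

noncomputable section

open Filter Topology

/-! ### Velocities of curves and of families of curves -/

section Velocity

variable {E N : Type*} [NormedAddCommGroup E] [NormedSpace ℝ E]
  [TopologicalSpace N] [ChartedSpace E N]
  {E' N' : Type*} [NormedAddCommGroup E'] [NormedSpace ℝ E']
  [TopologicalSpace N'] [ChartedSpace E' N']
  {E'' N'' : Type*} [NormedAddCommGroup E''] [NormedSpace ℝ E'']
  [TopologicalSpace N''] [ChartedSpace E'' N'']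

/-- The curve `c` has velocity `X` at time zero. -/
def IsVelocity (c : ℝ → N) (X : TangentBundle 𝓘(ℝ, E) N) : Prop :=
  MDifferentiableAt 𝓘(ℝ, ℝ) 𝓘(ℝ, E) c 0 ∧
    (⟨c 0, mfderiv 𝓘(ℝ, ℝ) 𝓘(ℝ, E) c 0 (1 : ℝ)⟩ : TangentBundle 𝓘(ℝ, E) N) = X

namespace IsVelocity

theorem apply_zero {c : ℝ → N} {X : TangentBundle 𝓘(ℝ, E) N} (h : IsVelocity c X) :
    c 0 = X.1 := by rw [← h.2]

/-- The equality takes place in the total space, so base points and vectors are compared together.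
This is the device that turns a pointwise groupoid identity into an identity of tangent vectors. -/
theorem unique {c c' : ℝ → N} {X X' : TangentBundle 𝓘(ℝ, E) N} (h : IsVelocity c X)
    (h' : IsVelocity c' X') (hc : c =ᶠ[𝓝 0] c') : X = X' := by
  rw [← h.2, ← h'.2, hc.mfderiv_eq]
  exact (Bundle.TotalSpace.mk_inj).2 rfl |>.trans (by rw [hc.eq_of_nhds])

theorem const (x : N) : IsVelocity (fun _ => x) (⟨x, 0⟩ : TangentBundle 𝓘(ℝ, E) N) :=
  ⟨mdifferentiableAt_const, by rw [mfderiv_const]; rfl⟩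

theorem comp {c : ℝ → N} {X : TangentBundle 𝓘(ℝ, E) N} (h : IsVelocity c X) {f : N → N'}
    (hf : MDifferentiableAt 𝓘(ℝ, E) 𝓘(ℝ, E') f X.1) :
    IsVelocity (fun τ => f (c τ)) (tangentMap 𝓘(ℝ, E) 𝓘(ℝ, E') f X) := by
  obtain ⟨h, rfl⟩ := h
  refine ⟨hf.comp (0 : ℝ) h, ?_⟩
  have := mfderiv_comp (0 : ℝ) hf h
  exact congrArg (fun L => (⟨f (c 0), L (1 : ℝ)⟩ : TangentBundle 𝓘(ℝ, E') N')) this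

/-- `S` need not have unique derivatives, so the derivative within `S` may involve a choice. On the
velocity of a curve that stays in `S` near time zero the choice has no effect, since the preimage of
`S` is a neighbourhood of `0` and the composite has an ordinary derivative. -/
theorem comp_within {c : ℝ → N} {X : TangentBundle 𝓘(ℝ, E) N} (h : IsVelocity c X) {f : N → N'}
    {S : Set N} (hf : MDifferentiableWithinAt 𝓘(ℝ, E) 𝓘(ℝ, E') f S X.1)
    (hS : ∀ᶠ τ in 𝓝 0, c τ ∈ S) :
    IsVelocity (fun τ => f (c τ)) (tangentMapWithin 𝓘(ℝ, E) 𝓘(ℝ, E') f S X) := by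
  obtain ⟨h, rfl⟩ := h
  have h1 : HasMFDerivWithinAt 𝓘(ℝ, ℝ) 𝓘(ℝ, E') (f ∘ c) (c ⁻¹' S) 0 _ :=
    HasMFDerivWithinAt.comp (0 : ℝ) hf.hasMFDerivWithinAt
      (h.hasMFDerivAt.hasMFDerivWithinAt (s := c ⁻¹' S)) subset_rfl
  have h2 := h1.hasMFDerivAt hS
  refine ⟨h2.mdifferentiableAt, ?_⟩
  exact congrArg (fun L => (⟨f (c 0), L (1 : ℝ)⟩ : TangentBundle 𝓘(ℝ, E') N')) h2.mfderiv

theorem comp₂_within {c : ℝ → N} {d : ℝ → N'} {X : TangentBundle 𝓘(ℝ, E) N}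
    {Y : TangentBundle 𝓘(ℝ, E') N'}
    (h : IsVelocity c X) (h' : IsVelocity d Y) {f : N × N' → N''}
    {S : Set (N × N')}
    (hf : MDifferentiableWithinAt (𝓘(ℝ, E).prod 𝓘(ℝ, E')) 𝓘(ℝ, E'') f S (X.1, Y.1))
    (hS : ∀ᶠ τ in 𝓝 0, (c τ, d τ) ∈ S) :
    IsVelocity (fun τ => f (c τ, d τ)) (⟨f (X.1, Y.1),
      mfderivWithin (𝓘(ℝ, E).prod 𝓘(ℝ, E')) 𝓘(ℝ, E'') f S (X.1, Y.1) (X.2, Y.2)⟩ :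
        TangentBundle 𝓘(ℝ, E'') N'') := by
  obtain ⟨h, rfl⟩ := h
  obtain ⟨h', rfl⟩ := h'
  have h1 : HasMFDerivWithinAt 𝓘(ℝ, ℝ) 𝓘(ℝ, E'') (f ∘ fun τ => (c τ, d τ))
      ((fun τ => (c τ, d τ)) ⁻¹' S) 0 _ :=
    HasMFDerivWithinAt.comp (0 : ℝ) hf.hasMFDerivWithinAt
      ((h.hasMFDerivAt.prodMk h'.hasMFDerivAt).hasMFDerivWithinAt) subset_rfl
  have h2 := h1.hasMFDerivAt hS
  refine ⟨h2.mdifferentiableAt, ?_⟩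
  exact congrArg (fun L => (⟨f (c 0, d 0), L (1 : ℝ)⟩ : TangentBundle 𝓘(ℝ, E'') N'')) h2.mfderiv

end IsVelocity

variable {P : Type*} [NormedAddCommGroup P] [NormedSpace ℝ P]

/-- `Γ` is a smooth family of curves near `z₀`, with initial velocities `X z`. -/
def IsVelocityFamily (Γ : P → ℝ → N) (X : P → TangentBundle 𝓘(ℝ, E) N) (z₀ : P) : Prop :=
  ContMDiffAt (𝓘(ℝ, P).prod 𝓘(ℝ, ℝ)) 𝓘(ℝ, E) ∞ (Function.uncurry Γ) (z₀, 0) ∧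
    ∀ᶠ z in 𝓝 z₀, IsVelocity (Γ z) (X z)

theorem ContMDiffAt.eventually_mdifferentiableAt [IsManifold 𝓘(ℝ, E) ∞ N]
    {F H : Type*} [NormedAddCommGroup F] [NormedSpace ℝ F] [TopologicalSpace H]
    {J : ModelWithCorners ℝ F H} {Q : Type*} [TopologicalSpace Q] [ChartedSpace H Q]
    [IsManifold J ∞ Q]
    {f : Q → N} {q : Q} (hf : ContMDiffAt J 𝓘(ℝ, E) ∞ f q) :
    ∀ᶠ x in 𝓝 q, MDifferentiableAt J 𝓘(ℝ, E) f x := by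
  have : IsManifold 𝓘(ℝ, E) 1 N := IsManifold.of_le (n := ∞) (by simp)
  have : IsManifold J 1 Q := IsManifold.of_le (n := ∞) (by simp)
  have h1 : ContMDiffAt J 𝓘(ℝ, E) 1 f q := hf.of_le (by simp)
  filter_upwards [(contMDiffAt_iff_contMDiffAt_nhds (by simp)).1 h1] with x hx
  exact hx.mdifferentiableAt (by simp)

/-- The partial derivative in time of a jointly smooth map depends smoothly on the parameter.
Smoothness of a family of tangent vectors can thus be proved by exhibiting curves. -/
theorem IsVelocityFamily.contMDiffAt [IsManifold 𝓘(ℝ, E) ∞ N] {Γ : P → ℝ → N}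
    {X : P → TangentBundle 𝓘(ℝ, E) N} {z₀ : P} (h : IsVelocityFamily Γ X z₀) :
    ContMDiffAt 𝓘(ℝ, P) 𝓘(ℝ, E).tangent ∞ X z₀ := by
  have : IsManifold 𝓘(ℝ, E) 1 N := IsManifold.of_le (n := ∞) (by simp)
  have h1 := ContMDiffAt.mfderiv (I := 𝓘(ℝ, ℝ)) (J := 𝓘(ℝ, P)) (I' := 𝓘(ℝ, E)) (m := ∞) Γ
    (fun _ => (0 : ℝ)) h.1 contMDiffAt_const (by simp)
  have h0 : ContMDiffAt 𝓘(ℝ, P) 𝓘(ℝ, E) ∞ (fun z => Γ z 0) z₀ :=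
    h.1.comp z₀ (contMDiffAt_id.prodMk contMDiffAt_const)
  have h2 : ContMDiffAt 𝓘(ℝ, P) 𝓘(ℝ, ℝ).tangent ∞
      (fun _ : P => (⟨(0 : ℝ), (1 : ℝ)⟩ : TangentBundle 𝓘(ℝ, ℝ) ℝ)) z₀ := contMDiffAt_const
  have h3 := ContMDiffAt.clm_apply_of_inCoordinates (b₁ := fun _ : P => (0 : ℝ))
    (b₂ := fun z => Γ z 0) (v := fun _ => (1 : ℝ)) h1 h2 h0
  refine h3.congr_of_eventuallyEq ?_
  filter_upwards [h.2] with z hz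
  exact hz.2.symm

end Velocity

/-! ### Curves with prescribed velocity, and lifts along submersions -/

section Velocity

variable {E N : Type*} [NormedAddCommGroup E] [NormedSpace ℝ E]
  [TopologicalSpace N] [ChartedSpace E N] [IsManifold 𝓘(ℝ, E) ∞ N]
  {P : Type*} [NormedAddCommGroup P] [NormedSpace ℝ P]

/-- The curve is a straight line in the chart at `x₀`. The chart is centred at `x₀` and not at the
base point of `X`, so that the line varies smoothly with `X`. -/
theorem isVelocity_chart_line (x₀ : N) (X : TangentBundle 𝓘(ℝ, E) N)
    (hX : X.1 ∈ (chartAt E x₀).source) :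
    IsVelocity (fun τ : ℝ => (extChartAt 𝓘(ℝ, E) x₀).symm (extChartAt 𝓘(ℝ, E) x₀ X.1 +
      τ • (trivializationAt E (TangentSpace 𝓘(ℝ, E) : N → Type _) x₀ X).2)) X := by
  have : IsManifold 𝓘(ℝ, E) 1 N := IsManifold.of_le (n := ∞) (by simp)
  obtain ⟨x, v⟩ := X
  set e := extChartAt 𝓘(ℝ, E) x₀ with he
  set w : E := (trivializationAt E (TangentSpace 𝓘(ℝ, E) : N → Type _) x₀ ⟨x, v⟩).2 with hw
  have hline : HasMFDerivAt 𝓘(ℝ, ℝ) 𝓘(ℝ, E) (fun τ : ℝ => e x + τ • w) 0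
      (ContinuousLinearMap.toSpanSingleton ℝ w) := by
    have : HasDerivAt (fun τ : ℝ => e x + τ • w) w 0 := by
      simpa using ((hasDerivAt_id (0 : ℝ)).smul_const w).const_add (e x)
    exact this.hasFDerivAt.hasMFDerivAt
  have hx : x ∈ e.source := by rwa [he, extChartAt_source]
  have hsymm : MDifferentiableAt 𝓘(ℝ, E) 𝓘(ℝ, E) e.symm (e x) := by
    have := mdifferentiableWithinAt_extChartAt_symm (I := 𝓘(ℝ, E)) (e.map_source hx)
    rwa [ModelWithCorners.range_eq_univ, mdifferentiableWithinAt_univ] at this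
  -- The inverse of the tangent trivialization is the derivative of the inverse chart.
  have hd : mfderiv 𝓘(ℝ, E) 𝓘(ℝ, E) e.symm (e x) w = v := by
    have h1 := TangentBundle.symmL_trivializationAt (I := 𝓘(ℝ, E)) hX
    rw [ModelWithCorners.range_eq_univ, mfderivWithin_univ] at h1
    have h2 := (trivializationAt E (TangentSpace 𝓘(ℝ, E) : N → Type _) x₀).symmL_continuousLinearMapAt
      (R := ℝ) (b := x) (by simpa using hX) v
    rw [h1] at h2
    rw [Bundle.Trivialization.continuousLinearMapAt_apply,
      Bundle.Trivialization.linearMapAt_apply, if_pos (by simpa using hX)] at h2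
    exact h2
  have hsymm' : MDifferentiableAt 𝓘(ℝ, E) 𝓘(ℝ, E) e.symm (e x + (0 : ℝ) • w) := by
    simpa using hsymm
  have hcomp := HasMFDerivAt.comp (0 : ℝ) hsymm'.hasMFDerivAt hline
  refine ⟨hcomp.mdifferentiableAt, ?_⟩
  have hb : e.symm (e x + (0 : ℝ) • w) = x := by simp [e.left_inv hx]
  have : mfderiv 𝓘(ℝ, ℝ) 𝓘(ℝ, E) (fun τ : ℝ => e.symm (e x + τ • w)) 0 (1 : ℝ) = (v : E) := by
    have h3 := congrArg (fun L => L (1 : ℝ)) hcomp.mfderiv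
    refine h3.trans ?_
    have h4 : (ContinuousLinearMap.toSpanSingleton ℝ w) (1 : ℝ) = w := by simp
    refine (congrArg (mfderiv 𝓘(ℝ, E) 𝓘(ℝ, E) e.symm (e x + (0 : ℝ) • w)) h4).trans ?_
    have h5 : ∀ y : E, y = e x → (mfderiv 𝓘(ℝ, E) 𝓘(ℝ, E) e.symm y w : E) = v := by
      rintro y rfl
      exact hd
    exact h5 _ (by simp)
  exact Bundle.TotalSpace.ext hb (heq_of_eq this)

theorem ContMDiffAt.exists_isVelocityFamily {X : P → TangentBundle 𝓘(ℝ, E) N} {z₀ : P}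
    (hX : ContMDiffAt 𝓘(ℝ, P) 𝓘(ℝ, E).tangent ∞ X z₀) :
    ∃ Γ : P → ℝ → N, IsVelocityFamily Γ X z₀ := by
  have hX' := Bundle.contMDiffAt_totalSpace.1 hX
  set x₀ := (X z₀).1 with hx₀
  refine ⟨fun z τ => (extChartAt 𝓘(ℝ, E) x₀).symm (extChartAt 𝓘(ℝ, E) x₀ (X z).1 +
      τ • (trivializationAt E (TangentSpace 𝓘(ℝ, E) : N → Type _) x₀ (X z)).2), ?_, ?_⟩
  · have h1 : ContMDiffAt (𝓘(ℝ, P).prod 𝓘(ℝ, ℝ)) 𝓘(ℝ, E) ∞ (fun q : P × ℝ =>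
        extChartAt 𝓘(ℝ, E) x₀ (X q.1).1 +
          q.2 • (trivializationAt E (TangentSpace 𝓘(ℝ, E) : N → Type _) x₀ (X q.1)).2)
        (z₀, 0) := by
      have ha : ContMDiffAt 𝓘(ℝ, P) 𝓘(ℝ, E) ∞ (fun z => extChartAt 𝓘(ℝ, E) x₀ (X z).1) z₀ :=
        ContMDiffAt.comp z₀ (contMDiffAt_extChartAt (x := x₀)) hX'.1
      have hτ : ContMDiffAt (𝓘(ℝ, P).prod 𝓘(ℝ, ℝ)) 𝓘(ℝ, ℝ) ∞ (fun q : P × ℝ => q.2) (z₀, 0) :=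
        contMDiffAt_snd
      exact (ContMDiffAt.comp (z₀, (0 : ℝ)) ha contMDiffAt_fst).add
        (hτ.smul (ContMDiffAt.comp (z₀, (0 : ℝ)) hX'.2 contMDiffAt_fst))
    have h2 : ContMDiffAt 𝓘(ℝ, E) 𝓘(ℝ, E) ∞ (extChartAt 𝓘(ℝ, E) x₀).symm
        (extChartAt 𝓘(ℝ, E) x₀ x₀) :=
      (contMDiffOn_extChartAt_symm x₀).contMDiffAt (extChartAt_target_mem_nhds x₀)
    refine ContMDiffAt.comp_of_eq (y := extChartAt 𝓘(ℝ, E) x₀ x₀) h2 h1 ?_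
    simp [hx₀]
  · have := hX'.1.continuousAt.preimage_mem_nhds ((chartAt E x₀).open_source.mem_nhds
      (mem_chart_source E x₀))
    filter_upwards [this] with z hz
    exact isVelocity_chart_line x₀ (X z) hz

variable {E' N' : Type*} [NormedAddCommGroup E'] [NormedSpace ℝ E']
  [TopologicalSpace N'] [ChartedSpace E' N'] [IsManifold 𝓘(ℝ, E') ∞ N']

omit [IsManifold 𝓘(ℝ, E) ∞ N] [IsManifold 𝓘(ℝ, E') ∞ N'] in
/-- Near any point, a submersion admits a smooth projection of the total space onto the fibres,
depending smoothly on the fibre. -/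
theorem Manifold.IsSubmersion.exists_fibre_projection {s : N → N'}
    (hs : Manifold.IsSubmersion 𝓘(ℝ, E) 𝓘(ℝ, E') ∞ s) (g₀ : N) :
    ∃ Ψ : N' × N → N, ContMDiffAt (𝓘(ℝ, E').prod 𝓘(ℝ, E)) 𝓘(ℝ, E) ∞ Ψ (s g₀, g₀) ∧
      (∀ᶠ q in 𝓝 (s g₀, g₀), s (Ψ q) = q.1) ∧ ∀ᶠ g in 𝓝 g₀, Ψ (s g, g) = g := by
  -- Local normal form: in suitable charts `s` is the projection `E' × F → E'`, with `L` the
  -- splitting of `E`.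
  obtain ⟨F, _, _, h⟩ := hs.isSubmersionAt g₀
  set φ := h.domChart.extend 𝓘(ℝ, E) with hφ
  set ψ := h.codChart.extend 𝓘(ℝ, E') with hψ
  set L := h.equiv
  have hgs : g₀ ∈ h.domChart.source := h.mem_domChart_source
  have hφs : φ.source = h.domChart.source := OpenPartialHomeomorph.extend_source _
  have hψs : ψ.source = h.codChart.source := OpenPartialHomeomorph.extend_source _
  have hφt : φ.target = h.domChart.target := by simp [hφ]
  have key : ∀ g ∈ φ.source, (L (φ g)).1 = ψ (s g) := by
    intro g hg
    have := h.writtenInCharts (φ.map_source hg)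
    simp only [Function.comp] at this
    rw [← hφ, φ.left_inv hg] at this
    exact this.symm
  have hφsm : ContMDiffAt 𝓘(ℝ, E) 𝓘(ℝ, E) ∞ φ g₀ :=
    OpenPartialHomeomorph.contMDiffAt_extend h.domChart_mem_maximalAtlas hgs
  have hψsm : ContMDiffAt 𝓘(ℝ, E') 𝓘(ℝ, E') ∞ ψ (s g₀) :=
    OpenPartialHomeomorph.contMDiffAt_extend h.codChart_mem_maximalAtlas h.mem_codChart_source
  have htarget : φ.target ∈ 𝓝 (φ g₀) := by
    rw [hφt]
    refine h.domChart.open_target.mem_nhds ?_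
    rw [← hφt]
    exact φ.map_source (hφs ▸ hgs)
  have hφsymm : ContMDiffAt 𝓘(ℝ, E) 𝓘(ℝ, E) ∞ φ.symm (φ g₀) := by
    have := contMDiffOn_extend_symm h.domChart_mem_maximalAtlas
    refine this.contMDiffAt ?_
    simpa [hφt] using htarget
  have hinner : ContMDiffAt (𝓘(ℝ, E').prod 𝓘(ℝ, E)) 𝓘(ℝ, E) ∞
      (fun q : N' × N => L.symm (ψ q.1, (L (φ q.2)).2)) (s g₀, g₀) := by
    have h1 : ContMDiffAt (𝓘(ℝ, E').prod 𝓘(ℝ, E)) 𝓘(ℝ, E') ∞ (fun q : N' × N => ψ q.1)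
        (s g₀, g₀) := ContMDiffAt.comp (s g₀, g₀) hψsm contMDiffAt_fst
    have h2 : ContMDiffAt (𝓘(ℝ, E').prod 𝓘(ℝ, E)) 𝓘(ℝ, E) ∞ (fun q : N' × N => φ q.2)
        (s g₀, g₀) := ContMDiffAt.comp (s g₀, g₀) hφsm contMDiffAt_snd
    have h3 : ContMDiffAt (𝓘(ℝ, E').prod 𝓘(ℝ, E)) 𝓘(ℝ, F) ∞ (fun q : N' × N => (L (φ q.2)).2)
        (s g₀, g₀) :=
      ContMDiffAt.comp (I' := 𝓘(ℝ, E)) (g := fun y : E => (L y).2) (s g₀, g₀)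
        (((ContinuousLinearMap.snd ℝ E' F).comp
          (L : E →L[ℝ] E' × F)).contMDiff.contMDiffAt) h2
    exact ContMDiffAt.comp (s g₀, g₀) ((L.symm : E' × F →L[ℝ] E).contMDiff.contMDiffAt)
      (h1.prodMk_space h3)
  have hpt : ∀ g ∈ φ.source, L.symm (ψ (s g), (L (φ g)).2) = φ g := by
    intro g hg
    rw [← key g hg]
    exact L.symm_apply_apply _
  have hsrc : ∀ᶠ g in 𝓝 g₀, g ∈ φ.source := by
    rw [hφs]; exact h.domChart.open_source.mem_nhds hgs
  have hg₀ : g₀ ∈ φ.source := hφs ▸ hgs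
  -- Keep the fibre coordinate of `q.2` and replace its base coordinate by that of `q.1`.
  refine ⟨fun q => φ.symm (L.symm (ψ q.1, (L (φ q.2)).2)), ?_, ?_, ?_⟩
  · exact ContMDiffAt.comp_of_eq (y := φ g₀) hφsymm hinner (hpt g₀ hg₀)
  · have e1 : ∀ᶠ q : N' × N in 𝓝 (s g₀, g₀), L.symm (ψ q.1, (L (φ q.2)).2) ∈ φ.target := by
      refine hinner.continuousAt.preimage_mem_nhds ?_
      show φ.target ∈ 𝓝 (L.symm (ψ (s g₀), (L (φ g₀)).2))
      rw [hpt g₀ hg₀]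
      exact htarget
    have e2 : ∀ᶠ q : N' × N in 𝓝 (s g₀, g₀), q.1 ∈ ψ.source := by
      rw [hψs]
      exact continuousAt_fst.preimage_mem_nhds
        (h.codChart.open_source.mem_nhds h.mem_codChart_source)
    filter_upwards [e1, e2] with q hq1 hq2
    refine ψ.injOn ?_ hq2 ?_
    · rw [hψs]
      exact h.source_subset_preimage_source (hφs ▸ φ.map_target hq1)
    · rw [← key _ (φ.map_target hq1), φ.right_inv hq1, L.apply_symm_apply]
  · filter_upwards [hsrc] with g hg
    simp only [hpt g hg]
    exact φ.left_inv hg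

/-- Families of tangent vectors are the velocities of families of curves lying over a prescribed
family of curves in the base of a submersion. -/
theorem Manifold.IsSubmersion.exists_isVelocityFamily {s : N → N'}
    (hs : Manifold.IsSubmersion 𝓘(ℝ, E) 𝓘(ℝ, E') ∞ s) (hs' : ContMDiff 𝓘(ℝ, E) 𝓘(ℝ, E') ∞ s)
    {X : P → TangentBundle 𝓘(ℝ, E) N} {z₀ : P}
    (hX : ContMDiffAt 𝓘(ℝ, P) 𝓘(ℝ, E).tangent ∞ X z₀) {κ : P → ℝ → N'}
    (hκ : IsVelocityFamily κ (fun z => tangentMap 𝓘(ℝ, E) 𝓘(ℝ, E') s (X z)) z₀) :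
    ∃ Γ : P → ℝ → N, IsVelocityFamily Γ X z₀ ∧
      ∀ᶠ q : P × ℝ in 𝓝 (z₀, 0), s (Γ q.1 q.2) = κ q.1 q.2 := by
  obtain ⟨Γ, hΓ, hv⟩ := hX.exists_isVelocityFamily
  have hb : Γ z₀ 0 = (X z₀).1 := hv.self_of_nhds.apply_zero
  have hκ0 : κ z₀ 0 = s (X z₀).1 := hκ.2.self_of_nhds.apply_zero
  obtain ⟨Ψ, hΨ, hΨs, hΨi⟩ := hs.exists_fibre_projection (X z₀).1
  have hcont : ContinuousAt (fun q : P × ℝ => (κ q.1 q.2, Γ q.1 q.2)) (z₀, 0) :=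
    hκ.1.continuousAt.prodMk hΓ.continuousAt
  have ht : Tendsto (fun q : P × ℝ => (κ q.1 q.2, Γ q.1 q.2)) (𝓝 (z₀, 0))
      (𝓝 (s (X z₀).1, (X z₀).1)) := by
    have := hcont.tendsto
    simp only [hb, hκ0] at this
    exact this
  -- An arbitrary family `Γ` with velocities `X` is moved into the fibres over `κ`.
  refine ⟨fun z τ => Ψ (κ z τ, Γ z τ), ⟨?_, ?_⟩, ?_⟩
  · exact ContMDiffAt.comp_of_eq (y := (s (X z₀).1, (X z₀).1)) hΨ (hκ.1.prodMk hΓ)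
      (Prod.ext hκ0 hb)
  · have hXc : Tendsto (fun z => (X z).1) (𝓝 z₀) (𝓝 (X z₀).1) :=
      (Bundle.contMDiffAt_totalSpace.1 hX).1.continuousAt.tendsto
    have hd := hΨ.eventually_mdifferentiableAt
    have hd' : ∀ᶠ z in 𝓝 z₀, MDifferentiableAt (𝓘(ℝ, E').prod 𝓘(ℝ, E)) 𝓘(ℝ, E) Ψ
        (s (X z).1, (X z).1) :=
      ((hs'.continuous.tendsto _).comp hXc |>.prodMk_nhds hXc).eventually hd
    filter_upwards [hv, hκ.2, hd', hXc.eventually hΨi.eventually_nhds] with z h1 h2 h3 h4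
    have h5 : IsVelocity (fun τ => s (Γ z τ)) (tangentMap 𝓘(ℝ, E) 𝓘(ℝ, E') s (X z)) :=
      h1.comp (hs'.mdifferentiableAt (by simp))
    have h3' := mdifferentiableWithinAt_univ.2 h3
    -- The projection does not change the velocity: `κ` and `s ∘ Γ` have the same one, and `Ψ (s ∘
    -- Γ, Γ) = Γ` near time zero.
    have h6 := h2.comp₂_within h1 h3' (by simp)
    have h7 := h5.comp₂_within h1 h3' (by simp)
    have h8 : IsVelocity (fun τ => Ψ (s (Γ z τ), Γ z τ)) (X z) := by
      refine ⟨h7.1, ?_⟩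
      have hc : (fun τ => Ψ (s (Γ z τ), Γ z τ)) =ᶠ[𝓝 0] Γ z := by
        have : Tendsto (Γ z) (𝓝 0) (𝓝 (X z).1) := by
          rw [← h1.apply_zero]; exact h1.1.continuousAt
        exact this.eventually h4
      exact (IsVelocity.unique ⟨h7.1, rfl⟩ h1 hc)
    rw [h7.unique h8 (Eventually.of_forall fun _ => rfl)] at h6
    exact h6
  · exact ht.eventually hΨs

end Velocity

/-! ### Groupoids without smooth structure -/

/-- A groupoid, with a totally defined multiplication that is meaningful on composable pairs. -/
structure AlgGroupoid (Γ B : Type*) where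
  s : Γ → B
  t : Γ → B
  u : B → Γ
  inv : Γ → Γ
  mul : Γ → Γ → Γ
  s_u : ∀ x, s (u x) = x
  t_u : ∀ x, t (u x) = x
  s_mul : ∀ g h, s g = t h → s (mul g h) = s h
  t_mul : ∀ g h, s g = t h → t (mul g h) = t g
  mul_assoc : ∀ g h k, s g = t h → s h = t k → mul (mul g h) k = mul g (mul h k)
  u_mul : ∀ g, mul (u (t g)) g = g
  mul_u : ∀ g, mul g (u (s g)) = g
  s_inv : ∀ g, s (inv g) = t g
  t_inv : ∀ g, t (inv g) = s g
  inv_mul : ∀ g, mul (inv g) g = u (s g)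
  mul_inv : ∀ g, mul g (inv g) = u (t g)

namespace AlgGroupoid

variable {Γ B : Type*} (𝒢 : AlgGroupoid Γ B) {a b c : Γ}

/-- Division. -/
def div (a b : Γ) : Γ := 𝒢.mul a (𝒢.inv b)

theorem mul_div_cancel (h : 𝒢.s a = 𝒢.t b) : 𝒢.div (𝒢.mul a b) b = a := by
  rw [div, 𝒢.mul_assoc _ _ _ h (𝒢.t_inv _).symm, 𝒢.mul_inv, ← h, 𝒢.mul_u]

theorem div_mul_cancel (h : 𝒢.s a = 𝒢.s b) : 𝒢.mul (𝒢.div a b) b = a := by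
  rw [div, 𝒢.mul_assoc _ _ _ (by rw [h, 𝒢.t_inv]) (𝒢.s_inv _), 𝒢.inv_mul, ← h, 𝒢.mul_u]

theorem s_div (h : 𝒢.s a = 𝒢.s b) : 𝒢.s (𝒢.div a b) = 𝒢.t b := by
  rw [div, 𝒢.s_mul _ _ (by rw [h, 𝒢.t_inv]), 𝒢.s_inv]

theorem t_div (h : 𝒢.s a = 𝒢.s b) : 𝒢.t (𝒢.div a b) = 𝒢.t a := by
  rw [div, 𝒢.t_mul _ _ (by rw [h, 𝒢.t_inv])]

theorem eq_div_of_mul_eq (ha : 𝒢.s a = 𝒢.t b) (h : 𝒢.mul a b = c) : a = 𝒢.div c b := by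
  rw [← h, 𝒢.mul_div_cancel ha]

/-- Both sides give `a c⁻¹` when multiplied by `b c⁻¹` on the right. In the tangent groupoid this is
the cancellation of the iterated `dm̄` terms in `δ²`. -/
theorem div_div (ha : 𝒢.s a = 𝒢.s c) (hb : 𝒢.s b = 𝒢.s c) :
    𝒢.div (𝒢.div a c) (𝒢.div b c) = 𝒢.div a b := by
  have hab : 𝒢.s a = 𝒢.s b := ha.trans hb.symm
  refine (𝒢.eq_div_of_mul_eq ?_ ?_).symm
  · rw [𝒢.s_div hab, 𝒢.t_div hb]
  · refine 𝒢.eq_div_of_mul_eq ?_ ?_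
    · rw [𝒢.s_mul _ _ (by rw [𝒢.s_div hab, 𝒢.t_div hb]), 𝒢.s_div hb]
    · rw [𝒢.mul_assoc _ _ _ (by rw [𝒢.s_div hab, 𝒢.t_div hb]) (𝒢.s_div hb),
        𝒢.div_mul_cancel hb, 𝒢.div_mul_cancel hab]

theorem mul_div_mul (h : 𝒢.s a = 𝒢.t c) (h' : 𝒢.s b = 𝒢.t c) :
    𝒢.div (𝒢.mul a c) (𝒢.mul b c) = 𝒢.div a b := by
  have := 𝒢.div_div (a := 𝒢.mul a c) (b := 𝒢.mul b c) (c := c) (𝒢.s_mul _ _ h) (𝒢.s_mul _ _ h')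
  rw [← this, 𝒢.mul_div_cancel h, 𝒢.mul_div_cancel h']

theorem inv_inv (a : Γ) : 𝒢.inv (𝒢.inv a) = a := by
  have h1 := 𝒢.u_mul (𝒢.inv (𝒢.inv a))
  rw [𝒢.t_inv, 𝒢.s_inv, ← 𝒢.mul_inv a, 𝒢.mul_assoc _ _ _ (𝒢.t_inv a).symm (𝒢.t_inv _).symm,
    𝒢.mul_inv, 𝒢.t_inv, 𝒢.mul_u] at h1
  exact h1.symm

theorem div_eq_mul_inv_right (h : 𝒢.s a = 𝒢.t b) (h' : 𝒢.s c = 𝒢.s b) :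
    𝒢.div (𝒢.mul a b) c = 𝒢.mul a (𝒢.div b c) := by
  rw [div, div, 𝒢.mul_assoc _ _ _ h (by rw [𝒢.t_inv, h'])]

/-- `c (b c)⁻¹ = b⁻¹` -/
theorem div_mul_self (h : 𝒢.s b = 𝒢.t c) : 𝒢.div c (𝒢.mul b c) = 𝒢.inv b := by
  have h1 := 𝒢.mul_div_mul (a := 𝒢.u (𝒢.t c)) (b := b) (c := c) (𝒢.s_u _) h
  rw [𝒢.u_mul] at h1
  rw [h1, div, ← h, ← 𝒢.t_inv b, 𝒢.u_mul]

end AlgGroupoid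

/-! ### Single curves through a tangent vector -/

section Curves

variable {E N : Type*} [NormedAddCommGroup E] [NormedSpace ℝ E]
  [TopologicalSpace N] [ChartedSpace E N] [IsManifold 𝓘(ℝ, E) ∞ N]
  {E' N' : Type*} [NormedAddCommGroup E'] [NormedSpace ℝ E']
  [TopologicalSpace N'] [ChartedSpace E' N'] [IsManifold 𝓘(ℝ, E') ∞ N']
  {P : Type*} [NormedAddCommGroup P] [NormedSpace ℝ P]

theorem exists_curve (X : TangentBundle 𝓘(ℝ, E) N) :
    ∃ c : ℝ → N, ContMDiffAt 𝓘(ℝ, ℝ) 𝓘(ℝ, E) ∞ c 0 ∧ IsVelocity c X := by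
  obtain ⟨Γ, h1, h2⟩ := ContMDiffAt.exists_isVelocityFamily (P := ℝ) (z₀ := 0)
    (contMDiffAt_const (c := X))
  exact ⟨Γ 0, h1.comp (0 : ℝ) (contMDiffAt_const.prodMk contMDiffAt_id), h2.self_of_nhds⟩

theorem Manifold.IsSubmersion.exists_curve {s : N → N'}
    (hs : Manifold.IsSubmersion 𝓘(ℝ, E) 𝓘(ℝ, E') ∞ s) (hs' : ContMDiff 𝓘(ℝ, E) 𝓘(ℝ, E') ∞ s)
    (X : TangentBundle 𝓘(ℝ, E) N) {κ : ℝ → N'} (hκ : ContMDiffAt 𝓘(ℝ, ℝ) 𝓘(ℝ, E') ∞ κ 0)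
    (hκv : IsVelocity κ (tangentMap 𝓘(ℝ, E) 𝓘(ℝ, E') s X)) :
    ∃ c : ℝ → N, ContMDiffAt 𝓘(ℝ, ℝ) 𝓘(ℝ, E) ∞ c 0 ∧ IsVelocity c X ∧
      ∀ᶠ τ in 𝓝 0, s (c τ) = κ τ := by
  obtain ⟨Γ, ⟨h1, h2⟩, h3⟩ := hs.exists_isVelocityFamily hs' (P := ℝ) (z₀ := 0)
    (contMDiffAt_const (c := X)) (κ := fun _ => κ)
    ⟨ContMDiffAt.comp ((0 : ℝ), (0 : ℝ)) hκ contMDiffAt_snd, Eventually.of_forall fun _ => hκv⟩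
  refine ⟨Γ 0, h1.comp (0 : ℝ) (contMDiffAt_const.prodMk contMDiffAt_id), h2.self_of_nhds, ?_⟩
  have : Tendsto (fun τ : ℝ => ((0 : ℝ), τ)) (𝓝 0) (𝓝 ((0 : ℝ), (0 : ℝ))) :=
    (Continuous.prodMk_right (0 : ℝ)).tendsto 0
  exact this.eventually h3

omit [IsManifold 𝓘(ℝ, E) ∞ N] [IsManifold 𝓘(ℝ, E') ∞ N'] in
theorem IsVelocityFamily.comp {Γ : P → ℝ → N} {X : P → TangentBundle 𝓘(ℝ, E) N} {z₀ : P}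
    (h : IsVelocityFamily Γ X z₀) {f : N → N'} (hf : ContMDiff 𝓘(ℝ, E) 𝓘(ℝ, E') ∞ f) :
    IsVelocityFamily (fun z τ => f (Γ z τ))
      (fun z => tangentMap 𝓘(ℝ, E) 𝓘(ℝ, E') f (X z)) z₀ := by
  refine ⟨hf.contMDiffAt.comp (z₀, (0 : ℝ)) h.1, ?_⟩
  filter_upwards [h.2] with z hz
  exact hz.comp (hf.mdifferentiableAt (by simp))

end Curves

/-! ### The tangent groupoid `TG ⇉ TM` -/

namespace LieGroupoid

variable {EG EM G M : Type*}
  [NormedAddCommGroup EG] [NormedSpace ℝ EG] [NormedAddCommGroup EM] [NormedSpace ℝ EM]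
  [TopologicalSpace G] [ChartedSpace EG G] [TopologicalSpace M] [ChartedSpace EM M]
  (𝒢 : LieGroupoid EG EM G M)

/-- The groupoid underlying a Lie groupoid. -/
def toAlg : AlgGroupoid G M where
  s := 𝒢.s
  t := 𝒢.t
  u := 𝒢.u
  inv := 𝒢.inv
  mul := 𝒢.mul
  s_u := 𝒢.s_u
  t_u := 𝒢.t_u
  s_mul := 𝒢.s_mul
  t_mul := 𝒢.t_mul
  mul_assoc := 𝒢.mul_assoc
  u_mul := 𝒢.u_mul
  mul_u := 𝒢.mul_u
  s_inv := 𝒢.s_inv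
  t_inv := 𝒢.t_inv
  inv_mul := 𝒢.inv_mul
  mul_inv := 𝒢.mul_inv

/-- The differential of the source, on the tangent bundle. -/
abbrev Ts (X : TangentBundle 𝓘(ℝ, EG) G) : TangentBundle 𝓘(ℝ, EM) M :=
  tangentMap 𝓘(ℝ, EG) 𝓘(ℝ, EM) 𝒢.s X

/-- The differential of the target, on the tangent bundle. -/
abbrev Tt (X : TangentBundle 𝓘(ℝ, EG) G) : TangentBundle 𝓘(ℝ, EM) M :=
  tangentMap 𝓘(ℝ, EG) 𝓘(ℝ, EM) 𝒢.t X

/-- The differential of the unit, on the tangent bundle. -/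
abbrev Tu (X : TangentBundle 𝓘(ℝ, EM) M) : TangentBundle 𝓘(ℝ, EG) G :=
  tangentMap 𝓘(ℝ, EM) 𝓘(ℝ, EG) 𝒢.u X

/-- The differential of the inversion, on the tangent bundle. -/
abbrev Ti (X : TangentBundle 𝓘(ℝ, EG) G) : TangentBundle 𝓘(ℝ, EG) G :=
  tangentMap 𝓘(ℝ, EG) 𝓘(ℝ, EG) 𝒢.inv X

/-- The differential of the multiplication, on the tangent bundle. -/
def Tm (X Y : TangentBundle 𝓘(ℝ, EG) G) : TangentBundle 𝓘(ℝ, EG) G :=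
  ⟨𝒢.mul X.1 Y.1, 𝒢.dm X.1 Y.1 (X.2, Y.2)⟩

-- This gives `dm` its meaning: on composable vectors it is the velocity of a product of composable
-- curves, whatever derivative within `{s p = t q}` has been chosen.
variable {𝒢} in
theorem isVelocity_mul [IsManifold 𝓘(ℝ, EG) ∞ G] {c d : ℝ → G} {X Y : TangentBundle 𝓘(ℝ, EG) G}
    (hX : IsVelocity c X) (hY : IsVelocity d Y) (h : ∀ᶠ τ in 𝓝 0, 𝒢.s (c τ) = 𝒢.t (d τ)) :
    IsVelocity (fun τ => 𝒢.mul (c τ) (d τ)) (𝒢.Tm X Y) := by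
  have h0 : 𝒢.s X.1 = 𝒢.t Y.1 := by
    rw [← hX.apply_zero, ← hY.apply_zero]; exact h.self_of_nhds
  exact hX.comp₂_within hY (f := fun p : G × G => 𝒢.mul p.1 p.2)
    (S := {p | 𝒢.s p.1 = 𝒢.t p.2})
    ((𝒢.mul_smooth (X.1, Y.1) h0).mdifferentiableWithinAt (by simp)) h

variable {𝒢} in
theorem _root_.IsVelocityFamily.mul {P : Type*} [NormedAddCommGroup P] [NormedSpace ℝ P]
    [IsManifold 𝓘(ℝ, EG) ∞ G] {c d : P → ℝ → G} {X Y : P → TangentBundle 𝓘(ℝ, EG) G} {z₀ : P}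
    (hX : IsVelocityFamily c X z₀) (hY : IsVelocityFamily d Y z₀)
    (h : ∀ᶠ q : P × ℝ in 𝓝 (z₀, 0), 𝒢.s (c q.1 q.2) = 𝒢.t (d q.1 q.2)) :
    IsVelocityFamily (fun z τ => 𝒢.mul (c z τ) (d z τ)) (fun z => 𝒢.Tm (X z) (Y z)) z₀ := by
  refine ⟨?_, ?_⟩
  · have h1 : ContMDiffWithinAt (𝓘(ℝ, P).prod 𝓘(ℝ, ℝ)) 𝓘(ℝ, EG) ∞
        ((fun p : G × G => 𝒢.mul p.1 p.2) ∘ fun q : P × ℝ => (c q.1 q.2, d q.1 q.2))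
        ((fun q : P × ℝ => (c q.1 q.2, d q.1 q.2)) ⁻¹' {p | 𝒢.s p.1 = 𝒢.t p.2}) (z₀, 0) :=
      ContMDiffWithinAt.comp (z₀, (0 : ℝ)) (𝒢.mul_smooth (c z₀ 0, d z₀ 0) h.self_of_nhds)
        (hX.1.prodMk hY.1).contMDiffWithinAt (Set.mapsTo_preimage _ _)
    exact h1.contMDiffAt h
  · have h' : ∀ᶠ z in 𝓝 z₀, ∀ᶠ τ in 𝓝 (0 : ℝ), 𝒢.s (c z τ) = 𝒢.t (d z τ) := h.curry_nhds
    filter_upwards [hX.2, hY.2, h'] with z h1 h2 h3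
    exact isVelocity_mul h1 h2 h3

variable [IsManifold 𝓘(ℝ, EG) ∞ G] [IsManifold 𝓘(ℝ, EM) ∞ M]

theorem exists_curve_over (X : TangentBundle 𝓘(ℝ, EG) G) {κ : ℝ → M}
    (hκ : ContMDiffAt 𝓘(ℝ, ℝ) 𝓘(ℝ, EM) ∞ κ 0) (hκv : IsVelocity κ (𝒢.Ts X)) :
    ∃ c : ℝ → G, ContMDiffAt 𝓘(ℝ, ℝ) 𝓘(ℝ, EG) ∞ c 0 ∧ IsVelocity c X ∧
      ∀ᶠ τ in 𝓝 0, 𝒢.s (c τ) = κ τ :=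
  𝒢.s_submersion.exists_curve 𝒢.s.contMDiff X hκ hκv

omit [IsManifold 𝓘(ℝ, EG) ∞ G] [IsManifold 𝓘(ℝ, EM) ∞ M] in
theorem isVelocity_s {c : ℝ → G} {X : TangentBundle 𝓘(ℝ, EG) G} (h : IsVelocity c X) :
    IsVelocity (fun τ => 𝒢.s (c τ)) (𝒢.Ts X) := h.comp (𝒢.s.contMDiff.mdifferentiableAt (by simp))

omit [IsManifold 𝓘(ℝ, EG) ∞ G] [IsManifold 𝓘(ℝ, EM) ∞ M] in
theorem isVelocity_t {c : ℝ → G} {X : TangentBundle 𝓘(ℝ, EG) G} (h : IsVelocity c X) :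
    IsVelocity (fun τ => 𝒢.t (c τ)) (𝒢.Tt X) := h.comp (𝒢.t.contMDiff.mdifferentiableAt (by simp))

omit [IsManifold 𝓘(ℝ, EG) ∞ G] [IsManifold 𝓘(ℝ, EM) ∞ M] in
theorem isVelocity_u {c : ℝ → M} {X : TangentBundle 𝓘(ℝ, EM) M} (h : IsVelocity c X) :
    IsVelocity (fun τ => 𝒢.u (c τ)) (𝒢.Tu X) := h.comp (𝒢.u.contMDiff.mdifferentiableAt (by simp))

omit [IsManifold 𝓘(ℝ, EG) ∞ G] [IsManifold 𝓘(ℝ, EM) ∞ M] in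
theorem isVelocity_inv {c : ℝ → G} {X : TangentBundle 𝓘(ℝ, EG) G} (h : IsVelocity c X) :
    IsVelocity (fun τ => 𝒢.inv (c τ)) (𝒢.Ti X) :=
  h.comp (𝒢.inv.contMDiff.mdifferentiableAt (by simp))

/-- Composable tangent vectors are the velocities of composable curves. -/
theorem exists_composable_curves {X Y : TangentBundle 𝓘(ℝ, EG) G} (h : 𝒢.Ts X = 𝒢.Tt Y)
    {d : ℝ → G} (hd : ContMDiffAt 𝓘(ℝ, ℝ) 𝓘(ℝ, EG) ∞ d 0) (hd' : IsVelocity d Y) :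
    ∃ c : ℝ → G, ContMDiffAt 𝓘(ℝ, ℝ) 𝓘(ℝ, EG) ∞ c 0 ∧ IsVelocity c X ∧
      ∀ᶠ τ in 𝓝 0, 𝒢.s (c τ) = 𝒢.t (d τ) :=
  𝒢.exists_curve_over X (𝒢.t.contMDiff.contMDiffAt.comp (0 : ℝ) hd) (h ▸ 𝒢.isVelocity_t hd')

/-- The tangent groupoid `TG ⇉ TM`. -/
def tangent : AlgGroupoid (TangentBundle 𝓘(ℝ, EG) G) (TangentBundle 𝓘(ℝ, EM) M) where
  s := 𝒢.Ts
  t := 𝒢.Tt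
  u := 𝒢.Tu
  inv := 𝒢.Ti
  mul := 𝒢.Tm
  -- Every axiom is proved by representing the vectors by curves, applying the axiom of `G` at each
  -- time, and comparing velocities.
  s_u X := by
    obtain ⟨c, -, hc⟩ := exists_curve X
    exact (𝒢.isVelocity_s (𝒢.isVelocity_u hc)).unique hc (Eventually.of_forall fun _ => 𝒢.s_u _)
  t_u X := by
    obtain ⟨c, -, hc⟩ := exists_curve X
    exact (𝒢.isVelocity_t (𝒢.isVelocity_u hc)).unique hc (Eventually.of_forall fun _ => 𝒢.t_u _)
  s_mul X Y h := by
    obtain ⟨d, hd, hY⟩ := exists_curve Y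
    obtain ⟨c, hc, hX, hcd⟩ := 𝒢.exists_composable_curves h hd hY
    exact (𝒢.isVelocity_s (isVelocity_mul hX hY hcd)).unique (𝒢.isVelocity_s hY)
      (hcd.mono fun τ hτ => 𝒢.s_mul _ _ hτ)
  t_mul X Y h := by
    obtain ⟨d, hd, hY⟩ := exists_curve Y
    obtain ⟨c, hc, hX, hcd⟩ := 𝒢.exists_composable_curves h hd hY
    exact (𝒢.isVelocity_t (isVelocity_mul hX hY hcd)).unique (𝒢.isVelocity_t hX)
      (hcd.mono fun τ hτ => 𝒢.t_mul _ _ hτ)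
  mul_assoc X Y Z h h' := by
    -- Curves are chosen from right to left, since each new curve has to be lifted through `s` over
    -- the targets of the previous one.
    obtain ⟨e, he, hZ⟩ := exists_curve Z
    obtain ⟨d, hd, hY, hde⟩ := 𝒢.exists_composable_curves h' he hZ
    obtain ⟨c, hc, hX, hcd⟩ := 𝒢.exists_composable_curves h hd hY
    refine IsVelocity.unique (isVelocity_mul (isVelocity_mul hX hY hcd) hZ ?_)
      (isVelocity_mul hX (isVelocity_mul hY hZ hde) ?_) ?_
    · filter_upwards [hcd, hde] with τ h1 h2
      rw [𝒢.s_mul _ _ h1, h2]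
    · filter_upwards [hcd, hde] with τ h1 h2
      rw [𝒢.t_mul _ _ h2, h1]
    · filter_upwards [hcd, hde] with τ h1 h2
      exact 𝒢.mul_assoc _ _ _ h1 h2
  u_mul X := by
    obtain ⟨c, -, hc⟩ := exists_curve X
    exact (isVelocity_mul (𝒢.isVelocity_u (𝒢.isVelocity_t hc)) hc
      (Eventually.of_forall fun _ => 𝒢.s_u _)).unique hc (Eventually.of_forall fun _ => 𝒢.u_mul _)
  mul_u X := by
    obtain ⟨c, -, hc⟩ := exists_curve X
    exact (isVelocity_mul hc (𝒢.isVelocity_u (𝒢.isVelocity_s hc))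
      (Eventually.of_forall fun _ => (𝒢.t_u _).symm)).unique hc
      (Eventually.of_forall fun _ => 𝒢.mul_u _)
  s_inv X := by
    obtain ⟨c, -, hc⟩ := exists_curve X
    exact (𝒢.isVelocity_s (𝒢.isVelocity_inv hc)).unique (𝒢.isVelocity_t hc)
      (Eventually.of_forall fun _ => 𝒢.s_inv _)
  t_inv X := by
    obtain ⟨c, -, hc⟩ := exists_curve X
    exact (𝒢.isVelocity_t (𝒢.isVelocity_inv hc)).unique (𝒢.isVelocity_s hc)
      (Eventually.of_forall fun _ => 𝒢.t_inv _)
  inv_mul X := by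
    obtain ⟨c, -, hc⟩ := exists_curve X
    exact (isVelocity_mul (𝒢.isVelocity_inv hc) hc
      (Eventually.of_forall fun _ => 𝒢.s_inv _)).unique (𝒢.isVelocity_u (𝒢.isVelocity_s hc))
      (Eventually.of_forall fun _ => 𝒢.inv_mul _)
  mul_inv X := by
    obtain ⟨c, -, hc⟩ := exists_curve X
    exact (isVelocity_mul hc (𝒢.isVelocity_inv hc)
      (Eventually.of_forall fun _ => (𝒢.t_inv _).symm)).unique (𝒢.isVelocity_u (𝒢.isVelocity_t hc))
      (Eventually.of_forall fun _ => 𝒢.mul_inv _)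

/-! ### Smooth families in the tangent groupoid -/

section Families

variable {P : Type*} [NormedAddCommGroup P] [NormedSpace ℝ P]
  {X Y : P → TangentBundle 𝓘(ℝ, EG) G}

/-- Near each parameter the two families are the velocities of composable smooth families of curves,
and the product of these is a smooth family of curves with velocities `Tm`. No manifold structure on
the set of composable pairs is needed. -/
theorem contMDiff_Tm (hX : ContMDiff 𝓘(ℝ, P) 𝓘(ℝ, EG).tangent ∞ X)
    (hY : ContMDiff 𝓘(ℝ, P) 𝓘(ℝ, EG).tangent ∞ Y) (h : ∀ z, 𝒢.Ts (X z) = 𝒢.Tt (Y z)) :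
    ContMDiff 𝓘(ℝ, P) 𝓘(ℝ, EG).tangent ∞ (fun z => 𝒢.Tm (X z) (Y z)) := by
  intro z₀
  obtain ⟨d, hd⟩ := (hY z₀).exists_isVelocityFamily
  have hκ := hd.comp 𝒢.t.contMDiff
  have hκ' : IsVelocityFamily (fun z τ => 𝒢.t (d z τ)) (fun z => 𝒢.Ts (X z)) z₀ := by
    simpa only [h] using hκ
  obtain ⟨c, hc, hcd⟩ := 𝒢.s_submersion.exists_isVelocityFamily 𝒢.s.contMDiff (hX z₀) hκ'
  exact (hc.mul hd hcd).contMDiffAt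

theorem contMDiff_tangentMap_comp {E N E' N' : Type*} [NormedAddCommGroup E] [NormedSpace ℝ E]
    [TopologicalSpace N] [ChartedSpace E N] [IsManifold 𝓘(ℝ, E) ∞ N]
    [NormedAddCommGroup E'] [NormedSpace ℝ E']
    [TopologicalSpace N'] [ChartedSpace E' N'] [IsManifold 𝓘(ℝ, E') ∞ N']
    {f : N → N'} (hf : ContMDiff 𝓘(ℝ, E) 𝓘(ℝ, E') ∞ f) {X : P → TangentBundle 𝓘(ℝ, E) N}
    (hX : ContMDiff 𝓘(ℝ, P) 𝓘(ℝ, E).tangent ∞ X) :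
    ContMDiff 𝓘(ℝ, P) 𝓘(ℝ, E').tangent ∞ (fun z => tangentMap 𝓘(ℝ, E) 𝓘(ℝ, E') f (X z)) := by
  have : IsManifold 𝓘(ℝ, E) 1 N := IsManifold.of_le (n := ∞) (by simp)
  have : IsManifold 𝓘(ℝ, E') 1 N' := IsManifold.of_le (n := ∞) (by simp)
  exact (hf.contMDiff_tangentMap (m := ∞) (by simp)).comp hX

end Families

end LieGroupoid

/-! ### Transport -/

section Transport

variable {B : Type*} {E : B → Type*} [∀ x, AddCommGroup (E x)] [∀ x, Module ℝ (E x)]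

@[simp]
theorem transport_rfl {x : B} (h : x = x) (v : E x) : transport E h v = v := rfl

theorem transport_transport {x y z : B} (h : x = y) (h' : y = z) (v : E x) :
    transport E h' (transport E h v) = transport E (h.trans h') v := by
  cases h; cases h'; rfl

theorem transport_eq_iff {x y : B} (h : x = y) {v : E x} {w : E y} :
    transport E h v = w ↔ v = transport E h.symm w := by
  cases h; rfl

/-- Transports become invisible in the total space. Equations between vectors over propositionally
equal base points are therefore checked there. -/
theorem mk_transport (F : Type*) {x y : B} (h : x = y) (v : E x) :
    (⟨y, transport E h v⟩ : Bundle.TotalSpace F E) = ⟨x, v⟩ := by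
  cases h; rfl

theorem transport_eq_of_mk_eq (F : Type*) {x y : B} (h : x = y) {v : E x} {w : E y}
    (hvw : (⟨x, v⟩ : Bundle.TotalSpace F E) = ⟨y, w⟩) : transport E h v = w := by
  cases h
  exact Bundle.TotalSpace.mk_inj.1 hvw

theorem congr_transport (u : ∀ x, E x) {x y : B} (h : x = y) : transport E h (u x) = u y := by
  cases h; rfl

end Transport

/-! ### Anchor, translations and division expressed in the tangent groupoid -/

namespace LieGroupoid

variable {EG EM G M : Type*}
  [NormedAddCommGroup EG] [NormedSpace ℝ EG] [NormedAddCommGroup EM] [NormedSpace ℝ EM]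
  [TopologicalSpace G] [ChartedSpace EG G] [TopologicalSpace M] [ChartedSpace EM M]
  (𝒢 : LieGroupoid EG EM G M)

theorem s_div {p q : G} (h : 𝒢.s p = 𝒢.s q) : 𝒢.s (𝒢.div p q) = 𝒢.t q := 𝒢.toAlg.s_div h

theorem t_div {p q : G} (h : 𝒢.s p = 𝒢.s q) : 𝒢.t (𝒢.div p q) = 𝒢.t p := 𝒢.toAlg.t_div h

theorem tangent_ext {g : G} {X Y : TangentSpace 𝓘(ℝ, EG) g}
    (h : (⟨g, X⟩ : TangentBundle 𝓘(ℝ, EG) G) = ⟨g, Y⟩) : X = Y :=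
  Bundle.TotalSpace.mk_inj.1 h

theorem mk_transport_TU {x y : M} (h : x = y) (v : 𝒢.TU x) :
    (⟨𝒢.u y, transport 𝒢.TU h v⟩ : TangentBundle 𝓘(ℝ, EG) G) = ⟨𝒢.u x, v⟩ := by
  cases h; rfl

theorem transport_mem_A {x y : M} (h : x = y) {v : 𝒢.TU x} (hv : v ∈ 𝒢.A x) :
    transport 𝒢.TU h v ∈ 𝒢.A y := by
  cases h; exact hv

theorem transport_r {g g' : G} (h : g = g') (α : 𝒢.TU (𝒢.t g)) :
    transport (TangentSpace 𝓘(ℝ, EG) (M := G)) h (𝒢.r g α) =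
      𝒢.r g' (transport 𝒢.TU (congrArg 𝒢.t h) α) := by
  cases h; rfl

theorem transport_ds {g g' : G} (h : g = g') (X : TangentSpace 𝓘(ℝ, EG) g) :
    𝒢.ds g' (transport (TangentSpace 𝓘(ℝ, EG) (M := G)) h X) =
      transport (TangentSpace 𝓘(ℝ, EM) (M := M)) (congrArg 𝒢.s h) (𝒢.ds g X) := by
  cases h; rfl

theorem transport_leftInv {g g' : G} (h : g = g') (α : 𝒢.TU (𝒢.s g)) :
    transport (TangentSpace 𝓘(ℝ, EG) (M := G)) h (𝒢.leftInv g α) =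
      𝒢.leftInv g' (transport 𝒢.TU (congrArg 𝒢.s h) α) := by
  cases h; rfl

theorem transport_anchor {x y : M} (h : x = y) (α : 𝒢.TU x) :
    transport (TangentSpace 𝓘(ℝ, EM) (M := M)) h (𝒢.anchor x α) =
      𝒢.anchor y (transport 𝒢.TU h α) := by
  cases h; rfl

/-! ### Zero vectors -/

theorem Ts_zero (g : G) : 𝒢.Ts ⟨g, 0⟩ = ⟨𝒢.s g, 0⟩ :=
  Bundle.TotalSpace.mk_inj.2 (map_zero (𝒢.ds g))

theorem Tt_zero (g : G) : 𝒢.Tt ⟨g, 0⟩ = ⟨𝒢.t g, 0⟩ :=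
  Bundle.TotalSpace.mk_inj.2 (map_zero (𝒢.dt g))

theorem Ti_zero (g : G) : 𝒢.Ti ⟨g, 0⟩ = ⟨𝒢.inv g, 0⟩ :=
  Bundle.TotalSpace.mk_inj.2 (map_zero (𝒢.di g))

theorem Tm_zero (g h : G) : 𝒢.Tm ⟨g, 0⟩ ⟨h, 0⟩ = ⟨𝒢.mul g h, 0⟩ :=
  Bundle.TotalSpace.mk_inj.2 (map_zero (𝒢.dm g h))

theorem Ts_mk (g : G) (X : TangentSpace 𝓘(ℝ, EG) g) : 𝒢.Ts ⟨g, X⟩ = ⟨𝒢.s g, 𝒢.ds g X⟩ := rfl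

theorem Tt_mk (g : G) (X : TangentSpace 𝓘(ℝ, EG) g) : 𝒢.Tt ⟨g, X⟩ = ⟨𝒢.t g, 𝒢.dt g X⟩ := rfl

theorem Ts_eq_zero_iff {g : G} {X : TangentSpace 𝓘(ℝ, EG) g} :
    𝒢.Ts ⟨g, X⟩ = ⟨𝒢.s g, 0⟩ ↔ 𝒢.ds g X = 0 := Bundle.TotalSpace.mk_inj

theorem Ts_eq_iff {g : G} {X : TangentSpace 𝓘(ℝ, EG) g} {v : TangentSpace 𝓘(ℝ, EM) (𝒢.s g)} :
    𝒢.Ts ⟨g, X⟩ = ⟨𝒢.s g, v⟩ ↔ 𝒢.ds g X = v := Bundle.TotalSpace.mk_inj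

theorem Ts_mk_u {x : M} {α : 𝒢.TU x} (hα : α ∈ 𝒢.A x) : 𝒢.Ts ⟨𝒢.u x, α⟩ = ⟨x, 0⟩ := by
  have h : 𝒢.ds (𝒢.u x) α = 0 := hα
  rw [𝒢.Ts_eq_zero_iff.2 h, 𝒢.s_u]

theorem mem_A_of_Ts {x : M} {α : 𝒢.TU x} (h : 𝒢.Ts ⟨𝒢.u x, α⟩ = ⟨x, 0⟩) : α ∈ 𝒢.A x := by
  refine 𝒢.Ts_eq_zero_iff.1 ?_
  rw [h, 𝒢.s_u]

theorem Tt_mk_u (x : M) (α : 𝒢.TU x) : 𝒢.Tt ⟨𝒢.u x, α⟩ = ⟨x, 𝒢.anchor x α⟩ :=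
  (mk_transport EM (𝒢.t_u x) (𝒢.dt (𝒢.u x) α)).symm

variable [IsManifold 𝓘(ℝ, EG) ∞ G]

/-- A vector killed by `ds` is the velocity of a curve inside the source fibre. Along it, right
translation is multiplication by the constant curve `g`, whose velocity is zero. -/
theorem mk_rightTrans [IsManifold 𝓘(ℝ, EM) ∞ M] {g h : G} (hgh : 𝒢.s h = 𝒢.t g)
    {X : TangentSpace 𝓘(ℝ, EG) h} (hX : 𝒢.ds h X = 0) :
    (⟨𝒢.mul h g, 𝒢.rightTrans g h X⟩ : TangentBundle 𝓘(ℝ, EG) G) = 𝒢.Tm ⟨h, X⟩ ⟨g, 0⟩ := by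
  obtain ⟨c, -, hc, hcs⟩ := 𝒢.exists_curve_over ⟨h, X⟩ (κ := fun _ => 𝒢.s h) contMDiffAt_const
    (by rw [𝒢.Ts_eq_zero_iff.2 hX]; exact IsVelocity.const _)
  have hcs' : ∀ᶠ τ in 𝓝 0, 𝒢.s (c τ) = 𝒢.t g := hcs.mono fun τ hτ => hτ.trans hgh
  have hd : MDifferentiableWithinAt 𝓘(ℝ, EG) 𝓘(ℝ, EG) (fun h' => 𝒢.mul h' g)
      {h' | 𝒢.s h' = 𝒢.t g} h := by
    have h1 : ContMDiffWithinAt 𝓘(ℝ, EG) 𝓘(ℝ, EG) ∞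
        ((fun p : G × G => 𝒢.mul p.1 p.2) ∘ fun h' => (h', g)) {h' | 𝒢.s h' = 𝒢.t g} h :=
      ContMDiffWithinAt.comp h (𝒢.mul_smooth (h, g) hgh)
        (contMDiffWithinAt_id.prodMk contMDiffWithinAt_const) (fun _ hx => hx)
    exact h1.mdifferentiableWithinAt (by simp)
  exact (hc.comp_within hd hcs').unique (isVelocity_mul hc (IsVelocity.const g) hcs')
    (Eventually.of_forall fun _ => rfl)

/-- Vectors with the same `ds` are velocities of curves with the same source at each time near zero.
Along these, `m̄` is multiplication by the inverse curve. -/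
theorem mk_ddiv [IsManifold 𝓘(ℝ, EM) ∞ M] {p q : G} {X : TangentSpace 𝓘(ℝ, EG) p}
    {Y : TangentSpace 𝓘(ℝ, EG) q} (h : 𝒢.Ts ⟨p, X⟩ = 𝒢.Ts ⟨q, Y⟩) :
    (⟨𝒢.div p q, 𝒢.ddiv p q (X, Y)⟩ : TangentBundle 𝓘(ℝ, EG) G) =
      𝒢.tangent.div ⟨p, X⟩ ⟨q, Y⟩ := by
  obtain ⟨d, hd, hY⟩ := exists_curve (⟨q, Y⟩ : TangentBundle 𝓘(ℝ, EG) G)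
  obtain ⟨c, hc, hX, hcd⟩ := 𝒢.exists_curve_over ⟨p, X⟩ (κ := fun τ => 𝒢.s (d τ))
    (𝒢.s.contMDiff.contMDiffAt.comp (0 : ℝ) hd) (h ▸ 𝒢.isVelocity_s hY)
  have hpq : 𝒢.s p = 𝒢.s q := congrArg Bundle.TotalSpace.proj h
  have hdiff : MDifferentiableWithinAt (𝓘(ℝ, EG).prod 𝓘(ℝ, EG)) 𝓘(ℝ, EG)
      (fun r : G × G => 𝒢.div r.1 r.2) {r | 𝒢.s r.1 = 𝒢.s r.2} (p, q) := by
    have h1 : ContMDiffWithinAt (𝓘(ℝ, EG).prod 𝓘(ℝ, EG)) 𝓘(ℝ, EG) ∞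
        ((fun p : G × G => 𝒢.mul p.1 p.2) ∘ fun r : G × G => (r.1, 𝒢.inv r.2))
        {r | 𝒢.s r.1 = 𝒢.s r.2} (p, q) := by
      refine ContMDiffWithinAt.comp (p, q) (𝒢.mul_smooth (p, 𝒢.inv q) ?_)
        (contMDiffWithinAt_fst.prodMk ?_) ?_
      · exact hpq.trans (𝒢.t_inv q).symm
      · exact (𝒢.inv.contMDiff.contMDiffAt.comp (p, q) contMDiffAt_snd).contMDiffWithinAt
      · intro r hr
        exact (hr : 𝒢.s r.1 = 𝒢.s r.2).trans (𝒢.t_inv _).symm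
    exact h1.mdifferentiableWithinAt (by simp)
  exact (hX.comp₂_within hY hdiff hcd).unique
    (isVelocity_mul hX (𝒢.isVelocity_inv hY) (hcd.mono fun τ hτ => hτ.trans (𝒢.t_inv _).symm))
    (Eventually.of_forall fun _ => rfl)

/-- Only `s` is assumed to be a submersion. A curve in the target fibre is obtained by lifting the
inverse vector into a source fibre and inverting. -/
theorem mk_leftTrans [IsManifold 𝓘(ℝ, EM) ∞ M] {g h : G} (hgh : 𝒢.s g = 𝒢.t h)
    {Y : TangentSpace 𝓘(ℝ, EG) h} (hY : 𝒢.dt h Y = 0) :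
    (⟨𝒢.mul g h, 𝒢.leftTrans g h Y⟩ : TangentBundle 𝓘(ℝ, EG) G) = 𝒢.Tm ⟨g, 0⟩ ⟨h, Y⟩ := by
  have hs : 𝒢.Ts (𝒢.Ti ⟨h, Y⟩) = ⟨𝒢.t h, 0⟩ := by
    rw [show 𝒢.Ts (𝒢.Ti ⟨h, Y⟩) = 𝒢.Tt ⟨h, Y⟩ from 𝒢.tangent.s_inv _, Tt_mk, hY]
  obtain ⟨b, -, hb, hbs⟩ := 𝒢.exists_curve_over (𝒢.Ti ⟨h, Y⟩) (κ := fun _ => 𝒢.t h)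
    contMDiffAt_const (by rw [hs]; exact IsVelocity.const _)
  have hc : IsVelocity (fun τ => 𝒢.inv (b τ)) (⟨h, Y⟩ : TangentBundle 𝓘(ℝ, EG) G) := by
    have := 𝒢.isVelocity_inv hb
    rwa [show 𝒢.Ti (𝒢.Ti ⟨h, Y⟩) = ⟨h, Y⟩ from 𝒢.tangent.inv_inv _] at this
  have hct : ∀ᶠ τ in 𝓝 0, 𝒢.t (𝒢.inv (b τ)) = 𝒢.s g :=
    hbs.mono fun τ hτ => by rw [𝒢.t_inv, hτ, hgh]
  have hd : MDifferentiableWithinAt 𝓘(ℝ, EG) 𝓘(ℝ, EG) (fun h' => 𝒢.mul g h')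
      {h' | 𝒢.t h' = 𝒢.s g} h := by
    have h1 : ContMDiffWithinAt 𝓘(ℝ, EG) 𝓘(ℝ, EG) ∞
        ((fun p : G × G => 𝒢.mul p.1 p.2) ∘ fun h' => (g, h')) {h' | 𝒢.t h' = 𝒢.s g} h :=
      ContMDiffWithinAt.comp h (𝒢.mul_smooth (g, h) hgh)
        (contMDiffWithinAt_const.prodMk contMDiffWithinAt_id) (fun _ hx => Eq.symm hx)
    exact h1.mdifferentiableWithinAt (by simp)
  exact (hc.comp_within hd hct).unique
    (isVelocity_mul (IsVelocity.const g) hc (hct.mono fun _ h => h.symm))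
    (Eventually.of_forall fun _ => rfl)

variable [IsManifold 𝓘(ℝ, EM) ∞ M]

theorem mk_r {g : G} {α : 𝒢.TU (𝒢.t g)} (hα : α ∈ 𝒢.A (𝒢.t g)) :
    (⟨g, 𝒢.r g α⟩ : TangentBundle 𝓘(ℝ, EG) G) = 𝒢.Tm ⟨𝒢.u (𝒢.t g), α⟩ ⟨g, 0⟩ :=
  (mk_transport EG (𝒢.u_mul g) _).trans (𝒢.mk_rightTrans (𝒢.s_u _) hα)

theorem mk_rInv {g : G} {X : TangentSpace 𝓘(ℝ, EG) g} (hX : 𝒢.ds g X = 0) :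
    (⟨𝒢.u (𝒢.t g), 𝒢.rInv g X⟩ : TangentBundle 𝓘(ℝ, EG) G) = 𝒢.Tm ⟨g, X⟩ ⟨𝒢.inv g, 0⟩ :=
  (mk_transport EG (𝒢.mul_inv g) _).trans (𝒢.mk_rightTrans (𝒢.t_inv g).symm hX)

theorem mk_leftInv {g : G} {α : 𝒢.TU (𝒢.s g)} (hα : α ∈ 𝒢.A (𝒢.s g)) :
    (⟨g, 𝒢.leftInv g α⟩ : TangentBundle 𝓘(ℝ, EG) G) =
      𝒢.Tm ⟨g, 0⟩ (𝒢.Ti ⟨𝒢.u (𝒢.s g), α⟩) := by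
  set β := transport (TangentSpace 𝓘(ℝ, EG) (M := G)) (𝒢.inv_u (𝒢.s g)) (𝒢.di (𝒢.u (𝒢.s g)) α)
    with hβ
  have hmk : (⟨𝒢.u (𝒢.s g), β⟩ : TangentBundle 𝓘(ℝ, EG) G) = 𝒢.Ti ⟨𝒢.u (𝒢.s g), α⟩ :=
    mk_transport EG _ _
  have hdt : 𝒢.dt (𝒢.u (𝒢.s g)) β = 0 := by
    have h1 : 𝒢.Tt ⟨𝒢.u (𝒢.s g), β⟩ = ⟨𝒢.s g, 0⟩ := by
      rw [hmk, show 𝒢.Tt (𝒢.Ti ⟨𝒢.u (𝒢.s g), α⟩) = 𝒢.Ts ⟨𝒢.u (𝒢.s g), α⟩ from 𝒢.tangent.t_inv _,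
        𝒢.Ts_mk_u hα]
    have h2 : (⟨𝒢.t (𝒢.u (𝒢.s g)), 𝒢.dt (𝒢.u (𝒢.s g)) β⟩ : TangentBundle 𝓘(ℝ, EM) M) =
        ⟨𝒢.t (𝒢.u (𝒢.s g)), 0⟩ := by
      refine h1.trans ?_
      rw [𝒢.t_u]
    exact Bundle.TotalSpace.mk_inj.1 h2
  rw [← hmk]
  exact (mk_transport EG (𝒢.mul_u g) _).trans (𝒢.mk_leftTrans (𝒢.t_u _).symm hdt)

/-! ### Translations -/

theorem ds_r {g : G} {α : 𝒢.TU (𝒢.t g)} (hα : α ∈ 𝒢.A (𝒢.t g)) : 𝒢.ds g (𝒢.r g α) = 0 := by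
  refine 𝒢.Ts_eq_zero_iff.1 ?_
  rw [𝒢.mk_r hα, ← 𝒢.Ts_zero]
  exact 𝒢.tangent.s_mul _ _ ((𝒢.Ts_mk_u hα).trans (𝒢.Tt_zero g).symm)

theorem rInv_mem_A {g : G} {X : TangentSpace 𝓘(ℝ, EG) g} (hX : 𝒢.ds g X = 0) :
    𝒢.rInv g X ∈ 𝒢.A (𝒢.t g) := by
  refine 𝒢.mem_A_of_Ts ?_
  rw [𝒢.mk_rInv hX]
  refine (𝒢.tangent.s_mul _ _ ?_).trans ?_
  · exact (𝒢.Ts_eq_zero_iff.2 hX).trans ((𝒢.Tt_zero _).trans (by rw [𝒢.t_inv])).symm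
  · exact (𝒢.Ts_zero _).trans (by rw [𝒢.s_inv])

/-- In the tangent groupoid, `r` and `rInv` are multiplication and division by `0_g`. -/
theorem r_rInv {g : G} {X : TangentSpace 𝓘(ℝ, EG) g} (hX : 𝒢.ds g X = 0) :
    𝒢.r g (𝒢.rInv g X) = X := by
  refine tangent_ext ?_
  rw [𝒢.mk_r (𝒢.rInv_mem_A hX), 𝒢.mk_rInv hX, ← 𝒢.Ti_zero]
  exact 𝒢.tangent.div_mul_cancel ((𝒢.Ts_eq_zero_iff.2 hX).trans (𝒢.Ts_zero _).symm)

theorem rInv_r {g : G} {α : 𝒢.TU (𝒢.t g)} (hα : α ∈ 𝒢.A (𝒢.t g)) :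
    𝒢.rInv g (𝒢.r g α) = α := by
  refine tangent_ext (g := 𝒢.u (𝒢.t g)) ?_
  rw [𝒢.mk_rInv (𝒢.ds_r hα), 𝒢.mk_r hα, ← 𝒢.Ti_zero]
  exact 𝒢.tangent.mul_div_cancel ((𝒢.Ts_mk_u hα).trans (𝒢.Tt_zero _).symm)

/-- The source of `0_g · α⁻¹` is the source of `α⁻¹`, which is the target of `α`, that is, `ρ(α)`.
-/
theorem ds_leftInv {g : G} {α : 𝒢.TU (𝒢.s g)} (hα : α ∈ 𝒢.A (𝒢.s g)) :
    𝒢.ds g (𝒢.leftInv g α) = 𝒢.anchor (𝒢.s g) α := by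
  refine 𝒢.Ts_eq_iff.1 ?_
  rw [𝒢.mk_leftInv hα, ← 𝒢.Tt_mk_u]
  refine (𝒢.tangent.s_mul _ _ ?_).trans (𝒢.tangent.s_inv _)
  refine (𝒢.Ts_zero g).trans ((𝒢.tangent.t_inv _).trans (𝒢.Ts_mk_u hα)).symm

/-! ### Properties of the division map -/

theorem tangent_div_zero (p q : G) :
    𝒢.tangent.div ⟨p, 0⟩ ⟨q, 0⟩ = (⟨𝒢.div p q, 0⟩ : TangentBundle 𝓘(ℝ, EG) G) := by
  show 𝒢.Tm ⟨p, 0⟩ (𝒢.Ti ⟨q, 0⟩) = _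
  rw [Ti_zero, Tm_zero]; rfl

/-- Associativity: `(α · 0_p) · 0_q⁻¹ = α · (0_p · 0_q⁻¹)`. -/
theorem ddiv_r_zero {p q : G} (h : 𝒢.s p = 𝒢.s q) {α : 𝒢.TU (𝒢.t p)} (hα : α ∈ 𝒢.A (𝒢.t p)) :
    𝒢.ddiv p q (𝒢.r p α, 0) = 𝒢.r (𝒢.div p q) (transport 𝒢.TU (𝒢.t_div h).symm α) := by
  refine tangent_ext ?_
  rw [𝒢.mk_r (𝒢.transport_mem_A _ hα),
    mk_transport_TU, 𝒢.mk_ddiv, 𝒢.mk_r hα]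
  · refine (𝒢.tangent.div_eq_mul_inv_right ((𝒢.Ts_mk_u hα).trans (𝒢.Tt_zero _).symm) ?_).trans ?_
    · exact (𝒢.Ts_zero _).trans ((𝒢.Ts_zero _).trans (by rw [h])).symm
    · rw [tangent_div_zero]; rfl
  · rw [𝒢.Ts_eq_zero_iff.2 (𝒢.ds_r hα), Ts_zero, h]

/-- Write `0_p` as `(0_p · 0_q⁻¹) · 0_q` and use `0_q · (β · 0_q)⁻¹ = β⁻¹`. This is where left
invariant vectors enter the differential. -/
theorem ddiv_zero_r {p q : G} (h : 𝒢.s p = 𝒢.s q) {β : 𝒢.TU (𝒢.t q)} (hβ : β ∈ 𝒢.A (𝒢.t q)) :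
    𝒢.ddiv p q (0, 𝒢.r q β) = 𝒢.leftInv (𝒢.div p q) (transport 𝒢.TU (𝒢.s_div h).symm β) := by
  refine tangent_ext ?_
  have hpq : 𝒢.Ts ⟨p, 0⟩ = 𝒢.Ts ⟨q, 0⟩ := by rw [Ts_zero, Ts_zero, h]
  have hβq : 𝒢.Ts ⟨𝒢.u (𝒢.t q), β⟩ = 𝒢.Tt ⟨q, 0⟩ := (𝒢.Ts_mk_u hβ).trans (𝒢.Tt_zero _).symm
  rw [𝒢.mk_leftInv (𝒢.transport_mem_A _ hβ),
    mk_transport_TU, 𝒢.mk_ddiv, 𝒢.mk_r hβ, ← tangent_div_zero]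
  · rw [show 𝒢.Ti ⟨𝒢.u (𝒢.t q), β⟩ = _ from (𝒢.tangent.div_mul_self hβq).symm]
    have h1 : (⟨p, 0⟩ : TangentBundle 𝓘(ℝ, EG) G) =
        𝒢.tangent.mul (𝒢.tangent.div ⟨p, 0⟩ ⟨q, 0⟩) ⟨q, 0⟩ :=
      (𝒢.tangent.div_mul_cancel hpq).symm
    conv_lhs => rw [h1]
    exact 𝒢.tangent.div_eq_mul_inv_right (𝒢.tangent.s_div hpq) (𝒢.tangent.s_mul _ _ hβq)
  · rw [𝒢.Ts_eq_zero_iff.2 (𝒢.ds_r hβ), Ts_zero, h]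

/-- The common right factor `β⁻¹` cancels in `(0_p · β⁻¹)(0_q · β⁻¹)⁻¹`. -/
theorem ddiv_leftInv_leftInv {p q : G} (h : 𝒢.s p = 𝒢.s q) {β : 𝒢.TU (𝒢.s p)}
    (hβ : β ∈ 𝒢.A (𝒢.s p)) :
    𝒢.ddiv p q (𝒢.leftInv p β, 𝒢.leftInv q (transport 𝒢.TU h β)) = 0 := by
  refine tangent_ext ?_
  have hβ' := 𝒢.transport_mem_A h hβ
  have hi : 𝒢.Tt (𝒢.Ti ⟨𝒢.u (𝒢.s p), β⟩) = ⟨𝒢.s p, 0⟩ :=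
    (𝒢.tangent.t_inv _).trans (𝒢.Ts_mk_u hβ)
  rw [𝒢.mk_ddiv, 𝒢.mk_leftInv hβ,
    𝒢.mk_leftInv hβ', mk_transport_TU, ← tangent_div_zero]
  · refine 𝒢.tangent.mul_div_mul ?_ ?_
    · exact (𝒢.Ts_zero _).trans hi.symm
    · exact ((𝒢.Ts_zero _).trans (by rw [h])).trans hi.symm
  · rw [Ts_mk, Ts_mk, 𝒢.ds_leftInv hβ, 𝒢.ds_leftInv hβ', ← transport_anchor, mk_transport]

theorem Ts_ddiv {p q : G} {X : TangentSpace 𝓘(ℝ, EG) p}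
    {Y : TangentSpace 𝓘(ℝ, EG) q} (h : 𝒢.Ts ⟨p, X⟩ = 𝒢.Ts ⟨q, Y⟩) :
    𝒢.Ts ⟨𝒢.div p q, 𝒢.ddiv p q (X, Y)⟩ = 𝒢.Tt ⟨q, Y⟩ := by
  rw [𝒢.mk_ddiv h]
  exact 𝒢.tangent.s_div h

end LieGroupoid

/-! ### Linear operations on smooth families of tangent vectors -/

section Along

variable {E N E' N' : Type*}
    [NormedAddCommGroup E] [NormedSpace ℝ E] [TopologicalSpace N] [ChartedSpace E N]
    [IsManifold 𝓘(ℝ, E) ∞ N]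
    [NormedAddCommGroup E'] [NormedSpace ℝ E'] [TopologicalSpace N'] [ChartedSpace E' N']
    {b : N' → N} {v w : ∀ z, TangentSpace 𝓘(ℝ, E) (b z)}

theorem contMDiff_neg_along
    (hv : ContMDiff 𝓘(ℝ, E') 𝓘(ℝ, E).tangent ∞
      (fun z => (⟨b z, v z⟩ : TangentBundle 𝓘(ℝ, E) N))) :
    ContMDiff 𝓘(ℝ, E') 𝓘(ℝ, E).tangent ∞
      (fun z => (⟨b z, -v z⟩ : TangentBundle 𝓘(ℝ, E) N)) := by
  have := contMDiff_smul_along (-1) hv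
  simpa only [neg_smul, one_smul] using this

theorem contMDiff_sub_along
    (hv : ContMDiff 𝓘(ℝ, E') 𝓘(ℝ, E).tangent ∞
      (fun z => (⟨b z, v z⟩ : TangentBundle 𝓘(ℝ, E) N)))
    (hw : ContMDiff 𝓘(ℝ, E') 𝓘(ℝ, E).tangent ∞
      (fun z => (⟨b z, w z⟩ : TangentBundle 𝓘(ℝ, E) N))) :
    ContMDiff 𝓘(ℝ, E') 𝓘(ℝ, E).tangent ∞
      (fun z => (⟨b z, v z - w z⟩ : TangentBundle 𝓘(ℝ, E) N)) := by
  simpa only [sub_eq_add_neg] using contMDiff_add_along hv (contMDiff_neg_along hw)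

theorem contMDiff_sum_along {ι : Type*} (s : Finset ι)
    (hb : ContMDiff 𝓘(ℝ, E') 𝓘(ℝ, E) ∞ b)
    {f : ι → ∀ z, TangentSpace 𝓘(ℝ, E) (b z)}
    (hf : ∀ i ∈ s, ContMDiff 𝓘(ℝ, E') 𝓘(ℝ, E).tangent ∞
      (fun z => (⟨b z, f i z⟩ : TangentBundle 𝓘(ℝ, E) N))) :
    ContMDiff 𝓘(ℝ, E') 𝓘(ℝ, E).tangent ∞
      (fun z => (⟨b z, ∑ i ∈ s, f i z⟩ : TangentBundle 𝓘(ℝ, E) N)) := by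
  classical
  induction s using Finset.induction_on with
  | empty => simpa using contMDiff_zero_along hb
  | insert i s hi ih =>
    simp only [Finset.sum_insert hi]
    exact contMDiff_add_along (hf i (Finset.mem_insert_self _ _))
      (ih fun j hj => hf j (Finset.mem_insert_of_mem hj))

/-- The product of a smooth function and a smooth family of tangent vectors is smooth. -/
theorem contMDiff_mul_along {a : N' → ℝ} (ha : ContMDiff 𝓘(ℝ, E') 𝓘(ℝ, ℝ) ∞ a)
    (hv : ContMDiff 𝓘(ℝ, E') 𝓘(ℝ, E).tangent ∞
      (fun z => (⟨b z, v z⟩ : TangentBundle 𝓘(ℝ, E) N))) :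
    ContMDiff 𝓘(ℝ, E') 𝓘(ℝ, E).tangent ∞
      (fun z => (⟨b z, a z • v z⟩ : TangentBundle 𝓘(ℝ, E) N)) := by
  intro z₀
  have hv' := Bundle.contMDiffAt_totalSpace.1 (hv z₀)
  refine Bundle.contMDiffAt_totalSpace.2 ⟨hv'.1, ?_⟩
  have hb : ContMDiffAt 𝓘(ℝ, E') 𝓘(ℝ, E) ∞ b z₀ := hv'.1
  set e := trivializationAt E (TangentSpace 𝓘(ℝ, E) : N → Type _) (b z₀) with he
  refine ((ha z₀).smul hv'.2).congr_of_eventuallyEq ?_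
  filter_upwards [hb.continuousAt.preimage_mem_nhds
    (e.open_baseSet.mem_nhds (FiberBundle.mem_baseSet_trivializationAt' (b z₀)))] with z hz
  exact (e.linear ℝ hz).2 (a z) (v z)

theorem contMDiff_base_along
    (hv : ContMDiff 𝓘(ℝ, E') 𝓘(ℝ, E).tangent ∞
      (fun z => (⟨b z, v z⟩ : TangentBundle 𝓘(ℝ, E) N))) : ContMDiff 𝓘(ℝ, E') 𝓘(ℝ, E) ∞ b :=
  fun z => (Bundle.contMDiffAt_totalSpace.1 (hv z)).1

end Along

/-! ### Smoothness of the structure maps, the quasi-actions and the basic curvature -/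

namespace LieGroupoid

variable {EG EM G M : Type*}
  [NormedAddCommGroup EG] [NormedSpace ℝ EG] [NormedAddCommGroup EM] [NormedSpace ℝ EM]
  [TopologicalSpace G] [ChartedSpace EG G] [TopologicalSpace M] [ChartedSpace EM M]
  [IsManifold 𝓘(ℝ, EG) ∞ G] [IsManifold 𝓘(ℝ, EM) ∞ M]
  {𝒢 : LieGroupoid EG EM G M}
  {P : Type*} [NormedAddCommGroup P] [NormedSpace ℝ P]

section Families

variable {γ η : P → G}

theorem contMDiff_ds {X : ∀ z, TangentSpace 𝓘(ℝ, EG) (γ z)}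
    (hX : ContMDiff 𝓘(ℝ, P) 𝓘(ℝ, EG).tangent ∞
      (fun z => (⟨γ z, X z⟩ : TangentBundle 𝓘(ℝ, EG) G))) :
    ContMDiff 𝓘(ℝ, P) 𝓘(ℝ, EM).tangent ∞
      (fun z => (⟨𝒢.s (γ z), 𝒢.ds (γ z) (X z)⟩ : TangentBundle 𝓘(ℝ, EM) M)) :=
  contMDiff_tangentMap_comp 𝒢.s.contMDiff hX

theorem contMDiff_dt {X : ∀ z, TangentSpace 𝓘(ℝ, EG) (γ z)}
    (hX : ContMDiff 𝓘(ℝ, P) 𝓘(ℝ, EG).tangent ∞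
      (fun z => (⟨γ z, X z⟩ : TangentBundle 𝓘(ℝ, EG) G))) :
    ContMDiff 𝓘(ℝ, P) 𝓘(ℝ, EM).tangent ∞
      (fun z => (⟨𝒢.t (γ z), 𝒢.dt (γ z) (X z)⟩ : TangentBundle 𝓘(ℝ, EM) M)) :=
  contMDiff_tangentMap_comp 𝒢.t.contMDiff hX

theorem contMDiff_r {α : ∀ z, 𝒢.TU (𝒢.t (γ z))} (hA : ∀ z, α z ∈ 𝒢.A (𝒢.t (γ z)))
    (hγ : ContMDiff 𝓘(ℝ, P) 𝓘(ℝ, EG) ∞ γ)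
    (hα : ContMDiff 𝓘(ℝ, P) 𝓘(ℝ, EG).tangent ∞
      (fun z => (⟨𝒢.u (𝒢.t (γ z)), α z⟩ : TangentBundle 𝓘(ℝ, EG) G))) :
    ContMDiff 𝓘(ℝ, P) 𝓘(ℝ, EG).tangent ∞
      (fun z => (⟨γ z, 𝒢.r (γ z) (α z)⟩ : TangentBundle 𝓘(ℝ, EG) G)) := by
  simp only [𝒢.mk_r (hA _)]
  exact 𝒢.contMDiff_Tm hα (contMDiff_zero_along hγ)
    fun z => (𝒢.Ts_mk_u (hA z)).trans (𝒢.Tt_zero _).symm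

theorem contMDiff_rInv {X : ∀ z, TangentSpace 𝓘(ℝ, EG) (γ z)} (hs : ∀ z, 𝒢.ds (γ z) (X z) = 0)
    (hX : ContMDiff 𝓘(ℝ, P) 𝓘(ℝ, EG).tangent ∞
      (fun z => (⟨γ z, X z⟩ : TangentBundle 𝓘(ℝ, EG) G))) :
    ContMDiff 𝓘(ℝ, P) 𝓘(ℝ, EG).tangent ∞
      (fun z => (⟨𝒢.u (𝒢.t (γ z)), 𝒢.rInv (γ z) (X z)⟩ : TangentBundle 𝓘(ℝ, EG) G)) := by
  simp only [𝒢.mk_rInv (hs _)]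
  refine 𝒢.contMDiff_Tm hX
    (contMDiff_zero_along (𝒢.inv.contMDiff.comp (contMDiff_base_along hX))) fun z => ?_
  rw [𝒢.Ts_eq_zero_iff.2 (hs z), Tt_zero, 𝒢.t_inv]

theorem contMDiff_leftInv {α : ∀ z, 𝒢.TU (𝒢.s (γ z))} (hA : ∀ z, α z ∈ 𝒢.A (𝒢.s (γ z)))
    (hγ : ContMDiff 𝓘(ℝ, P) 𝓘(ℝ, EG) ∞ γ)
    (hα : ContMDiff 𝓘(ℝ, P) 𝓘(ℝ, EG).tangent ∞
      (fun z => (⟨𝒢.u (𝒢.s (γ z)), α z⟩ : TangentBundle 𝓘(ℝ, EG) G))) :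
    ContMDiff 𝓘(ℝ, P) 𝓘(ℝ, EG).tangent ∞
      (fun z => (⟨γ z, 𝒢.leftInv (γ z) (α z)⟩ : TangentBundle 𝓘(ℝ, EG) G)) := by
  simp only [𝒢.mk_leftInv (hA _)]
  exact 𝒢.contMDiff_Tm (contMDiff_zero_along hγ)
    (contMDiff_tangentMap_comp 𝒢.inv.contMDiff hα)
    fun z => (𝒢.Ts_zero _).trans ((𝒢.tangent.t_inv _).trans (𝒢.Ts_mk_u (hA z))).symm

theorem contMDiff_ddiv {X : ∀ z, TangentSpace 𝓘(ℝ, EG) (γ z)}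
    {Y : ∀ z, TangentSpace 𝓘(ℝ, EG) (η z)}
    (h : ∀ z, 𝒢.Ts ⟨γ z, X z⟩ = 𝒢.Ts ⟨η z, Y z⟩)
    (hX : ContMDiff 𝓘(ℝ, P) 𝓘(ℝ, EG).tangent ∞
      (fun z => (⟨γ z, X z⟩ : TangentBundle 𝓘(ℝ, EG) G)))
    (hY : ContMDiff 𝓘(ℝ, P) 𝓘(ℝ, EG).tangent ∞
      (fun z => (⟨η z, Y z⟩ : TangentBundle 𝓘(ℝ, EG) G))) :
    ContMDiff 𝓘(ℝ, P) 𝓘(ℝ, EG).tangent ∞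
      (fun z => (⟨𝒢.div (γ z) (η z), 𝒢.ddiv (γ z) (η z) (X z, Y z)⟩ :
        TangentBundle 𝓘(ℝ, EG) G)) := by
  simp only [𝒢.mk_ddiv (h _)]
  exact 𝒢.contMDiff_Tm hX (contMDiff_tangentMap_comp 𝒢.inv.contMDiff hY)
    fun z => (h z).trans (𝒢.tangent.t_inv _).symm

end Families

namespace EhresmannConnection

variable (σ : 𝒢.EhresmannConnection)

theorem mk_ds_σ (g : G) (v : TangentSpace 𝓘(ℝ, EM) (𝒢.s g)) :
    𝒢.Ts ⟨g, σ.σ g v⟩ = ⟨𝒢.s g, v⟩ := 𝒢.Ts_eq_iff.2 (σ.ds_σ g v)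

theorem transport_σ {g g' : G} (h : g = g') (v : TangentSpace 𝓘(ℝ, EM) (𝒢.s g)) :
    transport (TangentSpace 𝓘(ℝ, EG) (M := G)) h (σ.σ g v) =
      σ.σ g' (transport (TangentSpace 𝓘(ℝ, EM) (M := M)) (congrArg 𝒢.s h) v) := by
  cases h; rfl

theorem ds_sub_σ (g : G) (X : TangentSpace 𝓘(ℝ, EG) g) :
    𝒢.ds g (X - σ.σ g (𝒢.ds g X)) = 0 := by
  rw [map_sub, σ.ds_σ, sub_self]

theorem leftSplit_mem_A (g : G) (X : TangentSpace 𝓘(ℝ, EG) g) :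
    σ.leftSplit g X ∈ 𝒢.A (𝒢.t g) :=
  𝒢.rInv_mem_A (σ.ds_sub_σ g X)

theorem r_leftSplit (g : G) (X : TangentSpace 𝓘(ℝ, EG) g) :
    𝒢.r g (σ.leftSplit g X) = X - σ.σ g (𝒢.ds g X) :=
  𝒢.r_rInv (σ.ds_sub_σ g X)

theorem lamA_mem_A (g : G) (α : 𝒢.TU (𝒢.s g)) : σ.lamA g α ∈ 𝒢.A (𝒢.t g) :=
  (𝒢.A _).neg_mem (σ.leftSplit_mem_A _ _)

/-- This decomposes a left invariant vector along `T_g G = r_g A ⊕ σ_g TM`: its horizontal part lies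
over `ρ(α)` and its vertical part is `-λ_g(α)`. -/
theorem r_lamA {g : G} {α : 𝒢.TU (𝒢.s g)} (hα : α ∈ 𝒢.A (𝒢.s g)) :
    𝒢.r g (σ.lamA g α) = σ.σ g (𝒢.anchor (𝒢.s g) α) - 𝒢.leftInv g α := by
  rw [← 𝒢.ds_leftInv hα]
  show 𝒢.r g (-(σ.leftSplit g (𝒢.leftInv g α))) = _
  rw [map_neg, r_leftSplit, neg_sub]

theorem contMDiff_σ {γ : P → G} {v : ∀ z, TangentSpace 𝓘(ℝ, EM) (𝒢.s (γ z))}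
    (hγ : ContMDiff 𝓘(ℝ, P) 𝓘(ℝ, EG) ∞ γ)
    (hv : ContMDiff 𝓘(ℝ, P) 𝓘(ℝ, EM).tangent ∞
      (fun z => (⟨𝒢.s (γ z), v z⟩ : TangentBundle 𝓘(ℝ, EM) M))) :
    ContMDiff 𝓘(ℝ, P) 𝓘(ℝ, EG).tangent ∞
      (fun z => (⟨γ z, σ.σ (γ z) (v z)⟩ : TangentBundle 𝓘(ℝ, EG) G)) := by
  have h : ContMDiff 𝓘(ℝ, P) (𝓘(ℝ, EG).prod 𝓘(ℝ, EM)) ∞ (fun z => (⟨γ z, v z⟩ :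
      Bundle.TotalSpace EM (𝒢.s *ᵖ (TangentSpace 𝓘(ℝ, EM) : M → Type _)))) := by
    intro z₀
    refine Bundle.contMDiffAt_totalSpace.2 ⟨hγ z₀, ?_⟩
    -- The pullback bundle inherits its trivializations from `TM`, so the fibre coordinate is the
    -- same in both.
    exact (Bundle.contMDiffAt_totalSpace.1 (hv z₀)).2
  exact σ.smooth.comp h

theorem contMDiff_leftSplit {γ : P → G} {X : ∀ z, TangentSpace 𝓘(ℝ, EG) (γ z)}
    (hX : ContMDiff 𝓘(ℝ, P) 𝓘(ℝ, EG).tangent ∞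
      (fun z => (⟨γ z, X z⟩ : TangentBundle 𝓘(ℝ, EG) G))) :
    ContMDiff 𝓘(ℝ, P) 𝓘(ℝ, EG).tangent ∞
      (fun z => (⟨𝒢.u (𝒢.t (γ z)), σ.leftSplit (γ z) (X z)⟩ : TangentBundle 𝓘(ℝ, EG) G)) :=
  contMDiff_rInv (fun z => σ.ds_sub_σ (γ z) (X z))
    (contMDiff_sub_along hX (σ.contMDiff_σ (contMDiff_base_along hX) (contMDiff_ds hX)))

theorem isQuasiActionA : IsQuasiActionA 𝒢 σ.lamA :=
  ⟨fun g α _ => σ.lamA_mem_A g α, fun _ _ _ hA hγ hα =>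
    contMDiff_neg_along (σ.contMDiff_leftSplit (contMDiff_leftInv hA hγ hα))⟩

theorem isQuasiActionTM : IsQuasiActionTM 𝒢 σ.lamTM :=
  fun _ _ _ hγ hv => contMDiff_dt (σ.contMDiff_σ hγ hv)

theorem Ts_eq_Tt_σ {g h : G} (hgh : 𝒢.s g = 𝒢.t h) (v : TangentSpace 𝓘(ℝ, EM) (𝒢.s h)) :
    𝒢.Ts ⟨g, σ.σ g (transport (TangentSpace 𝓘(ℝ, EM) (M := M)) hgh.symm (σ.lamTM h v))⟩ =
      𝒢.Tt ⟨h, σ.σ h v⟩ := by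
  rw [mk_ds_σ, mk_transport]; rfl

/-- Both terms of the defect project to `v`, because the source of a tangent product is that of its
second factor. Hence `rInv` may be applied to the defect, and `K` takes values in `A`. -/
theorem ds_curvDefect (g h : G) (hgh : 𝒢.s g = 𝒢.t h) (v : TangentSpace 𝓘(ℝ, EM) (𝒢.s h)) :
    𝒢.ds (𝒢.mul g h) (σ.curvDefect g h hgh v) = 0 := by
  have h1 : 𝒢.ds (𝒢.mul g h) (𝒢.dm g h
      (σ.σ g (transport (TangentSpace 𝓘(ℝ, EM) (M := M)) hgh.symm (σ.lamTM h v)), σ.σ h v)) =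
      transport (TangentSpace 𝓘(ℝ, EM) (M := M)) (𝒢.s_mul g h hgh).symm v := by
    refine 𝒢.Ts_eq_iff.1 ?_
    rw [mk_transport, ← σ.mk_ds_σ]
    exact 𝒢.tangent.s_mul _ _ (σ.Ts_eq_Tt_σ hgh v)
  show 𝒢.ds (𝒢.mul g h) (σ.σ (𝒢.mul g h) (transport (TangentSpace 𝓘(ℝ, EM) (M := M))
    (𝒢.s_mul g h hgh).symm v) - 𝒢.dm g h _) = 0
  rw [map_sub, σ.ds_σ, sub_eq_zero]
  exact h1.symm

theorem K_mem_A (g h : G) (hgh : 𝒢.s g = 𝒢.t h) (v : TangentSpace 𝓘(ℝ, EM) (𝒢.s h)) :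
    σ.K g h hgh v ∈ 𝒢.A (𝒢.t g) :=
  𝒢.transport_mem_A _ (𝒢.rInv_mem_A (σ.ds_curvDefect g h hgh v))

theorem r_K (g h : G) (hgh : 𝒢.s g = 𝒢.t h) (v : TangentSpace 𝓘(ℝ, EM) (𝒢.s h)) :
    𝒢.r (𝒢.mul g h) (transport 𝒢.TU (𝒢.t_mul g h hgh).symm (σ.K g h hgh v)) =
      σ.curvDefect g h hgh v := by
  have h1 : transport 𝒢.TU (𝒢.t_mul g h hgh).symm (σ.K g h hgh v) =
      𝒢.rInv (𝒢.mul g h) (σ.curvDefect g h hgh v) := by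
    show transport 𝒢.TU _ (transport 𝒢.TU _ _) = _
    rw [transport_transport, transport_rfl]; rfl
  rw [h1, 𝒢.r_rInv (σ.ds_curvDefect g h hgh v)]

theorem isCurvatureTerm : IsCurvatureTerm 𝒢 σ.K := by
  refine ⟨σ.K_mem_A, fun n γ η h v hγ hη hv => ?_⟩
  have hmul : ContMDiff 𝓘(ℝ, EuclideanSpace ℝ (Fin n)) 𝓘(ℝ, EG) ∞
      (fun z => 𝒢.mul (γ z) (η z)) :=
    𝒢.mul_smooth.comp_contMDiff (hγ.prodMk hη) h
  have h1 := contMDiff_dt (𝒢 := 𝒢) (σ.contMDiff_σ hη hv)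
  have h2 : ContMDiff 𝓘(ℝ, EuclideanSpace ℝ (Fin n)) 𝓘(ℝ, EG).tangent ∞
      (fun z => (⟨γ z, σ.σ (γ z) (transport (TangentSpace 𝓘(ℝ, EM) (M := M)) (h z).symm
        (σ.lamTM (η z) (v z)))⟩ : TangentBundle 𝓘(ℝ, EG) G)) := by
    refine σ.contMDiff_σ hγ ?_
    simp only [mk_transport]
    exact h1
  have h3 := 𝒢.contMDiff_Tm h2 (σ.contMDiff_σ hη hv) (fun z => σ.Ts_eq_Tt_σ (h z) (v z))
  have h4 : ContMDiff 𝓘(ℝ, EuclideanSpace ℝ (Fin n)) 𝓘(ℝ, EG).tangent ∞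
      (fun z => (⟨𝒢.mul (γ z) (η z), σ.σ (𝒢.mul (γ z) (η z))
        (transport (TangentSpace 𝓘(ℝ, EM) (M := M)) (𝒢.s_mul _ _ (h z)).symm (v z))⟩ :
          TangentBundle 𝓘(ℝ, EG) G)) := by
    refine σ.contMDiff_σ hmul ?_
    simp only [mk_transport]
    exact hv
  have h5 : ContMDiff 𝓘(ℝ, EuclideanSpace ℝ (Fin n)) 𝓘(ℝ, EG).tangent ∞
      (fun z => (⟨𝒢.mul (γ z) (η z), σ.curvDefect (γ z) (η z) (h z) (v z)⟩ :
          TangentBundle 𝓘(ℝ, EG) G)) := contMDiff_sub_along h4 h3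
  have h6 := contMDiff_rInv (𝒢 := 𝒢) (fun z => σ.ds_curvDefect (γ z) (η z) (h z) (v z)) h5
  have h7 : ∀ z, (⟨𝒢.u (𝒢.t (γ z)), σ.K (γ z) (η z) (h z) (v z)⟩ : TangentBundle 𝓘(ℝ, EG) G) =
      ⟨𝒢.u (𝒢.t (𝒢.mul (γ z) (η z))),
        𝒢.rInv (𝒢.mul (γ z) (η z)) (σ.curvDefect (γ z) (η z) (h z) (v z))⟩ :=
    fun z => 𝒢.mk_transport_TU _ _
  simp only [h7]
  exact h6

/-- The difference between the right translates of `K(g, h) v` and the images of the horizontal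
lifts under division. -/
theorem transport_ddiv_σ {p g h : G} (hgh : 𝒢.s g = 𝒢.t h) (hp : p = 𝒢.mul g h)
    (hs : 𝒢.s h = 𝒢.s p) (e : 𝒢.div p h = g) (v : TangentSpace 𝓘(ℝ, EM) (𝒢.s h)) :
    transport (TangentSpace 𝓘(ℝ, EG) (M := G)) e (𝒢.ddiv p h
        (σ.σ p (transport (TangentSpace 𝓘(ℝ, EM) (M := M)) hs v), σ.σ h v)) =
      𝒢.r g (σ.K g h hgh v) +
        σ.σ g (transport (TangentSpace 𝓘(ℝ, EM) (M := M)) hgh.symm (σ.lamTM h v)) := by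
  subst hp
  set w := σ.σ g (transport (TangentSpace 𝓘(ℝ, EM) (M := M)) hgh.symm (σ.lamTM h v)) with hw
  -- By the definition of `K`, the lift at `gh` is `r K v` plus the tangent product of `w` and `σ_h
  -- v`. Dividing that product by `σ_h v` leaves `w`.
  have h1 : σ.σ (𝒢.mul g h) (transport (TangentSpace 𝓘(ℝ, EM) (M := M)) hs v) =
      𝒢.r (𝒢.mul g h) (transport 𝒢.TU (𝒢.t_mul g h hgh).symm (σ.K g h hgh v)) +
        𝒢.dm g h (w, σ.σ h v) := by
    rw [r_K]
    exact (sub_add_cancel _ _).symm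
  have h2 : (𝒢.r (𝒢.mul g h) (transport 𝒢.TU (𝒢.t_mul g h hgh).symm (σ.K g h hgh v)) +
        𝒢.dm g h (w, σ.σ h v), σ.σ h v) =
      (𝒢.r (𝒢.mul g h) (transport 𝒢.TU (𝒢.t_mul g h hgh).symm (σ.K g h hgh v)), 0) +
        (𝒢.dm g h (w, σ.σ h v), σ.σ h v) := by
    rw [Prod.mk_add_mk, zero_add]
  rw [h1, h2, map_add, map_add, 𝒢.ddiv_r_zero hs.symm (𝒢.transport_mem_A _ (σ.K_mem_A _ _ _ _)),
    transport_r, transport_transport, transport_transport, transport_rfl]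
  congr 1
  refine transport_eq_of_mk_eq EG e ?_
  have hc := σ.Ts_eq_Tt_σ hgh v
  have hm : (⟨𝒢.mul g h, 𝒢.dm g h (w, σ.σ h v)⟩ : TangentBundle 𝓘(ℝ, EG) G) =
      𝒢.Tm ⟨g, w⟩ ⟨h, σ.σ h v⟩ := rfl
  rw [𝒢.mk_ddiv]
  · rw [hm]
    exact 𝒢.tangent.mul_div_cancel hc
  · rw [hm]
    exact 𝒢.tangent.s_mul _ _ hc

/-- The computation behind the formula for `D_σ`. The vertical part contributes the face `g₁g₂` of
`u` together with `λ` on `A` and `K`. The horizontal part contributes `ρ` and `λ` on `TM`. -/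
theorem transport_ddiv_assemble {p g h : G} (hgh : 𝒢.s g = 𝒢.t h) (hp : p = 𝒢.mul g h)
    (hs : 𝒢.s h = 𝒢.s p) (e : 𝒢.div p h = g) (ht : 𝒢.t p = 𝒢.t g)
    (v : TangentSpace 𝓘(ℝ, EM) (𝒢.s h)) {α : 𝒢.TU (𝒢.t p)} (hα : α ∈ 𝒢.A (𝒢.t p))
    {β : 𝒢.TU (𝒢.t h)} (hβ : β ∈ 𝒢.A (𝒢.t h)) :
    transport (TangentSpace 𝓘(ℝ, EG) (M := G)) e (𝒢.ddiv p h
        (𝒢.r p α - σ.σ p (transport (TangentSpace 𝓘(ℝ, EM) (M := M)) hs v),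
          𝒢.r h β - σ.σ h v)) =
      𝒢.r g (transport 𝒢.TU ht α - σ.lamA g (transport 𝒢.TU hgh.symm β) - σ.K g h hgh v) +
        σ.σ g (transport (TangentSpace 𝓘(ℝ, EM) (M := M)) hgh.symm
          (𝒢.anchor (𝒢.t h) β - σ.lamTM h v)) := by
  -- The pair is split so that in each of the three summands both entries have the same image under
  -- `ds`; only on such pairs is `dm̄` determined.
  have h1 : (𝒢.r p α - σ.σ p (transport (TangentSpace 𝓘(ℝ, EM) (M := M)) hs v),
          𝒢.r h β - σ.σ h v) =
      (𝒢.r p α, 0) + (0, 𝒢.r h β) -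
        (σ.σ p (transport (TangentSpace 𝓘(ℝ, EM) (M := M)) hs v), σ.σ h v) := by
    rw [Prod.mk_add_mk, Prod.mk_sub_mk, add_zero, zero_add]
  rw [h1, map_sub, map_sub, map_add, map_add, 𝒢.ddiv_r_zero hs.symm hα,
    𝒢.ddiv_zero_r hs.symm hβ, transport_r, transport_transport, transport_leftInv,
    transport_transport, σ.transport_ddiv_σ hgh hp hs e v, map_sub (𝒢.r g), map_sub (𝒢.r g),
    r_lamA σ (𝒢.transport_mem_A _ hβ), map_sub (transport _ _), map_sub (σ.σ g),
    transport_anchor]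
  abel

end EhresmannConnection

end LieGroupoid

namespace LieGroupoid

variable {EG EM G M : Type*}
  [NormedAddCommGroup EG] [NormedSpace ℝ EG] [NormedAddCommGroup EM] [NormedSpace ℝ EM]
  [TopologicalSpace G] [ChartedSpace EG G] [TopologicalSpace M] [ChartedSpace EM M]
  {𝒢 : LieGroupoid EG EM G M}

/-! ### Combinatorics of strings -/

namespace Strings

variable {k l m : ℕ}

theorem contract_arr_of_lt (j : Fin (k + 1)) (p : 𝒢.Strings (k + 1)) {i : Fin k}
    (h : (i : ℕ) < j) : (p.contract j).arr i = p.arr i.castSucc :=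
  Fin.contractNth_apply_of_lt _ _ _ _ h

theorem contract_arr_of_eq (j : Fin (k + 1)) (p : 𝒢.Strings (k + 1)) {i : Fin k}
    (h : (i : ℕ) = j) : (p.contract j).arr i = 𝒢.mul (p.arr i.castSucc) (p.arr i.succ) :=
  Fin.contractNth_apply_of_eq _ _ _ _ h

theorem contract_arr_of_gt (j : Fin (k + 1)) (p : 𝒢.Strings (k + 1)) {i : Fin k}
    (h : (j : ℕ) < i) : (p.contract j).arr i = p.arr i.succ :=
  Fin.contractNth_apply_of_gt _ _ _ _ h

theorem contract_obj_of_le (j : Fin (k + 1)) (p : 𝒢.Strings (k + 1)) {i : Fin (k + 1)}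
    (h : (i : ℕ) ≤ j) : (p.contract j).obj i = p.obj i.castSucc := by
  show p.obj (j.succ.succAbove i) = _
  rw [Fin.succAbove_of_castSucc_lt]
  rw [Fin.lt_def]; simp; omega

theorem contract_obj_of_gt (j : Fin (k + 1)) (p : 𝒢.Strings (k + 1)) {i : Fin (k + 1)}
    (h : (j : ℕ) < i) : (p.contract j).obj i = p.obj i.succ := by
  show p.obj (j.succ.succAbove i) = _
  rw [Fin.succAbove_of_le_castSucc]
  rw [Fin.le_def]; simp; omega

/-- A simplicial identity. It is bookkeeping of indices except for `i = j`, where two neighbouring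
products overlap and associativity is needed. -/
theorem contract_contract (p : 𝒢.Strings (k + 2)) {i j : Fin (k + 1)} (h : i ≤ j) :
    (p.contract j.succ).contract i = (p.contract i.castSucc).contract j := by
  have hij : (i : ℕ) ≤ j := h
  ext l
  · show p.obj (j.succ.succ.succAbove (i.succ.succAbove l)) =
      p.obj (i.castSucc.succ.succAbove (j.succ.succAbove l))
    congr 1
    ext
    simp only [Fin.succAbove, Fin.lt_def]
    split_ifs <;> simp_all <;> omega
  · rcases lt_trichotomy (l : ℕ) (i : ℕ) with h1 | h1 | h1
    · rw [contract_arr_of_lt _ _ h1, contract_arr_of_lt _ _ (by simp; omega),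
        contract_arr_of_lt _ _ (by omega), contract_arr_of_lt _ _ (by simpa using h1)]
    · rw [contract_arr_of_eq _ _ h1, contract_arr_of_lt _ _ (by simp; omega)]
      rcases hij.lt_or_eq with h2 | h2
      · rw [contract_arr_of_lt _ _ (by simp; omega), contract_arr_of_lt _ _ (by omega),
          contract_arr_of_eq _ _ (by simpa using h1)]
        rfl
      · rw [contract_arr_of_eq _ _ (by simp; omega), contract_arr_of_eq _ _ (by omega),
          contract_arr_of_eq _ _ (by simpa using h1), contract_arr_of_gt _ _ (by simp; omega),
          𝒢.mul_assoc _ _ _ (p.comp (by simp)) (p.comp (by simp))]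
        rfl
    · rw [contract_arr_of_gt _ _ h1]
      rcases lt_trichotomy (l : ℕ) (j : ℕ) with h2 | h2 | h2
      · rw [contract_arr_of_lt _ _ (by simp; omega), contract_arr_of_lt _ _ (by omega),
          contract_arr_of_gt _ _ (by simpa using h1)]
        rfl
      · rw [contract_arr_of_eq _ _ (by simp; omega), contract_arr_of_eq _ _ h2,
          contract_arr_of_gt _ _ (by simpa using h1), contract_arr_of_gt _ _ (by simp; omega)]
        rfl
      · rw [contract_arr_of_gt _ _ (by simp; omega), contract_arr_of_gt _ _ h2,
          contract_arr_of_gt _ _ (by simp; omega)]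

theorem tail_contract_succ (p : 𝒢.Strings (k + 2)) (j : Fin (k + 1)) :
    (p.contract j.succ).tail = p.tail.contract j := by
  ext l
  · show p.obj (j.succ.succ.succAbove l.succ) = p.obj (j.succ.succAbove l).succ
    rw [Fin.succ_succAbove_succ]
  · show (p.contract j.succ).arr l.succ = (p.tail.contract j).arr l
    rcases lt_trichotomy (l : ℕ) (j : ℕ) with h1 | h1 | h1
    · rw [contract_arr_of_lt _ _ h1, contract_arr_of_lt _ _ (by simp; omega)]
      rfl
    · rw [contract_arr_of_eq _ _ h1, contract_arr_of_eq _ _ (by simp; omega)]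
      rfl
    · rw [contract_arr_of_gt _ _ h1, contract_arr_of_gt _ _ (by simp; omega)]
      rfl

/-- For a projectable cochain this ensures that its values at `(g₁g₂, g₃, …)` and `(g₂, g₃, …)` have
the same `ds`, so that `dm̄` applies to them. -/
theorem tail_contract_zero (p : 𝒢.Strings (k + 2)) : (p.contract 0).tail = p.tail.tail := by
  ext l
  · exact contract_obj_of_gt _ _ (by simp)
  · exact contract_arr_of_gt (0 : Fin (k + 2)) p (i := l.succ) (by simp)

theorem contract_zero_arr_zero (p : 𝒢.Strings (k + 2)) :
    (p.contract 0).arr 0 = 𝒢.mul (p.arr 0) (p.arr 1) :=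
  contract_arr_of_eq 0 p (i := 0) (by simp)

/-- The string `(1, g₁, …, g_k)`. -/
def consUnit (p : 𝒢.Strings k) : 𝒢.Strings (k + 1) where
  obj := Fin.cons (p.obj 0) p.obj
  arr := Fin.cons (𝒢.u (p.obj 0)) p.arr
  t_arr := by
    intro i
    refine Fin.cases ?_ (fun i => ?_) i
    · exact 𝒢.t_u _
    · rw [Fin.cons_succ, p.t_arr, ← Fin.succ_castSucc, Fin.cons_succ]
  s_arr := by
    intro i
    refine Fin.cases ?_ (fun i => ?_) i
    · exact 𝒢.s_u _
    · rw [Fin.cons_succ, p.s_arr, Fin.cons_succ]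

theorem tail_consUnit (p : 𝒢.Strings k) : p.consUnit.tail = p := rfl

theorem eq_pt (p : 𝒢.Strings 0) : p = pt (p.obj 0) := by
  ext i
  · rw [Fin.fin_one_eq_zero i]; rfl
  · exact i.elim0

theorem tail_eq_pt (p : 𝒢.Strings 1) : p.tail = pt (𝒢.s (p.arr 0)) := by
  rw [p.tail.eq_pt, p.s_zero]

theorem contract_eq_pt (p : 𝒢.Strings 1) (j : Fin 1) : p.contract j = pt (𝒢.t (p.arr 0)) := by
  rw [(p.contract j).eq_pt, p.t_zero, p.contract_obj_zero]

end Strings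

/-! ### Smooth families of strings -/

namespace IsSmoothFamily

variable {k l m n : ℕ}

theorem tail {φ : EuclideanSpace ℝ (Fin n) → 𝒢.Strings (k + 1)} (hφ : IsSmoothFamily φ) :
    IsSmoothFamily (fun z => (φ z).tail) :=
  ⟨fun i => hφ.1 i.succ, fun i => hφ.2 i.succ⟩

theorem front (h : k + l = m) {φ : EuclideanSpace ℝ (Fin n) → 𝒢.Strings m}
    (hφ : IsSmoothFamily φ) : IsSmoothFamily (fun z => (φ z).front h) :=
  ⟨fun _ => hφ.1 _, fun _ => hφ.2 _⟩

theorem back (h : k + l = m) {φ : EuclideanSpace ℝ (Fin n) → 𝒢.Strings m}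
    (hφ : IsSmoothFamily φ) : IsSmoothFamily (fun z => (φ z).back h) :=
  ⟨fun _ => hφ.1 _, fun _ => hφ.2 _⟩

theorem contract (j : Fin (k + 1)) {φ : EuclideanSpace ℝ (Fin n) → 𝒢.Strings (k + 1)}
    (hφ : IsSmoothFamily φ) : IsSmoothFamily (fun z => (φ z).contract j) := by
  refine ⟨fun i => hφ.1 _, fun i => ?_⟩
  rcases lt_trichotomy (i : ℕ) (j : ℕ) with h | h | h
  · simp only [Strings.contract_arr_of_lt j _ h]
    exact hφ.2 _
  · simp only [Strings.contract_arr_of_eq j _ h]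
    exact 𝒢.mul_smooth.comp_contMDiff ((hφ.2 _).prodMk (hφ.2 _))
      fun z => (φ z).comp (by simp)
  · simp only [Strings.contract_arr_of_gt j _ h]
    exact hφ.2 _

theorem consUnit {φ : EuclideanSpace ℝ (Fin n) → 𝒢.Strings k} (hφ : IsSmoothFamily φ) :
    IsSmoothFamily (fun z => (φ z).consUnit) := by
  refine ⟨fun i => ?_, fun i => ?_⟩
  · refine Fin.cases ?_ (fun i => ?_) i
    · exact hφ.1 0
    · exact hφ.1 i
  · refine Fin.cases ?_ (fun i => ?_) i
    · exact 𝒢.u.contMDiff.comp (hφ.1 0)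
    · exact hφ.2 i

theorem pt {x : EuclideanSpace ℝ (Fin n) → M}
    (hx : ContMDiff 𝓘(ℝ, EuclideanSpace ℝ (Fin n)) 𝓘(ℝ, EM) ∞ x) :
    IsSmoothFamily (fun z => (Strings.pt (x z) : 𝒢.Strings 0)) :=
  ⟨fun _ => hx, fun i => i.elim0⟩

end IsSmoothFamily

end LieGroupoid

/-- The cancellation behind `δ² = 0`. -/
theorem sum_alternating_faces_eq_zero {V : Type*} [AddCommGroup V] [Module ℝ V] {n : ℕ}
    (f : Fin (n + 2) → Fin (n + 1) → V)
    (hf : ∀ i j : Fin (n + 1), i ≤ j → f j.succ i = f i.castSucc j) :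
    ∑ j : Fin (n + 2), ∑ i : Fin (n + 1), ((-1 : ℝ) ^ (j : ℕ) * (-1) ^ (i : ℕ)) • f j i = 0 := by
  rw [← Fintype.sum_prod_type']
  -- A pair `(j, i)` with `i < j` is matched with `(i, j - 1)`. By `hf` the two terms agree, and
  -- their signs are opposite.
  refine Finset.sum_involution (fun q _ =>
    if h : (q.2 : ℕ) < q.1 then (q.2.castSucc, (⟨q.1 - 1, by omega⟩ : Fin (n + 1)))
    else (q.2.succ, (⟨q.1, by omega⟩ : Fin (n + 1)))) ?_ ?_ ?_ ?_
  · rintro ⟨j, i⟩ -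
    by_cases h : (i : ℕ) < j
    · obtain ⟨j, rfl⟩ := Fin.exists_succ_eq.2 (show j ≠ 0 by rintro rfl; simp at h)
      simp only [h, dif_pos]
      have hj : (⟨(j.succ : ℕ) - 1, by simp; omega⟩ : Fin (n + 1)) = j := by ext; simp
      rw [hf i j (by rw [Fin.le_def]; simp at h; omega), hj, Fin.val_succ, Nat.add_sub_cancel,
        ← add_smul, ← Fin.val_succ]
      rw [show ((-1 : ℝ) ^ (j.succ : ℕ) * (-1) ^ (i : ℕ) +
        (-1) ^ (i.castSucc : ℕ) * (-1) ^ (j : ℕ)) = 0 by simp [pow_succ]; ring, zero_smul]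
    · simp only [h, dif_neg, not_false_eq_true]
      have hji : (j : ℕ) ≤ i := by omega
      rw [hf ⟨j, by omega⟩ i hji, show (⟨j, by omega⟩ : Fin (n + 1)).castSucc = j from rfl,
        ← add_smul]
      rw [show ((-1 : ℝ) ^ (j : ℕ) * (-1) ^ (i : ℕ) +
        (-1) ^ (i.succ : ℕ) * (-1) ^ (j : ℕ)) = 0 by simp [pow_succ]; ring, zero_smul]
  · rintro ⟨j, i⟩ - -
    split_ifs with h <;> simp only [ne_eq, Prod.mk.injEq, Fin.ext_iff] <;> simp at h ⊢ <;> omega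
  · intro q _
    exact Finset.mem_univ _
  · rintro ⟨j, i⟩ -
    by_cases h : (i : ℕ) < j
    · have h' : ¬ ((j : ℕ) - 1 < i) := by omega
      simp [h, h', Prod.ext_iff, Fin.ext_iff]
      omega
    · have h' : (j : ℕ) < i + 1 := by omega
      simp [h, h']

theorem transport_eq_transport {B : Type*} {E : B → Type*} [∀ x, AddCommGroup (E x)]
    [∀ x, Module ℝ (E x)] (F : Type*) {x x' y : B} (h : x = y) (h' : x' = y) {v : E x} {v' : E x'}
    (hv : (⟨x, v⟩ : Bundle.TotalSpace F E) = ⟨x', v'⟩) : transport E h v = transport E h' v' := by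
  cases h; cases h'
  exact Bundle.TotalSpace.mk_inj.1 hv

namespace LieGroupoid

variable {EG EM G M : Type*}
  [NormedAddCommGroup EG] [NormedSpace ℝ EG] [NormedAddCommGroup EM] [NormedSpace ℝ EM]
  [TopologicalSpace G] [ChartedSpace EG G] [TopologicalSpace M] [ChartedSpace EM M]
  {𝒢 : LieGroupoid EG EM G M} {k : ℕ}

theorem mk_apply_congr (c : ∀ p : 𝒢.Strings (k + 1), TangentSpace 𝓘(ℝ, EG) (p.arr 0))
    {p q : 𝒢.Strings (k + 1)} (h : p = q) :
    (⟨p.arr 0, c p⟩ : TangentBundle 𝓘(ℝ, EG) G) = ⟨q.arr 0, c q⟩ := by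
  cases h; rfl

theorem mk_ddiv_congr {p q p' q' : G} {X : TangentSpace 𝓘(ℝ, EG) p} {Y : TangentSpace 𝓘(ℝ, EG) q}
    {X' : TangentSpace 𝓘(ℝ, EG) p'} {Y' : TangentSpace 𝓘(ℝ, EG) q'}
    (hX : (⟨p, X⟩ : TangentBundle 𝓘(ℝ, EG) G) = ⟨p', X'⟩)
    (hY : (⟨q, Y⟩ : TangentBundle 𝓘(ℝ, EG) G) = ⟨q', Y'⟩) :
    (⟨𝒢.div p q, 𝒢.ddiv p q (X, Y)⟩ : TangentBundle 𝓘(ℝ, EG) G) =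
      ⟨𝒢.div p' q', 𝒢.ddiv p' q' (X', Y')⟩ := by
  cases hX; cases hY; rfl

theorem ddiv_sum {ι : Type*} (s : Finset ι) {p q : G} (X : ι → TangentSpace 𝓘(ℝ, EG) p)
    (Y : ι → TangentSpace 𝓘(ℝ, EG) q) :
    𝒢.ddiv p q (∑ i ∈ s, X i, ∑ i ∈ s, Y i) = ∑ i ∈ s, 𝒢.ddiv p q (X i, Y i) := by
  rw [← map_sum]
  congr 1
  ext <;> simp [Prod.fst_sum, Prod.snd_sum]

variable [IsManifold 𝓘(ℝ, EG) ∞ G] [IsManifold 𝓘(ℝ, EM) ∞ M]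

omit [IsManifold 𝓘(ℝ, EM) ∞ M] in
theorem Ts_eq_of_tail_eq {c : ∀ p : 𝒢.Strings (k + 1), TangentSpace 𝓘(ℝ, EG) (p.arr 0)}
    (hc : c ∈ 𝒢.CDefPos k) {p q : 𝒢.Strings (k + 1)} (h : p.tail = q.tail) :
    𝒢.Ts ⟨p.arr 0, c p⟩ = 𝒢.Ts ⟨q.arr 0, c q⟩ := by
  obtain ⟨-, sc, hsc⟩ := hc
  rw [Ts_mk, Ts_mk, ← mk_transport EM p.s_zero, ← mk_transport EM q.s_zero, hsc, hsc, h]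

omit [IsManifold 𝓘(ℝ, EM) ∞ M] in
theorem Ts_contract_zero {c : ∀ p : 𝒢.Strings (k + 1), TangentSpace 𝓘(ℝ, EG) (p.arr 0)}
    (hc : c ∈ 𝒢.CDefPos k) (p : 𝒢.Strings (k + 2)) :
    𝒢.Ts ⟨(p.contract 0).arr 0, c (p.contract 0)⟩ = 𝒢.Ts ⟨p.tail.arr 0, c p.tail⟩ :=
  Ts_eq_of_tail_eq hc p.tail_contract_zero

/-! ### The deformation differential -/

omit [IsManifold 𝓘(ℝ, EG) ∞ G] [IsManifold 𝓘(ℝ, EM) ∞ M] in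
theorem deformDiffZero_apply (α : 𝒢.Raw 𝒢.TU 0) (p : 𝒢.Strings 1) :
    𝒢.deformDiffZero α p = -(𝒢.r (p.arr 0) (α (Strings.pt (𝒢.t (p.arr 0)))) +
      𝒢.leftInv (p.arr 0) (α (Strings.pt (𝒢.s (p.arr 0))))) := rfl

omit [IsManifold 𝓘(ℝ, EG) ∞ G] [IsManifold 𝓘(ℝ, EM) ∞ M] in
theorem deformDiffPos_apply (c : ∀ p : 𝒢.Strings (k + 1), TangentSpace 𝓘(ℝ, EG) (p.arr 0))
    (p : 𝒢.Strings (k + 2)) : 𝒢.deformDiffPos k c p =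
    -transport (TangentSpace 𝓘(ℝ, EG) (M := G)) p.div_contract
        (𝒢.ddiv ((p.contract 0).arr 0) (p.tail.arr 0) (c (p.contract 0), c p.tail)) +
      ∑ j : Fin (k + 1), (-1 : ℝ) ^ ((j : ℕ) + 2) •
        transport (TangentSpace 𝓘(ℝ, EG) (M := G)) (p.contract_succ_arr_zero j)
          (c (p.contract j.succ)) := rfl

theorem deformDiffZero_mem {α : 𝒢.Raw 𝒢.TU 0} (hα : α ∈ 𝒢.CA 0) :
    𝒢.deformDiffZero α ∈ 𝒢.CDefPos 0 := by
  have hA : ∀ x, α (Strings.pt x) ∈ 𝒢.A x := fun x => hα.1 (Strings.pt x)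
  -- The right invariant part is killed by `ds` and the left invariant part projects to the anchor,
  -- so the `s`-projection of `δα` is `-ρ(α)`.
  refine ⟨fun n φ hφ => ?_, fun q => -𝒢.anchor (q.obj 0) (α q), fun p => ?_⟩
  · refine contMDiff_neg_along (contMDiff_add_along ?_ ?_)
    · exact contMDiff_r (fun z => hA _) (hφ.2 0)
        (hα.2 n _ (IsSmoothFamily.pt (𝒢.t.contMDiff.comp (hφ.2 0))))
    · exact contMDiff_leftInv (fun z => hA _) (hφ.2 0)
        (hα.2 n _ (IsSmoothFamily.pt (𝒢.s.contMDiff.comp (hφ.2 0))))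
  · have h1 : 𝒢.ds (p.arr 0) (𝒢.deformDiffZero α p) =
        -𝒢.anchor (𝒢.s (p.arr 0)) (α (Strings.pt (𝒢.s (p.arr 0)))) := by
      rw [deformDiffZero_apply, map_neg, map_add, 𝒢.ds_r (hA _), 𝒢.ds_leftInv (hA _)]
      exact congrArg Neg.neg (zero_add _)
    rw [h1]
    refine transport_eq_of_mk_eq EM _ ?_
    rw [p.tail_eq_pt]
    rfl

theorem deformDiffPos_mem {c : ∀ p : 𝒢.Strings (k + 1), TangentSpace 𝓘(ℝ, EG) (p.arr 0)}
    (hc : c ∈ 𝒢.CDefPos k) : 𝒢.deformDiffPos k c ∈ 𝒢.CDefPos (k + 1) := by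
  have hsm := hc.1
  obtain ⟨sc, hsc⟩ := hc.2
  -- The witness is the `s`-projection of `δc`. The term with `dt` arises because `ds` of a quotient
  -- `X · Y⁻¹` is `dt Y`, and the faces beyond the first become faces of the tail.
  refine ⟨fun n φ hφ => ?_, fun q =>
    -transport (TangentSpace 𝓘(ℝ, EM) (M := M)) q.t_zero (𝒢.dt (q.arr 0) (c q)) +
      ∑ j : Fin (k + 1), (-1 : ℝ) ^ ((j : ℕ) + 2) •
        transport (TangentSpace 𝓘(ℝ, EM) (M := M)) (q.contract_obj_zero j) (sc (q.contract j)),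
    fun p => ?_⟩
  · simp only [deformDiffPos_apply]
    refine contMDiff_add_along (contMDiff_neg_along ?_)
      (contMDiff_sum_along _ (hφ.2 0) fun j _ => contMDiff_smul_along _ ?_)
    · simp only [mk_transport]
      exact contMDiff_ddiv (fun z => Ts_contract_zero hc (φ z)) (hsm n _ (hφ.contract 0))
        (hsm n _ hφ.tail)
    · simp only [mk_transport]
      exact hsm n _ (hφ.contract j.succ)
  · rw [deformDiffPos_apply, map_add, map_add, map_neg, map_neg, map_sum, map_sum, transport_ds,
      transport_transport]
    congr 1
    · congr 1
      exact transport_eq_transport EM _ _ (𝒢.Ts_ddiv (Ts_contract_zero hc p))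
    · refine Finset.sum_congr rfl fun j _ => ?_
      rw [map_smul, map_smul, transport_ds, transport_transport]
      congr 1
      refine transport_eq_transport EM _ _ ?_
      rw [← mk_transport EM (p.contract j.succ).s_zero, hsc, p.tail_contract_succ]

/-- The vector field `-(α⃗ + α⃖)` is multiplicative: `dm̄` maps its values at `P` and `Q` to its
value at `P Q⁻¹`, which is `key`. At `P = g₁g₂`, `Q = g₂` this is the value at `g₁`, and it cancels
the remaining face. -/
theorem deformDiffPos_deformDiffZero {α : 𝒢.Raw 𝒢.TU 0} (hα : α ∈ 𝒢.CA 0) :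
    𝒢.deformDiffPos 0 (𝒢.deformDiffZero α) = 0 := by
  have hA : ∀ x, α (Strings.pt x) ∈ 𝒢.A x := fun x => hα.1 (Strings.pt x)
  funext p
  have hs : 𝒢.s ((p.contract 0).arr 0) = 𝒢.s (p.tail.arr 0) := by
    rw [(p.contract 0).s_zero, p.tail.s_zero, p.tail_contract_zero]
  have key : ∀ P Q : G, 𝒢.s P = 𝒢.s Q →
      𝒢.ddiv P Q (-(𝒢.r P (α (Strings.pt (𝒢.t P))) + 𝒢.leftInv P (α (Strings.pt (𝒢.s P)))),
        -(𝒢.r Q (α (Strings.pt (𝒢.t Q))) + 𝒢.leftInv Q (α (Strings.pt (𝒢.s Q))))) =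
      -(𝒢.r (𝒢.div P Q) (α (Strings.pt (𝒢.t (𝒢.div P Q)))) +
        𝒢.leftInv (𝒢.div P Q) (α (Strings.pt (𝒢.s (𝒢.div P Q))))) := by
    intro P Q h
    have hl : α (Strings.pt (𝒢.s Q)) = transport 𝒢.TU h (α (Strings.pt (𝒢.s P))) :=
      (congr_transport (E := 𝒢.TU) (fun x => α (Strings.pt x)) h).symm
    rw [show (-(𝒢.r P (α (Strings.pt (𝒢.t P))) + 𝒢.leftInv P (α (Strings.pt (𝒢.s P)))),
        -(𝒢.r Q (α (Strings.pt (𝒢.t Q))) + 𝒢.leftInv Q (α (Strings.pt (𝒢.s Q))))) =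
      -((𝒢.r P (α (Strings.pt (𝒢.t P))), 0) + (0, 𝒢.r Q (α (Strings.pt (𝒢.t Q)))) +
        (𝒢.leftInv P (α (Strings.pt (𝒢.s P))), 𝒢.leftInv Q (α (Strings.pt (𝒢.s Q))))) by
        simp only [Prod.mk_add_mk, add_zero, zero_add, Prod.neg_mk], map_neg, map_add, map_add, hl,
      𝒢.ddiv_leftInv_leftInv h (hA _), 𝒢.ddiv_r_zero h (hA _), 𝒢.ddiv_zero_r h (hA _), add_zero,
      congr_transport (E := 𝒢.TU) (fun x => α (Strings.pt x)) (𝒢.t_div h).symm,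
      congr_transport (E := 𝒢.TU) (fun x => α (Strings.pt x)) (𝒢.s_div h).symm]
  rw [deformDiffPos_apply, deformDiffZero_apply, deformDiffZero_apply, key _ _ hs,
    Fin.sum_univ_one]
  have h1 : transport (TangentSpace 𝓘(ℝ, EG) (M := G)) p.div_contract
      (-(𝒢.r (𝒢.div ((p.contract 0).arr 0) (p.tail.arr 0))
        (α (Strings.pt (𝒢.t (𝒢.div ((p.contract 0).arr 0) (p.tail.arr 0))))) +
        𝒢.leftInv (𝒢.div ((p.contract 0).arr 0) (p.tail.arr 0))
          (α (Strings.pt (𝒢.s (𝒢.div ((p.contract 0).arr 0) (p.tail.arr 0))))))) =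
      -(𝒢.r (p.arr 0) (α (Strings.pt (𝒢.t (p.arr 0)))) +
        𝒢.leftInv (p.arr 0) (α (Strings.pt (𝒢.s (p.arr 0))))) :=
    congr_transport (E := TangentSpace 𝓘(ℝ, EG) (M := G))
      (fun g => -(𝒢.r g (α (Strings.pt (𝒢.t g))) + 𝒢.leftInv g (α (Strings.pt (𝒢.s g)))))
      p.div_contract
  have h2 : transport (TangentSpace 𝓘(ℝ, EG) (M := G)) (p.contract_succ_arr_zero 0)
      (𝒢.deformDiffZero α (p.contract (Fin.succ 0))) =
      -(𝒢.r (p.arr 0) (α (Strings.pt (𝒢.t (p.arr 0)))) +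
        𝒢.leftInv (p.arr 0) (α (Strings.pt (𝒢.s (p.arr 0))))) :=
    congr_transport (E := TangentSpace 𝓘(ℝ, EG) (M := G))
      (fun g => -(𝒢.r g (α (Strings.pt (𝒢.t g))) + 𝒢.leftInv g (α (Strings.pt (𝒢.s g)))))
      (p.contract_succ_arr_zero 0)
  rw [h1, h2]
  simp

/-- Terms without `dm̄` cancel in pairs (`hdouble`). The iterated `dm̄` cancels against `dm̄` on the
face `g₂g₃` (`hfirst`). The mixed terms cancel because `dm̄` commutes with the later faces
(`hrest`). -/
theorem deformDiffPos_deformDiffPos {c : ∀ p : 𝒢.Strings (k + 1), TangentSpace 𝓘(ℝ, EG) (p.arr 0)}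
    (hc : c ∈ 𝒢.CDefPos k) : 𝒢.deformDiffPos (k + 1) (𝒢.deformDiffPos k c) = 0 := by
  funext p
  have hpair : (𝒢.deformDiffPos k c (p.contract 0), 𝒢.deformDiffPos k c p.tail) =
      -(transport (TangentSpace 𝓘(ℝ, EG) (M := G)) (p.contract 0).div_contract
          (𝒢.ddiv (((p.contract 0).contract 0).arr 0) ((p.contract 0).tail.arr 0)
            (c ((p.contract 0).contract 0), c (p.contract 0).tail)),
        transport (TangentSpace 𝓘(ℝ, EG) (M := G)) p.tail.div_contract
          (𝒢.ddiv ((p.tail.contract 0).arr 0) (p.tail.tail.arr 0)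
            (c (p.tail.contract 0), c p.tail.tail))) +
      (∑ j : Fin (k + 1), (-1 : ℝ) ^ ((j : ℕ) + 2) •
        transport (TangentSpace 𝓘(ℝ, EG) (M := G)) ((p.contract 0).contract_succ_arr_zero j)
          (c ((p.contract 0).contract j.succ)),
       ∑ j : Fin (k + 1), (-1 : ℝ) ^ ((j : ℕ) + 2) •
        transport (TangentSpace 𝓘(ℝ, EG) (M := G)) (p.tail.contract_succ_arr_zero j)
          (c (p.tail.contract j.succ))) := rfl
  rw [deformDiffPos_apply, hpair, map_add, map_neg, ddiv_sum, map_add, map_neg, neg_add, neg_neg]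
  simp only [deformDiffPos_apply (k := k) c (Strings.contract _ _), map_add, map_neg, map_sum,
    map_smul, smul_add, Finset.sum_add_distrib, ← Prod.smul_mk]
  have hdouble : ∑ j : Fin (k + 2), (-1 : ℝ) ^ ((j : ℕ) + 2) •
      transport (TangentSpace 𝓘(ℝ, EG) (M := G)) (p.contract_succ_arr_zero j)
        (∑ i : Fin (k + 1), (-1 : ℝ) ^ ((i : ℕ) + 2) •
          transport (TangentSpace 𝓘(ℝ, EG) (M := G)) ((p.contract j.succ).contract_succ_arr_zero i)
            (c ((p.contract j.succ).contract i.succ))) = 0 := by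
    rw [← sum_alternating_faces_eq_zero (fun (j : Fin (k + 2)) (i : Fin (k + 1)) =>
      transport (TangentSpace 𝓘(ℝ, EG) (M := G)) (p.contract_succ_arr_zero j)
        (transport (TangentSpace 𝓘(ℝ, EG) (M := G)) ((p.contract j.succ).contract_succ_arr_zero i)
            (c ((p.contract j.succ).contract i.succ))))]
    · refine Finset.sum_congr rfl fun j _ => ?_
      rw [map_sum, Finset.smul_sum]
      refine Finset.sum_congr rfl fun i _ => ?_
      rw [map_smul, smul_smul]
      congr 1
      simp [pow_add]
    · intro i j hij
      rw [transport_transport, transport_transport]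
      refine transport_eq_transport EG _ _ (mk_apply_congr c ?_)
      exact Strings.contract_contract p (i := i.succ) (j := j.succ) (by simpa using hij)
  simp only [map_sum, map_smul] at hdouble
  rw [hdouble, add_zero, Fin.sum_univ_succ (n := k + 1)]
  -- With `X = c(g₁g₂g₃, …)`, `Y = c(g₂g₃, …)` and `Z = c(g₃, …)`, this is `(X Z⁻¹)(Y Z⁻¹)⁻¹ = X
  -- Y⁻¹`.
  have hfirst : transport (TangentSpace 𝓘(ℝ, EG) (M := G)) p.div_contract
      (𝒢.ddiv ((p.contract 0).arr 0) (p.tail.arr 0)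
        (transport (TangentSpace 𝓘(ℝ, EG) (M := G)) (p.contract 0).div_contract
          (𝒢.ddiv (((p.contract 0).contract 0).arr 0) ((p.contract 0).tail.arr 0)
            (c ((p.contract 0).contract 0), c (p.contract 0).tail)),
        transport (TangentSpace 𝓘(ℝ, EG) (M := G)) p.tail.div_contract
          (𝒢.ddiv ((p.tail.contract 0).arr 0) (p.tail.tail.arr 0)
            (c (p.tail.contract 0), c p.tail.tail)))) =
      transport (TangentSpace 𝓘(ℝ, EG) (M := G)) (p.contract_succ_arr_zero 0)
        (transport (TangentSpace 𝓘(ℝ, EG) (M := G)) (p.contract (Fin.succ 0)).div_contract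
          (𝒢.ddiv (((p.contract (Fin.succ 0)).contract 0).arr 0)
            ((p.contract (Fin.succ 0)).tail.arr 0)
            (c ((p.contract (Fin.succ 0)).contract 0), c (p.contract (Fin.succ 0)).tail))) := by
    rw [transport_transport]
    refine transport_eq_transport EG _ _ ?_
    have e1 : (p.contract (Fin.succ 0)).contract 0 = (p.contract 0).contract 0 :=
      Strings.contract_contract p (i := 0) (j := 0) le_rfl
    have e2 : (p.contract (Fin.succ 0)).tail = p.tail.contract 0 := p.tail_contract_succ 0
    have t1 := Ts_contract_zero hc (p.contract 0)
    have t2 := Ts_contract_zero hc p.tail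
    have t3 : 𝒢.Ts ⟨(p.contract 0).tail.arr 0, c (p.contract 0).tail⟩ =
        𝒢.Ts ⟨p.tail.tail.arr 0, c p.tail.tail⟩ := by rw [p.tail_contract_zero]
    rw [mk_ddiv_congr (mk_apply_congr c e1) (mk_apply_congr c e2), mk_ddiv, mk_ddiv,
      mk_transport, mk_transport, mk_ddiv _ t1, mk_ddiv _ t2, mk_apply_congr c p.tail_contract_zero]
    · exact 𝒢.tangent.div_div (t1.trans t3) t2
    · exact t1.trans (t3.trans t2.symm)
    · rw [mk_transport, mk_transport, 𝒢.Ts_ddiv t1, 𝒢.Ts_ddiv t2,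
        mk_apply_congr c p.tail_contract_zero]
  rw [hfirst]
  have hrest : ∀ j : Fin (k + 1),
      transport (TangentSpace 𝓘(ℝ, EG) (M := G)) (p.contract_succ_arr_zero j.succ)
        (transport (TangentSpace 𝓘(ℝ, EG) (M := G)) (p.contract j.succ.succ).div_contract
          (𝒢.ddiv (((p.contract j.succ.succ).contract 0).arr 0)
            ((p.contract j.succ.succ).tail.arr 0)
            (c ((p.contract j.succ.succ).contract 0), c (p.contract j.succ.succ).tail))) =
      transport (TangentSpace 𝓘(ℝ, EG) (M := G)) p.div_contract
        (𝒢.ddiv ((p.contract 0).arr 0) (p.tail.arr 0)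
          (transport (TangentSpace 𝓘(ℝ, EG) (M := G)) ((p.contract 0).contract_succ_arr_zero j)
            (c ((p.contract 0).contract j.succ)),
          transport (TangentSpace 𝓘(ℝ, EG) (M := G)) (p.tail.contract_succ_arr_zero j)
            (c (p.tail.contract j.succ)))) := by
    intro j
    rw [transport_transport]
    refine transport_eq_transport EG _ _ (mk_ddiv_congr ?_ ?_)
    · rw [mk_transport]
      exact mk_apply_congr c (Strings.contract_contract p (i := 0) (j := j.succ) (Fin.zero_le _))
    · rw [mk_transport]
      exact mk_apply_congr c (p.tail_contract_succ j.succ)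
  simp only [hrest]
  simp [pow_succ]
  abel

end LieGroupoid

/-! ### The deformation differential in the components `(u, v)` -/

namespace LieGroupoid

variable {EG EM G M : Type*}
  [NormedAddCommGroup EG] [NormedSpace ℝ EG] [NormedAddCommGroup EM] [NormedSpace ℝ EM]
  [TopologicalSpace G] [ChartedSpace EG G] [TopologicalSpace M] [ChartedSpace EM M]
  {𝒢 : LieGroupoid EG EM G M} {k : ℕ}

theorem mk_apply_congr_TM (v : 𝒢.Raw (TangentSpace 𝓘(ℝ, EM)) k)
    {p q : 𝒢.Strings k} (h : p = q) :
    (⟨p.obj 0, v p⟩ : TangentBundle 𝓘(ℝ, EM) M) = ⟨q.obj 0, v q⟩ := by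
  cases h; rfl

theorem transport_apply_congr {E : M → Type*} [∀ x, AddCommGroup (E x)]
    [∀ x, Module ℝ (E x)] (u : 𝒢.Raw E k) {p q : 𝒢.Strings k} (h : p = q) {x : M}
    (hp : p.obj 0 = x) (hq : q.obj 0 = x) : transport E hp (u p) = transport E hq (u q) := by
  cases h; rfl

variable [IsManifold 𝓘(ℝ, EG) ∞ G] [IsManifold 𝓘(ℝ, EM) ∞ M]

namespace EhresmannConnection

variable (σ : 𝒢.EhresmannConnection)

theorem assemble_succ_apply (w : 𝒢.RawAd (k + 1)) (p : 𝒢.Strings (k + 1)) :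
    (σ.assemble (k + 1) w : ∀ p : 𝒢.Strings (k + 1), TangentSpace 𝓘(ℝ, EG) (p.arr 0)) p =
      𝒢.r (p.arr 0) (transport 𝒢.TU p.t_zero.symm (w.1 p)) -
        σ.σ (p.arr 0) (transport (TangentSpace 𝓘(ℝ, EM) (M := M)) p.s_zero.symm
          ((w.2 : 𝒢.Raw (TangentSpace 𝓘(ℝ, EM)) k) p.tail)) := rfl

theorem structureOp_succ_fst_apply (u : 𝒢.Raw 𝒢.TU (k + 1))
    (v : 𝒢.Raw (TangentSpace 𝓘(ℝ, EM)) k) (p : 𝒢.Strings (k + 2)) :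
    (σ.structureOp (k + 1) (u, v)).1 p =
      transport 𝒢.TU p.t_zero (σ.lamA (p.arr 0) (transport 𝒢.TU p.s_zero.symm (u p.tail))) +
        ∑ j : Fin (k + 2), (-1 : ℝ) ^ ((j : ℕ) + 1) •
          transport 𝒢.TU (p.contract_obj_zero j) (u (p.contract j)) +
      transport 𝒢.TU p.t_zero (σ.K (p.arr 0) (p.tail.arr 0) (p.comp (i := 0) (j := 1) (by simp))
        (transport (TangentSpace 𝓘(ℝ, EM) (M := M)) p.tail.s_zero.symm (v p.tail.tail))) := rfl

theorem structureOp_succ_snd_apply (u : 𝒢.Raw 𝒢.TU (k + 1))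
    (v : 𝒢.Raw (TangentSpace 𝓘(ℝ, EM)) k) (p : 𝒢.Strings (k + 1)) :
    ((σ.structureOp (k + 1) (u, v)).2 : 𝒢.Raw (TangentSpace 𝓘(ℝ, EM)) (k + 1)) p =
      -(transport (TangentSpace 𝓘(ℝ, EM) (M := M)) p.t_zero (σ.lamTM (p.arr 0)
          (transport (TangentSpace 𝓘(ℝ, EM) (M := M)) p.s_zero.symm (v p.tail))) +
        ∑ j : Fin (k + 1), (-1 : ℝ) ^ ((j : ℕ) + 1) •
          transport (TangentSpace 𝓘(ℝ, EM) (M := M)) (p.contract_obj_zero j) (v (p.contract j))) +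
      𝒢.anchor (p.obj 0) (u p) := rfl

/-- With `a`, `b` the values at the target and the source of the arrow, `r(λ b - a) - σ(ρ b)` equals
minus the sum of `r a` and the left invariant vector of `b`, by `r_lamA`. -/
theorem deformDiffZero_eq_assemble {w : 𝒢.RawAd 0} (hA : ∀ p, w.1 p ∈ 𝒢.A (p.obj 0)) :
    (𝒢.deformDiffZero w.1 : 𝒢.RawDef 1) = σ.assemble 1 (σ.structureOp 0 w) := by
  funext p
  have h1 : (σ.structureOp 0 w).1 p =
      transport 𝒢.TU p.t_zero (σ.lamA (p.arr 0) (transport 𝒢.TU p.s_zero.symm (w.1 p.tail))) +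
        ∑ j : Fin 1, (-1 : ℝ) ^ ((j : ℕ) + 1) •
          transport 𝒢.TU (p.contract_obj_zero j) (w.1 (p.contract j)) := add_zero _
  have h2 : ((σ.structureOp 0 w).2 : 𝒢.Raw (TangentSpace 𝓘(ℝ, EM)) 0) p.tail =
      𝒢.anchor (p.tail.obj 0) (w.1 p.tail) :=
    (congrArg (fun X => X + 𝒢.anchor (p.tail.obj 0) (w.1 p.tail))
      (neg_zero (G := TangentSpace 𝓘(ℝ, EM) (p.tail.obj 0)))).trans (zero_add _)
  obtain ⟨a, ha⟩ : ∃ a : 𝒢.TU (𝒢.t (p.arr 0)), a = w.1 (Strings.pt (𝒢.t (p.arr 0))) := ⟨_, rfl⟩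
  obtain ⟨b, hb⟩ : ∃ b : 𝒢.TU (𝒢.s (p.arr 0)), b = w.1 (Strings.pt (𝒢.s (p.arr 0))) := ⟨_, rfl⟩
  have hbA : b ∈ 𝒢.A (𝒢.s (p.arr 0)) := hb ▸ hA (Strings.pt (𝒢.s (p.arr 0)))
  have h3 : transport 𝒢.TU p.s_zero.symm (w.1 p.tail) = b :=
    (transport_apply_congr w.1 p.tail_eq_pt _ rfl).trans hb.symm
  have h4 : transport 𝒢.TU ((p.contract_obj_zero 0).trans p.t_zero.symm) (w.1 (p.contract 0)) =
      a := (transport_apply_congr w.1 (p.contract_eq_pt 0) _ rfl).trans ha.symm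
  have h5 : 𝒢.deformDiffZero w.1 p = -(𝒢.r (p.arr 0) a + 𝒢.leftInv (p.arr 0) b) := by
    rw [ha, hb]; rfl
  refine Eq.trans ?_ (σ.assemble_succ_apply (k := 0) _ p).symm
  rw [h5, h1, h2, Fin.sum_univ_one, map_add,
    map_smul, transport_transport, transport_transport, transport_rfl, h4, h3, transport_anchor,
    h3, map_add, map_smul, σ.r_lamA hbA]
  simp only [Fin.val_zero, zero_add, pow_one, neg_smul, one_smul]
  abel

/-- The `dm̄` term is `transport_ddiv_assemble`. The other faces keep `g₁`, so they pass through `r`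
and `σ`. A face of index `j + 1` on the string has index `j` on the tail that `v` sees, and this
shift produces the sign in `-δ_λ v`. -/
theorem deformDiffPos_assemble {u : 𝒢.Raw 𝒢.TU (k + 1)} (hA : ∀ p, u p ∈ 𝒢.A (p.obj 0))
    (v : 𝒢.Raw (TangentSpace 𝓘(ℝ, EM)) k) :
    (𝒢.deformDiffPos k (σ.assemble (k + 1) (u, v)) : 𝒢.RawDef (k + 2)) =
      σ.assemble (k + 2) (σ.structureOp (k + 1) (u, v)) := by
  funext p
  refine Eq.trans ?_ (σ.assemble_succ_apply _ p).symm
  rw [structureOp_succ_fst_apply, structureOp_succ_snd_apply]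
  refine (deformDiffPos_apply (σ.assemble (k + 1) (u, v)) p).trans ?_
  have hgh : 𝒢.s (p.arr 0) = 𝒢.t (p.tail.arr 0) := p.comp (by simp)
  have hs : 𝒢.s (p.tail.arr 0) = 𝒢.s ((p.contract 0).arr 0) := by
    rw [(p.contract 0).s_zero, p.tail.s_zero, p.tail_contract_zero]
  have ht : 𝒢.t ((p.contract 0).arr 0) = 𝒢.t (p.arr 0) := by
    rw [(p.contract 0).t_zero, p.t_zero, p.contract_obj_zero]
  have hv : transport (TangentSpace 𝓘(ℝ, EM) (M := M)) (p.contract 0).s_zero.symm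
        (v (p.contract 0).tail) =
      transport (TangentSpace 𝓘(ℝ, EM) (M := M)) hs
        (transport (TangentSpace 𝓘(ℝ, EM) (M := M)) p.tail.s_zero.symm (v p.tail.tail)) := by
    rw [transport_transport]
    exact transport_eq_transport EM _ _ (mk_apply_congr_TM v p.tail_contract_zero)
  have hmain := σ.transport_ddiv_assemble hgh p.contract_zero_arr_zero hs p.div_contract ht
    (transport (TangentSpace 𝓘(ℝ, EM) (M := M)) p.tail.s_zero.symm (v p.tail.tail))
    (𝒢.transport_mem_A (p.contract 0).t_zero.symm (hA (p.contract 0)))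
    (𝒢.transport_mem_A p.tail.t_zero.symm (hA p.tail))
  rw [← hv, transport_transport, transport_transport] at hmain
  have hsum : ∀ j : Fin (k + 1), transport (TangentSpace 𝓘(ℝ, EG) (M := G))
      (p.contract_succ_arr_zero j)
      ((σ.assemble (k + 1) (u, v) : ∀ p : 𝒢.Strings (k + 1), TangentSpace 𝓘(ℝ, EG) (p.arr 0))
        (p.contract j.succ)) =
      𝒢.r (p.arr 0) (transport 𝒢.TU ((p.contract_obj_zero j.succ).trans p.t_zero.symm)
        (u (p.contract j.succ))) -
      σ.σ (p.arr 0) (transport (TangentSpace 𝓘(ℝ, EM) (M := M))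
        ((p.tail.contract_obj_zero j).trans p.s_zero.symm) (v (p.tail.contract j))) := by
    intro j
    rw [assemble_succ_apply, map_sub, transport_r, transport_σ, transport_transport,
      transport_transport]
    congr 2
    exact transport_eq_transport EM _ _ (mk_apply_congr_TM v (p.tail_contract_succ j))
  refine (congrArg₂ (fun a b => -a + b) hmain (Finset.sum_congr rfl fun (j : Fin (k + 1)) _ =>
    congrArg (fun X => (-1 : ℝ) ^ ((j : ℕ) + 2) • X) (hsum j))).trans ?_
  -- The face `g₁g₂` of `u` is isolated, since on the other side it comes out of `dm̄`.
  rw [Fin.sum_univ_succ (n := k + 1)]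
  simp only [map_add, map_sub, map_neg, map_sum, map_smul, transport_transport, transport_rfl,
    transport_anchor, smul_sub, Finset.sum_sub_distrib, Fin.val_succ]
  have hpow : ∀ j : ℕ, (-1 : ℝ) ^ (j + 2) = -(-1) ^ (j + 1) := fun j => by rw [pow_succ]; ring
  simp only [hpow, neg_smul, Finset.sum_neg_distrib, Fin.val_zero, zero_add, pow_one, one_smul]
  -- From here on the identity holds for arbitrary coefficients in place of the signs.
  obtain ⟨ε, hε⟩ : ∃ ε : ℕ → ℝ, ∀ j, (-1 : ℝ) ^ (j + 1) = ε j := ⟨_, fun _ => rfl⟩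
  simp only [hε]
  abel

end EhresmannConnection

end LieGroupoid

/-! ### Bijectivity of `I_σ` -/

namespace LieGroupoid

variable {EG EM G M : Type*}
  [NormedAddCommGroup EG] [NormedSpace ℝ EG] [NormedAddCommGroup EM] [NormedSpace ℝ EM]
  [TopologicalSpace G] [ChartedSpace EG G] [TopologicalSpace M] [ChartedSpace EM M]
  {𝒢 : LieGroupoid EG EM G M} {k : ℕ}
  [IsManifold 𝓘(ℝ, EG) ∞ G] [IsManifold 𝓘(ℝ, EM) ∞ M]

/-- The deformation differential on smooth projectable cochains. -/
def deformD (𝒢 : LieGroupoid EG EM G M) (k : ℕ) : 𝒢.CDef k →ₗ[ℝ] 𝒢.CDef (k + 1) :=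
  (𝒢.deformDiff k).restrict (p := 𝒢.CDef k) (q := 𝒢.CDef (k + 1)) fun c hc =>
    match k, c, hc with
    | 0, _, hc => deformDiffZero_mem hc
    | _ + 1, _, hc => deformDiffPos_mem hc

theorem coe_deformD (c : 𝒢.CDef k) :
    (𝒢.deformD k c : 𝒢.RawDef (k + 1)) = 𝒢.deformDiff k c := rfl

theorem deformD_deformD (k : ℕ) (c : 𝒢.CDef k) : 𝒢.deformD (k + 1) (𝒢.deformD k c) = 0 := by
  obtain ⟨c, hc⟩ := c
  refine Subtype.ext ?_
  match k, c, hc with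
  | 0, _, hc => exact deformDiffPos_deformDiffZero hc
  | _ + 1, _, hc => exact deformDiffPos_deformDiffPos hc

namespace EhresmannConnection

variable (σ : 𝒢.EhresmannConnection)

/-- `EhresmannConnection.assemble` as a linear map. -/
def assembleLin : ∀ k, 𝒢.RawAd k →ₗ[ℝ] 𝒢.RawDef k
  | 0 => LinearMap.fst ℝ (𝒢.Raw 𝒢.TU 0) (𝒢.RawShift 0)
  | k + 1 =>
    (LinearMap.pi fun p : 𝒢.Strings (k + 1) =>
      𝒢.r (p.arr 0) ∘ₗ transport 𝒢.TU p.t_zero.symm ∘ₗ LinearMap.proj p ∘ₗ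
          LinearMap.fst ℝ (𝒢.Raw 𝒢.TU (k + 1)) (𝒢.Raw (TangentSpace 𝓘(ℝ, EM)) k) -
        σ.σ (p.arr 0) ∘ₗ transport (TangentSpace 𝓘(ℝ, EM) (M := M)) p.s_zero.symm ∘ₗ
          LinearMap.proj p.tail ∘ₗ
          LinearMap.snd ℝ (𝒢.Raw 𝒢.TU (k + 1)) (𝒢.Raw (TangentSpace 𝓘(ℝ, EM)) k) :
      (𝒢.Raw 𝒢.TU (k + 1) × 𝒢.Raw (TangentSpace 𝓘(ℝ, EM)) k) →ₗ[ℝ]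
        (∀ p : 𝒢.Strings (k + 1), TangentSpace 𝓘(ℝ, EG) (p.arr 0)))

theorem assembleLin_apply (k : ℕ) (w : 𝒢.RawAd k) : σ.assembleLin k w = σ.assemble k w := by
  cases k <;> rfl

theorem assemble_mem {w : 𝒢.RawAd k} (hw : w ∈ 𝒢.CAd k) : σ.assemble k w ∈ 𝒢.CDef k := by
  obtain ⟨u, v⟩ := w
  obtain ⟨hu, hv⟩ := hw
  match k, u, v, hu, hv with
  | 0, u, v, hu, hv => exact hu
  | k + 1, u, v, hu, hv =>
    change u ∈ 𝒢.CA (k + 1) at hu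
    change v ∈ 𝒢.CTM k at hv
    refine ⟨fun n φ hφ => contMDiff_sub_along (contMDiff_r (fun z => ?_) (hφ.2 0) ?_)
      (σ.contMDiff_σ (hφ.2 0) ?_), fun q => -(v : 𝒢.Raw (TangentSpace 𝓘(ℝ, EM)) k) q, fun p => ?_⟩
    · exact 𝒢.transport_mem_A _ (hu.1 _)
    · simp only [mk_transport_TU]
      exact hu.2 n φ hφ
    · simp only [mk_transport]
      exact hv n _ hφ.tail
    · rw [assemble_succ_apply, map_sub, 𝒢.ds_r (𝒢.transport_mem_A _ (hu.1 _)), σ.ds_σ, zero_sub,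
        map_neg, transport_transport, transport_rfl]

/-- Applying `ds` isolates `v` on tails. Every string is a tail, for instance of the string with a
unit in front. After `v` vanishes, `rInv` recovers `u`; smoothness plays no role. -/
theorem eq_zero_of_assemble_eq_zero {w : 𝒢.RawAd k} (hA : ∀ p, w.1 p ∈ 𝒢.A (p.obj 0))
    (hw : σ.assemble k w = 0) : w = 0 := by
  obtain ⟨u, v⟩ := w
  match k, u, v, hA, hw with
  | 0, u, v, hA, hw => exact Prod.ext hw rfl
  | k + 1, u, v, hA, hw =>
    have hp : ∀ p : 𝒢.Strings (k + 1), 𝒢.r (p.arr 0) (transport 𝒢.TU p.t_zero.symm (u p)) -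
        σ.σ (p.arr 0) (transport (TangentSpace 𝓘(ℝ, EM) (M := M)) p.s_zero.symm
          ((v : 𝒢.Raw (TangentSpace 𝓘(ℝ, EM)) k) p.tail)) = 0 := fun p => congrFun hw p
    have hv : ∀ q, (v : 𝒢.Raw (TangentSpace 𝓘(ℝ, EM)) k) q = 0 := by
      intro q
      have h := congrArg (𝒢.ds _) (hp q.consUnit)
      rw [map_sub, 𝒢.ds_r (𝒢.transport_mem_A _ (hA _)), σ.ds_σ, map_zero, zero_sub, neg_eq_zero,
        transport_eq_iff, map_zero] at h
      exact h
    refine Prod.ext (funext fun p => ?_) (funext hv)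
    have h := hp p
    rw [hv, map_zero, map_zero, sub_zero] at h
    have h2 := congrArg (𝒢.rInv _) h
    rw [𝒢.rInv_r (𝒢.transport_mem_A _ (hA _)), map_zero, transport_eq_iff, map_zero] at h2
    exact h2

theorem assemble_injective {w w' : 𝒢.RawAd k} (hA : ∀ p, w.1 p ∈ 𝒢.A (p.obj 0))
    (hA' : ∀ p, w'.1 p ∈ 𝒢.A (p.obj 0)) (h : σ.assemble k w = σ.assemble k w') : w = w' := by
  rw [← sub_eq_zero]
  refine σ.eq_zero_of_assemble_eq_zero (fun p => (𝒢.A _).sub_mem (hA p) (hA' p)) ?_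
  rw [← assembleLin_apply, map_sub, assembleLin_apply, assembleLin_apply, h, sub_self]

/-- Take `u = ω(c)` and `v = -ds c`. The function `s_c` in the definition of projectability is not
assumed smooth, so `v` is defined by evaluating on `(1, g₂, …)`, which is visibly smooth.
Projectability then allows the unit to be replaced by `g₁`. -/
theorem exists_assemble_eq {c : 𝒢.RawDef k} (hc : c ∈ 𝒢.CDef k) :
    ∃ w ∈ 𝒢.CAd k, σ.assemble k w = c := by
  match k, c, hc with
  | 0, c, hc => exact ⟨(c, PUnit.unit), ⟨hc, trivial⟩, rfl⟩
  | k + 1, c, hc =>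
    change ∀ p : 𝒢.Strings (k + 1), TangentSpace 𝓘(ℝ, EG) (p.arr 0) at c
    change c ∈ 𝒢.CDefPos k at hc
    let u : 𝒢.Raw 𝒢.TU (k + 1) := fun p =>
      transport 𝒢.TU p.t_zero (σ.leftSplit (p.arr 0) (c p))
    let v : 𝒢.Raw (TangentSpace 𝓘(ℝ, EM)) k := fun q =>
      -transport (TangentSpace 𝓘(ℝ, EM) (M := M)) q.consUnit.s_zero
        (𝒢.ds (q.consUnit.arr 0) (c q.consUnit))
    refine ⟨(u, v), ⟨⟨fun p => 𝒢.transport_mem_A _ (σ.leftSplit_mem_A _ _), fun n φ hφ => ?_⟩,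
      fun n φ hφ => contMDiff_neg_along ?_⟩, ?_⟩
    · simp only [u, mk_transport_TU]
      exact σ.contMDiff_leftSplit (hc.1 n φ hφ)
    · have := contMDiff_ds (𝒢 := 𝒢) (hc.1 n _ hφ.consUnit)
      refine this.congr fun z => ?_
      exact mk_transport EM _ _
    · funext p
      refine (σ.assemble_succ_apply (u, v) p).trans ?_
      have h1 : transport 𝒢.TU p.t_zero.symm (u p) = σ.leftSplit (p.arr 0) (c p) :=
        (transport_transport _ _ _).trans (transport_rfl _ _)
      have h2 : transport (TangentSpace 𝓘(ℝ, EM) (M := M)) p.s_zero.symm (v p.tail) =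
          -𝒢.ds (p.arr 0) (c p) := by
        refine (map_neg _ _).trans (congrArg Neg.neg ?_)
        refine (transport_transport (E := TangentSpace 𝓘(ℝ, EM) (M := M)) _ _ _).trans ?_
        exact transport_eq_of_mk_eq EM _ (Ts_eq_of_tail_eq hc p.tail.tail_consUnit)
      refine (congrArg₂ (fun a b => 𝒢.r (p.arr 0) a - σ.σ (p.arr 0) b) h1 h2).trans ?_
      simp only [map_neg, sub_neg_eq_add, r_leftSplit, sub_add_cancel]

/-- The isomorphism `C(G, A ⊕ TM) ≅ C_def(G)` given by assembling cochains. -/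
def assembleEquiv (k : ℕ) : 𝒢.CAd k ≃ₗ[ℝ] 𝒢.CDef k :=
  LinearEquiv.ofBijective ((σ.assembleLin k).restrict (p := 𝒢.CAd k) (q := 𝒢.CDef k)
    fun w hw => by rw [assembleLin_apply]; exact σ.assemble_mem hw) <| by
    refine ⟨fun w w' h => ?_, fun c => ?_⟩
    · refine Subtype.ext (σ.assemble_injective w.2.1.1 w'.2.1.1 ?_)
      have := congrArg Subtype.val h
      simpa only [LinearMap.coe_restrict_apply, assembleLin_apply] using this
    · obtain ⟨w, hw, h⟩ := σ.exists_assemble_eq c.2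
      refine ⟨⟨w, hw⟩, Subtype.ext ?_⟩
      simpa only [LinearMap.coe_restrict_apply, assembleLin_apply] using h

theorem coe_assembleEquiv (w : 𝒢.CAd k) : (σ.assembleEquiv k w : 𝒢.RawDef k) = σ.assemble k w :=
  σ.assembleLin_apply k w

theorem structureOp_mem_A {w : 𝒢.RawAd k} (hA : ∀ p, w.1 p ∈ 𝒢.A (p.obj 0))
    (p : 𝒢.Strings (k + 1)) : (σ.structureOp k w).1 p ∈ 𝒢.A (p.obj 0) := by
  have h1 : 𝒢.deltaOp 𝒢.TU σ.lamA k w.1 p ∈ 𝒢.A (p.obj 0) :=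
    (𝒢.A _).add_mem (𝒢.transport_mem_A _ (σ.lamA_mem_A _ _))
      ((𝒢.A _).sum_mem fun j _ => (𝒢.A _).smul_mem _ (𝒢.transport_mem_A _ (hA _)))
  refine (𝒢.A _).add_mem h1 ?_
  obtain ⟨u, v⟩ := w
  match k, v, p with
  | 0, _, _ => exact (𝒢.A _).zero_mem
  | k + 1, _, _ => exact 𝒢.transport_mem_A _ (σ.K_mem_A _ _ _ _)

theorem deformDiff_assemble {w : 𝒢.RawAd k} (hA : ∀ p, w.1 p ∈ 𝒢.A (p.obj 0)) :
    𝒢.deformDiff k (σ.assemble k w) = σ.assemble (k + 1) (σ.structureOp k w) := by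
  obtain ⟨u, v⟩ := w
  match k, u, v, hA with
  | 0, _, _, hA => exact σ.deformDiffZero_eq_assemble hA
  | k + 1, _, _, hA => exact σ.deformDiffPos_assemble hA _

end EhresmannConnection

end LieGroupoid

namespace LieGroupoid

variable {EG EM G M : Type*}
  [NormedAddCommGroup EG] [NormedSpace ℝ EG] [NormedAddCommGroup EM] [NormedSpace ℝ EM]
  [TopologicalSpace G] [ChartedSpace EG G] [TopologicalSpace M] [ChartedSpace EM M]
  {𝒢 : LieGroupoid EG EM G M} {k l m : ℕ}

/-! ### Front and back faces of strings -/

namespace Strings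

theorem front_contract_of_lt (h : k + l = m) (h' : k + 1 + l = m + 1) (p : 𝒢.Strings (m + 1))
    {j : Fin (m + 1)} {i : Fin (k + 1)} (hij : (i : ℕ) = j) :
    (p.contract j).front h = (p.front h').contract i := by
  ext a
  · show (p.contract j).obj ⟨a, _⟩ = ((p.front h').contract i).obj a
    rcases le_or_gt (a : ℕ) (j : ℕ) with h1 | h1
    · rw [contract_obj_of_le _ _ h1, contract_obj_of_le _ _ (by omega)]
      rfl
    · rw [contract_obj_of_gt _ _ h1, contract_obj_of_gt _ _ (by omega)]
      rfl
  · show (p.contract j).arr ⟨a, _⟩ = ((p.front h').contract i).arr a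
    rcases lt_trichotomy (a : ℕ) (j : ℕ) with h1 | h1 | h1
    · rw [contract_arr_of_lt _ _ h1, contract_arr_of_lt _ _ (by omega)]
      rfl
    · rw [contract_arr_of_eq _ _ h1, contract_arr_of_eq _ _ (by omega)]
      rfl
    · rw [contract_arr_of_gt _ _ h1, contract_arr_of_gt _ _ (by omega)]
      rfl

theorem back_contract_of_lt (h : k + l = m) (h' : k + 1 + l = m + 1) (p : 𝒢.Strings (m + 1))
    {j : Fin (m + 1)} (hj : (j : ℕ) < k) : (p.contract j).back h = p.back h' := by
  ext a
  · refine (contract_obj_of_gt j p (i := ⟨k + a, by omega⟩) (Nat.lt_add_right _ hj)).trans ?_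
    exact congrArg p.obj (Fin.ext (by simp; omega))
  · refine (contract_arr_of_gt j p (i := ⟨k + a, by omega⟩) (Nat.lt_add_right _ hj)).trans ?_
    exact congrArg p.arr (Fin.ext (by simp; omega))

theorem front_contract_of_le (h : k + l = m) (h' : k + (l + 1) = m + 1) (p : 𝒢.Strings (m + 1))
    {j : Fin (m + 1)} (hj : k ≤ (j : ℕ)) : (p.contract j).front h = p.front h' := by
  ext a
  · exact contract_obj_of_le j p (i := ⟨a, by omega⟩) (by simp; omega)
  · exact contract_arr_of_lt j p (i := ⟨a, by omega⟩) (by simp; omega)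

theorem back_contract_of_le (h : k + l = m) (h' : k + (l + 1) = m + 1) (p : 𝒢.Strings (m + 1))
    {j : Fin (m + 1)} {i : Fin (l + 1)} (hij : k + (i : ℕ) = j) :
    (p.contract j).back h = (p.back h').contract i := by
  ext a
  · show (p.contract j).obj ⟨k + a, _⟩ = ((p.back h').contract i).obj a
    rcases le_or_gt (a : ℕ) (i : ℕ) with h1 | h1
    · rw [contract_obj_of_le _ _ (by simp; omega), contract_obj_of_le _ _ h1]
      rfl
    · rw [contract_obj_of_gt _ _ (by simp; omega), contract_obj_of_gt _ _ h1]
      rfl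
  · show (p.contract j).arr ⟨k + a, _⟩ = ((p.back h').contract i).arr a
    rcases lt_trichotomy (a : ℕ) (i : ℕ) with h1 | h1 | h1
    · rw [contract_arr_of_lt _ _ (by simp; omega), contract_arr_of_lt _ _ h1]
      rfl
    · rw [contract_arr_of_eq _ _ (by simp; omega), contract_arr_of_eq _ _ h1]
      rfl
    · rw [contract_arr_of_gt _ _ (by simp; omega), contract_arr_of_gt _ _ h1]
      rfl

theorem contract_last (p : 𝒢.Strings (k + 1)) : p.contract (Fin.last k) = p.front rfl := by
  ext a
  · exact contract_obj_of_le _ p (by simp; omega)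
  · exact contract_arr_of_lt _ p (by simp)

theorem tail_back (h : k + l = m) (h' : k + 1 + l = m + 1) (p : 𝒢.Strings (m + 1)) :
    p.tail.back h = p.back h' := by
  ext a
  · exact congrArg p.obj (Fin.ext (by simp; omega))
  · exact congrArg p.arr (Fin.ext (by simp; omega))

theorem back_tail (h : k + (l + 1) = m) (h' : k + 1 + l = m) (p : 𝒢.Strings m) :
    (p.back h).tail = p.back h' := by
  ext a
  · exact congrArg p.obj (Fin.ext (by simp; omega))
  · exact congrArg p.arr (Fin.ext (by simp; omega))

theorem back_back {a b l' : ℕ} (h₂ : a + l' = m) (h₁ : k + l = a) (h₃ : l + l' = b)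
    (h₄ : k + b = m) (p : 𝒢.Strings m) : (p.back h₄).back h₃ = p.back h₂ := by
  ext i
  · exact congrArg p.obj (Fin.ext (by simp; omega))
  · exact congrArg p.arr (Fin.ext (by simp; omega))

end Strings

/-! ### The cup product -/

section Cup

variable {E : M → Type*} [∀ x, AddCommGroup (E x)] [∀ x, Module ℝ (E x)]

theorem cup_one (u : 𝒢.Raw E k) : 𝒢.cup E (Nat.add_zero k) u (fun _ => (1 : ℝ)) = u := by
  funext p
  exact one_smul ℝ (u p)

theorem cup_cup {a b l' : ℕ} (h₁ : k + l = a) (h₂ : a + l' = m) (h₃ : l + l' = b)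
    (h₄ : k + b = m) (u : 𝒢.Raw E k) (f : 𝒢.Raw (Line (M := M)) l)
    (f' : 𝒢.Raw (Line (M := M)) l') :
    𝒢.cup E h₂ (𝒢.cup E h₁ u f) f' = 𝒢.cup E h₄ u (𝒢.cup (Line (M := M)) h₃ f f') := by
  funext p
  have h : f' ((p.back h₄).back h₃) = f' (p.back h₂) := by rw [p.back_back h₂ h₁ h₃ h₄]
  refine (smul_smul (f' (p.back h₂)) (f (p.back h₄ |>.front h₃))
    (u (p.front h₄) : E (p.obj 0))).trans ?_
  rw [← h]
  rfl

theorem deltaOp_apply (lam : ∀ g, E (𝒢.s g) →ₗ[ℝ] E (𝒢.t g)) (u : 𝒢.Raw E k)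
    (p : 𝒢.Strings (k + 1)) : 𝒢.deltaOp E lam k u p =
      transport E p.t_zero (lam (p.arr 0) (transport E p.s_zero.symm (u p.tail))) +
      ∑ j : Fin (k + 1), (-1 : ℝ) ^ ((j : ℕ) + 1) •
        transport E (p.contract_obj_zero j) (u (p.contract j)) := rfl

omit [TopologicalSpace M] in
theorem transport_Line {x y : M} (h : x = y) (a : ℝ) :
    transport (Line (M := M)) h a = a := by
  cases h; rfl

theorem delta_apply (f : 𝒢.Raw (Line (M := M)) l) (p : 𝒢.Strings (l + 1)) :
    𝒢.delta l f p = f p.tail + ∑ j : Fin (l + 1), (-1 : ℝ) ^ ((j : ℕ) + 1) * f (p.contract j) := by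
  refine (deltaOp_apply _ f p).trans (congrArg₂ (· + ·) ?_ (Finset.sum_congr rfl fun j _ => ?_))
  · exact (transport_Line p.t_zero _).trans (transport_Line p.s_zero.symm (f p.tail))
  · exact congrArg (fun x : ℝ => (-1 : ℝ) ^ ((j : ℕ) + 1) * x) (transport_Line _ _)

/-- The first `k` faces act on the arguments of `u` and the last `l + 1` on those of `f`. The
right-hand side has two further terms, the last face of `u` and the leading term of `δf`. Both are
`f(g_{k+2}, …) u(g₁, …, g_k)`, with signs `(-1)^{k+1}` and `(-1)^k`, and they cancel. No
multiplicativity of `λ` is needed. -/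
theorem deltaOp_cup (lam : ∀ g, E (𝒢.s g) →ₗ[ℝ] E (𝒢.t g)) (h : k + l = m)
    (h₁ : k + 1 + l = m + 1) (h₂ : k + (l + 1) = m + 1) (u : 𝒢.Raw E k)
    (f : 𝒢.Raw (Line (M := M)) l) :
    𝒢.deltaOp E lam m (𝒢.cup E h u f) =
      𝒢.cup E h₁ (𝒢.deltaOp E lam k u) f + (-1 : ℝ) ^ k • 𝒢.cup E h₂ u (𝒢.delta l f) := by
  subst h
  funext p
  obtain ⟨U, hU⟩ : ∃ U : E (p.obj 0), U = u (p.front h₂) := ⟨_, rfl⟩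
  obtain ⟨W, hW⟩ : ∃ W : Fin (k + 1) → E (p.obj 0), ∀ j, W j =
    transport E ((p.front h₁).contract_obj_zero j) (u ((p.front h₁).contract j)) := ⟨_, fun _ => rfl⟩
  obtain ⟨A, hA⟩ : ∃ A : E (p.obj 0), A = transport E p.t_zero (lam (p.arr 0)
    (transport E p.s_zero.symm (u (p.front h₁).tail))) := ⟨_, rfl⟩
  have hR : (𝒢.cup E h₁ (𝒢.deltaOp E lam k u) f +
      (-1 : ℝ) ^ k • 𝒢.cup E h₂ u (𝒢.delta l f)) p =
      f (p.back h₁) • (A + ∑ j : Fin (k + 1), (-1 : ℝ) ^ ((j : ℕ) + 1) • W j) +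
      (-1 : ℝ) ^ k • (𝒢.delta l f (p.back h₂) • U) := by
    rw [hU, hA, funext hW]; rfl
  have hfirst : transport E p.t_zero (lam (p.arr 0) (transport E p.s_zero.symm
      (𝒢.cup E rfl u f p.tail))) = f (p.back h₁) • A := by
    rw [hA, ← p.tail_back rfl h₁, ← map_smul, ← map_smul]
    refine congrArg (fun x => transport E p.t_zero (lam (p.arr 0) x)) ?_
    exact map_smul _ _ _
  have hlow : ∀ j : Fin k, transport E
        (p.contract_obj_zero (Fin.castAdd (l + 1) j : Fin (k + (l + 1))))
        (𝒢.cup E rfl u f (p.contract (Fin.castAdd (l + 1) j : Fin (k + (l + 1))))) =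
      f (p.back h₁) • W j.castSucc := by
    intro j
    refine (map_smul (transport E _) _ _).trans ?_
    rw [p.back_contract_of_lt rfl h₁ (by simp), hW]
    congr 1
    exact transport_apply_congr u (p.front_contract_of_lt rfl h₁ (by simp)) _ _
  have hhigh : ∀ i : Fin (l + 1), transport E
        (p.contract_obj_zero (Fin.natAdd k i : Fin (k + (l + 1))))
        (𝒢.cup E rfl u f (p.contract (Fin.natAdd k i : Fin (k + (l + 1))))) =
      f ((p.back h₂).contract i) • U := by
    intro i
    refine (map_smul (transport E _) _ _).trans ?_
    rw [p.back_contract_of_le rfl h₂ (i := i) (by simp)]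
    congr 1
    exact (transport_apply_congr u (p.front_contract_of_le rfl h₂ (by simp)) _ rfl).trans hU.symm
  have hlast : W (Fin.last k) = U :=
    (hW _).trans ((transport_apply_congr u (p.front h₁).contract_last _ rfl).trans hU.symm)
  have hsum : ∑ j : Fin (k + l + 1), (-1 : ℝ) ^ ((j : ℕ) + 1) •
        transport E (p.contract_obj_zero j) (𝒢.cup E rfl u f (p.contract j)) =
      ∑ j : Fin k, (-1 : ℝ) ^ ((j : ℕ) + 1) • f (p.back h₁) • W j.castSucc +
        ∑ i : Fin (l + 1), (-1 : ℝ) ^ (k + (i : ℕ) + 1) • f ((p.back h₂).contract i) • U := by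
    refine (Fin.sum_univ_add (a := k) (b := l + 1) _).trans ?_
    exact congrArg₂ (· + ·)
      (Finset.sum_congr rfl fun j _ => congrArg (fun x => (-1 : ℝ) ^ ((j : ℕ) + 1) • x) (hlow j))
      (Finset.sum_congr rfl fun i _ =>
        congrArg (fun x => (-1 : ℝ) ^ (k + (i : ℕ) + 1) • x) (hhigh i))
  rw [hR, delta_apply, deltaOp_apply, hfirst, hsum,
    Fin.sum_univ_castSucc (n := k) (fun j => (-1 : ℝ) ^ ((j : ℕ) + 1) • W j), hlast, p.back_tail h₂ h₁]
  simp only [Fin.val_castSucc, Fin.val_last, smul_add, add_smul, Finset.smul_sum, Finset.sum_smul,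
    mul_smul, smul_comm (f (p.back h₁)), pow_add, pow_one, neg_smul, one_smul, smul_neg]
  abel

end Cup

end LieGroupoid

namespace LieGroupoid

variable {EG EM G M : Type*}
  [NormedAddCommGroup EG] [NormedSpace ℝ EG] [NormedAddCommGroup EM] [NormedSpace ℝ EM]
  [TopologicalSpace G] [ChartedSpace EG G] [TopologicalSpace M] [ChartedSpace EM M]
  {𝒢 : LieGroupoid EG EM G M} {k l m : ℕ}

/-! ### The action on cochains with values in `A ⊕ TM` -/

theorem actAd_one (w : 𝒢.RawAd k) : 𝒢.actAd (Nat.add_zero k) w (fun _ => (1 : ℝ)) = w := by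
  obtain ⟨u, v⟩ := w
  refine Prod.ext (cup_one u) ?_
  match k, v with
  | 0, v => rfl
  | k + 1, v => exact cup_one (E := TangentSpace 𝓘(ℝ, EM)) v

theorem actAd_actAd {a b l' : ℕ} (h₁ : k + l = a) (h₂ : a + l' = m) (h₃ : l + l' = b)
    (h₄ : k + b = m) (w : 𝒢.RawAd k) (f : 𝒢.Raw (Line (M := M)) l)
    (f' : 𝒢.Raw (Line (M := M)) l') :
    𝒢.actAd h₂ (𝒢.actAd h₁ w f) f' = 𝒢.actAd h₄ w (𝒢.cup (Line (M := M)) h₃ f f') := by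
  obtain ⟨u, v⟩ := w
  refine Prod.ext (cup_cup h₁ h₂ h₃ h₄ u f f') ?_
  match k, a, m, v, h₁, h₂, h₄ with
  | 0, a, m, v, h₁, h₂, h₄ =>
    show 𝒢.cupShift h₂ (0 : 𝒢.RawShift a) f' = 0
    rw [map_zero, LinearMap.zero_apply]
  | k + 1, 0, _, _, h₁, _, _ => omega
  | k + 1, a + 1, 0, _, _, h₂, _ => omega
  | k + 1, a + 1, m + 1, v, h₁, h₂, h₄ =>
    exact cup_cup (E := TangentSpace 𝓘(ℝ, EM)) (by omega) (by omega) h₃ (by omega) v f f'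

theorem anchorOp_cup (h : k + l = m) (u : 𝒢.Raw 𝒢.TU k) (f : 𝒢.Raw (Line (M := M)) l) :
    𝒢.anchorOp m (𝒢.cup 𝒢.TU h u f) =
      𝒢.cup (TangentSpace 𝓘(ℝ, EM)) h (𝒢.anchorOp k u) f := by
  funext p
  exact map_smul (𝒢.anchor (p.obj 0)) (f (p.back h)) _

section Mem

variable [IsManifold 𝓘(ℝ, EG) ∞ G] [IsManifold 𝓘(ℝ, EM) ∞ M]

omit [IsManifold 𝓘(ℝ, EM) ∞ M] in
theorem cup_mem_CA (h : k + l = m) {u : 𝒢.Raw 𝒢.TU k} (hu : u ∈ 𝒢.CA k)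
    {f : 𝒢.Raw (Line (M := M)) l} (hf : f ∈ 𝒢.C l) : 𝒢.cup 𝒢.TU h u f ∈ 𝒢.CA m :=
  ⟨fun p => (𝒢.A (p.obj 0)).smul_mem _ (hu.1 (p.front h)), fun n _ hφ =>
    contMDiff_mul_along (hf n _ (hφ.back h)) (hu.2 n _ (hφ.front h))⟩

omit [IsManifold 𝓘(ℝ, EG) ∞ G] in
theorem cup_mem_CTM (h : k + l = m) {v : 𝒢.Raw (TangentSpace 𝓘(ℝ, EM)) k} (hv : v ∈ 𝒢.CTM k)
    {f : 𝒢.Raw (Line (M := M)) l} (hf : f ∈ 𝒢.C l) :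
    𝒢.cup (TangentSpace 𝓘(ℝ, EM)) h v f ∈ 𝒢.CTM m := fun n _ hφ =>
  contMDiff_mul_along (hf n _ (hφ.back h)) (hv n _ (hφ.front h))

omit [IsManifold 𝓘(ℝ, EG) ∞ G] in
theorem cupShift_mem (h : k + l = m) {v : 𝒢.RawShift k} (hv : v ∈ 𝒢.CShift k)
    {f : 𝒢.Raw (Line (M := M)) l} (hf : f ∈ 𝒢.C l) : 𝒢.cupShift h v f ∈ 𝒢.CShift m := by
  match k, m, v, h, hv with
  | 0, m, _, _, _ => exact (𝒢.CShift m).zero_mem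
  | k + 1, 0, _, h, _ => omega
  | k + 1, m + 1, v, h, hv => exact cup_mem_CTM (by omega) hv hf

theorem actAd_mem (h : k + l = m) {w : 𝒢.RawAd k} (hw : w ∈ 𝒢.CAd k)
    {f : 𝒢.Raw (Line (M := M)) l} (hf : f ∈ 𝒢.C l) : 𝒢.actAd h w f ∈ 𝒢.CAd m :=
  ⟨cup_mem_CA h hw.1 hf, cupShift_mem h hw.2 hf⟩

end Mem

namespace EhresmannConnection

variable [IsManifold 𝓘(ℝ, EG) ∞ G] [IsManifold 𝓘(ℝ, EM) ∞ M]

variable (σ : 𝒢.EhresmannConnection)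

theorem curvCupShift_cupShift (h : k + l = m) (h₁ : k + 1 + l = m + 1) (v : 𝒢.RawShift k)
    (f : 𝒢.Raw (Line (M := M)) l) :
    σ.curvCupShift m (𝒢.cupShift h v f) = 𝒢.cup 𝒢.TU h₁ (σ.curvCupShift k v) f := by
  match k, m, v, h, h₁ with
  | 0, m, v, h, h₁ =>
    refine Eq.trans (map_zero (σ.curvCupShift m)) ?_
    funext p
    exact (smul_zero _).symm
  | k + 1, 0, _, h, _ => omega
  | k + 1, m + 1, v, h, h₁ =>
    obtain rfl : k + l = m := by omega
    funext p
    have hf : f (p.tail.tail.back rfl) = f (p.back h₁) := by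
      rw [p.tail.tail_back rfl (by omega), p.tail_back (by omega) h₁]
    obtain ⟨v', hv'⟩ : ∃ v' : TangentSpace 𝓘(ℝ, EM) (p.tail.tail.obj 0),
      v' = (v : 𝒢.Raw (TangentSpace 𝓘(ℝ, EM)) k) (p.front h₁).tail.tail := ⟨_, rfl⟩
    obtain ⟨L, hL⟩ : ∃ L : TangentSpace 𝓘(ℝ, EM) (p.tail.tail.obj 0) →ₗ[ℝ] 𝒢.TU (p.obj 0),
      L = transport 𝒢.TU p.t_zero ∘ₗ σ.K (p.arr 0) (p.arr 1) (p.comp (by simp)) ∘ₗ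
        transport (TangentSpace 𝓘(ℝ, EM) (M := M)) p.tail.s_zero.symm := ⟨_, rfl⟩
    have h2 : σ.curvCupShift (k + l + 1) (𝒢.cupShift h v f) p =
        L (f (p.tail.tail.back rfl) • v') := by rw [hv', hL]; rfl
    have h3 : 𝒢.cup 𝒢.TU h₁ (σ.curvCupShift (k + 1) v) f p = f (p.back h₁) • L v' := by
      rw [hv', hL]; rfl
    rw [h2, h3, hf, map_smul]

/-- A `TM`-component of total degree `k` is a cochain of degree `k - 1`, so its Leibniz rule has the
sign `(-1)^{k-1}`. The minus sign in front of `δ_λ v` corrects this to `(-1)^k`. -/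
theorem deltaShift_cupShift (h : k + l = m) (h₂ : k + (l + 1) = m + 1) (v : 𝒢.RawShift k)
    (f : 𝒢.Raw (Line (M := M)) l) {x : 𝒢.Raw (TangentSpace 𝓘(ℝ, EM)) m}
    (hx : x = 𝒢.cupShift h₂ v (𝒢.delta l f)) :
    -σ.deltaShift m (𝒢.cupShift h v f) =
      𝒢.cup (TangentSpace 𝓘(ℝ, EM)) h (-σ.deltaShift k v) f + (-1 : ℝ) ^ k • x := by
  match k, m, v, h, h₂, x, hx with
  | 0, m, v, h, h₂, x, hx =>
    have hx0 : x = 0 := hx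
    have hm : σ.deltaShift m (𝒢.cupShift h v f) = 0 := map_zero (σ.deltaShift m)
    have h0 : σ.deltaShift 0 v = 0 := rfl
    rw [hx0, hm, h0, neg_zero, neg_zero, map_zero, LinearMap.zero_apply, smul_zero, add_zero]
  | k + 1, 0, _, h, _, _, _ => omega
  | k + 1, m + 1, v, h, h₂, x, hx =>
    have hm : σ.deltaShift (m + 1) (𝒢.cupShift h v f) =
        𝒢.cup (TangentSpace 𝓘(ℝ, EM)) h (σ.deltaShift (k + 1) v) f + (-1 : ℝ) ^ k • x := by
      rw [hx]
      exact deltaOp_cup (E := TangentSpace 𝓘(ℝ, EM)) σ.lamTM (by omega : k + l = m) h (by omega) v f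
    rw [hm, map_neg, LinearMap.neg_apply, pow_succ, mul_neg_one, neg_smul, neg_add]

/-- The Leibniz rule for the structure operator. -/
theorem structureOp_actAd (h : k + l = m) (h₁ : k + 1 + l = m + 1) (h₂ : k + (l + 1) = m + 1)
    (w : 𝒢.RawAd k) (f : 𝒢.Raw (Line (M := M)) l) :
    σ.structureOp m (𝒢.actAd h w f) =
      𝒢.actAd h₁ (σ.structureOp k w) f + (-1 : ℝ) ^ k • 𝒢.actAd h₂ w (𝒢.delta l f) := by
  obtain ⟨u, v⟩ := w
  refine Prod.ext ?_ ?_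
  · show 𝒢.deltaOp 𝒢.TU σ.lamA m (𝒢.cup 𝒢.TU h u f) + σ.curvCupShift m (𝒢.cupShift h v f) =
      𝒢.cup 𝒢.TU h₁ (𝒢.deltaOp 𝒢.TU σ.lamA k u + σ.curvCupShift k v) f +
        (-1 : ℝ) ^ k • 𝒢.cup 𝒢.TU h₂ u (𝒢.delta l f)
    rw [deltaOp_cup σ.lamA h h₁ h₂, σ.curvCupShift_cupShift h h₁, map_add, LinearMap.add_apply]
    abel
  · obtain ⟨x, hx⟩ : ∃ x : 𝒢.Raw (TangentSpace 𝓘(ℝ, EM)) m,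
      x = 𝒢.cupShift h₂ v (𝒢.delta l f) := ⟨_, rfl⟩
    refine Eq.trans ?_ (congrArg (fun y : 𝒢.Raw (TangentSpace 𝓘(ℝ, EM)) m =>
      𝒢.cup (TangentSpace 𝓘(ℝ, EM)) h (-σ.deltaShift k v + 𝒢.anchorOp k u) f +
        (-1 : ℝ) ^ k • y) hx)
    show -σ.deltaShift m (𝒢.cupShift h v f) + 𝒢.anchorOp m (𝒢.cup 𝒢.TU h u f) =
      𝒢.cup (TangentSpace 𝓘(ℝ, EM)) h (-σ.deltaShift k v + 𝒢.anchorOp k u) f +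
        (-1 : ℝ) ^ k • x
    rw [σ.deltaShift_cupShift h h₂ v f hx, anchorOp_cup, map_add, LinearMap.add_apply]
    abel

/-- The scalar `f` is evaluated on the same last arrows for `u` and for `v`, and it passes through
the linear maps `r` and `σ`. For `k = 0` only `u` is present, and translating it to `g₁` is the
definition of the action on sections of `A`. -/
theorem assemble_actAd (h : k + l = m) (w : 𝒢.RawAd k) (f : 𝒢.Raw (Line (M := M)) l) :
    σ.assemble m (𝒢.actAd h w f) = 𝒢.actDef h (σ.assemble k w) f := by
  obtain ⟨u, v⟩ := w
  match k, m, u, v, h with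
  | 0, 0, _, _, _ => rfl
  | 0, m + 1, u, v, h =>
    funext p
    refine (sub_eq_self (G := TangentSpace 𝓘(ℝ, EG) (p.arr 0))).2 ?_
    exact (congrArg (σ.σ (p.arr 0)) (map_zero _)).trans (map_zero _)
  | k + 1, 0, _, _, h => omega
  | k + 1, m + 1, u, v, h =>
    obtain rfl : k + l = m := by omega
    funext p
    have hf : f (p.tail.back rfl) = f (p.back h) := by rw [p.tail_back rfl h]
    obtain ⟨v', hv'⟩ : ∃ v' : TangentSpace 𝓘(ℝ, EM) (p.tail.obj 0),
      v' = (v : 𝒢.Raw (TangentSpace 𝓘(ℝ, EM)) k) (p.front h).tail := ⟨_, rfl⟩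
    obtain ⟨u', hu'⟩ : ∃ u' : 𝒢.TU (p.obj 0), u' = u (p.front h) := ⟨_, rfl⟩
    have hL : (σ.assemble (k + l + 1) (𝒢.actAd h (u, v) f) :
        ∀ p : 𝒢.Strings (k + l + 1), TangentSpace 𝓘(ℝ, EG) (p.arr 0)) p =
        𝒢.r (p.arr 0) (transport 𝒢.TU p.t_zero.symm (f (p.back h) • u')) -
        σ.σ (p.arr 0) (transport (TangentSpace 𝓘(ℝ, EM) (M := M)) p.s_zero.symm
          (f (p.tail.back rfl) • v')) := by rw [hv', hu']; rfl
    have hR : (𝒢.actDef h (σ.assemble (k + 1) (u, v)) f :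
        ∀ p : 𝒢.Strings (k + l + 1), TangentSpace 𝓘(ℝ, EG) (p.arr 0)) p = f (p.back h) •
        (𝒢.r (p.arr 0) (transport 𝒢.TU p.t_zero.symm u') -
        σ.σ (p.arr 0) (transport (TangentSpace 𝓘(ℝ, EM) (M := M)) p.s_zero.symm v')) := by
      rw [hv', hu']; rfl
    refine hL.trans (Eq.trans ?_ hR.symm)
    rw [hf, map_smul, map_smul, map_smul, map_smul, smul_sub]

end EhresmannConnection

end LieGroupoid

/-- A linear isomorphism of cochain complexes induces isomorphisms in cohomology. -/
theorem exists_cohomology_equiv {S T : ℕ → Type*} [∀ k, AddCommGroup (S k)] [∀ k, Module ℝ (S k)]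
    [∀ k, AddCommGroup (T k)] [∀ k, Module ℝ (T k)] {d : ∀ k, S k →ₗ[ℝ] S (k + 1)}
    {d' : ∀ k, T k →ₗ[ℝ] T (k + 1)} (I : ∀ k, S k ≃ₗ[ℝ] T k)
    (hI : ∀ k c, I (k + 1) (d k c) = d' k (I k c)) (k : ℕ) :
    ∃ Φ : Cohomology d k ≃ₗ[ℝ] Cohomology d' k,
      ∀ (c : LinearMap.ker (d k)) (w : LinearMap.ker (d' k)), (w : T k) = I k (c : S k) →
        Φ (Submodule.Quotient.mk c) = Submodule.Quotient.mk w := by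
  have hker : (LinearMap.ker (d k)).map (I k : S k →ₗ[ℝ] T k) = LinearMap.ker (d' k) := by
    ext w
    simp only [Submodule.mem_map, LinearMap.mem_ker, LinearEquiv.coe_coe]
    constructor
    · rintro ⟨c, hc, rfl⟩
      rw [← hI, hc, map_zero]
    · intro hw
      refine ⟨(I k).symm w, (I (k + 1)).injective ?_, (I k).apply_symm_apply w⟩
      rw [hI, LinearEquiv.apply_symm_apply, hw, map_zero]
  have hcob : ∀ c, I k c ∈ coboundaries d' k ↔ c ∈ coboundaries d k := by
    intro c
    match k, c with
    | 0, c => exact (I 0).map_eq_zero_iff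
    | k + 1, c =>
      constructor
      · rintro ⟨w, hw⟩
        refine ⟨(I k).symm w, (I (k + 1)).injective ?_⟩
        rw [hI, LinearEquiv.apply_symm_apply, hw]
      · rintro ⟨b, rfl⟩
        exact ⟨I k b, (hI k b).symm⟩
  let e : LinearMap.ker (d k) ≃ₗ[ℝ] LinearMap.ker (d' k) := (I k).ofSubmodules _ _ hker
  refine ⟨Submodule.Quotient.equiv _ _ e ?_, fun c w h => ?_⟩
  · ext w
    obtain ⟨c, rfl⟩ := e.surjective w
    rw [Submodule.mem_map_equiv, LinearEquiv.symm_apply_apply]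
    exact (hcob c).symm
  · exact congrArg Submodule.Quotient.mk (Subtype.ext h.symm)

/-! ### Transport of the differential graded structures along `I_σ` -/

namespace LieGroupoid.EhresmannConnection

variable {EG EM G M : Type*}
  [NormedAddCommGroup EG] [NormedSpace ℝ EG] [NormedAddCommGroup EM] [NormedSpace ℝ EM]
  [TopologicalSpace G] [ChartedSpace EG G] [TopologicalSpace M] [ChartedSpace EM M]
  {𝒢 : LieGroupoid EG EM G M} {k l m : ℕ}
  [IsManifold 𝓘(ℝ, EG) ∞ G] [IsManifold 𝓘(ℝ, EM) ∞ M] (σ : 𝒢.EhresmannConnection)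

include σ in
/-- The deformation complex is a right DG module. -/
theorem isRightDGModule_CDef : 𝒢.IsRightDGModule 𝒢.CDef 𝒢.actDef fun k => 𝒢.deformD k where
  -- Each cochain is assembled from some `w`, so the module axioms reduce to those for cup products.
  -- Only `d_d` is proved on the deformation side.
  act_mem h n f := by
    obtain ⟨w, hw, e⟩ := σ.exists_assemble_eq n.2
    rw [← e, ← σ.assemble_actAd]
    exact σ.assemble_mem (actAd_mem h hw f.2)
  act_one n := by
    obtain ⟨w, -, e⟩ := σ.exists_assemble_eq n.2
    rw [← e, ← σ.assemble_actAd, actAd_one]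
  act_act h₁ h₂ h₃ h₄ n f f' := by
    obtain ⟨w, -, e⟩ := σ.exists_assemble_eq n.2
    rw [← e, ← σ.assemble_actAd, ← σ.assemble_actAd, ← σ.assemble_actAd, actAd_actAd h₁ h₂ h₃ h₄]
  d_d := deformD_deformD
  leibniz {k l m} h n f := by
    obtain ⟨w, hw, e⟩ := σ.exists_assemble_eq n.2
    simp only [coe_deformD]
    rw [← e, ← σ.assemble_actAd, σ.deformDiff_assemble (actAd_mem h hw f.2).1.1,
      σ.deformDiff_assemble hw.1.1, σ.structureOp_actAd h (by omega) (by omega),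
      ← σ.assemble_actAd, ← σ.assemble_actAd, ← σ.assembleLin_apply, map_add, map_smul,
      σ.assembleLin_apply, σ.assembleLin_apply]

/-- The structure operator `D_σ` on smooth cochains. -/
def structureD (k : ℕ) : 𝒢.CAd k →ₗ[ℝ] 𝒢.CAd (k + 1) :=
  (σ.assembleEquiv (k + 1)).symm.toLinearMap ∘ₗ 𝒢.deformD k ∘ₗ (σ.assembleEquiv k).toLinearMap

theorem assembleEquiv_structureD (w : 𝒢.CAd k) :
    σ.assembleEquiv (k + 1) (σ.structureD k w) = 𝒢.deformD k (σ.assembleEquiv k w) :=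
  (σ.assembleEquiv (k + 1)).apply_symm_apply _

/-- Both sides assemble to the same deformation cochain, and injectivity only needs the first
components to lie in `A`. Smoothness of the explicit formula is thereby a consequence and not
something to check. -/
theorem coe_structureD (w : 𝒢.CAd k) :
    (σ.structureD k w : 𝒢.RawAd (k + 1)) = σ.structureOp k w := by
  refine σ.assemble_injective (σ.structureD k w).2.1.1 (σ.structureOp_mem_A w.2.1.1) ?_
  rw [← coe_assembleEquiv, assembleEquiv_structureD, coe_deformD, coe_assembleEquiv,
    σ.deformDiff_assemble w.2.1.1]

theorem isRepUpToHomotopyAd_structureD : 𝒢.IsRepUpToHomotopyAd σ.structureD where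
  act_mem h w f := actAd_mem h w.2 f.2
  act_one w := actAd_one _
  act_act h₁ h₂ h₃ h₄ w f f' := actAd_actAd h₁ h₂ h₃ h₄ _ _ _
  -- Read through the isomorphism, this is `δ² = 0`.
  d_d k w := (σ.assembleEquiv (k + 2)).injective <| by
    rw [assembleEquiv_structureD, assembleEquiv_structureD, deformD_deformD, map_zero]
  leibniz h w f := by
    rw [coe_structureD, coe_structureD]
    exact σ.structureOp_actAd h _ _ _ _

end LieGroupoid.EhresmannConnection

end

theorem mainTheorem4 {EG EM G M : Type*}
    [NormedAddCommGroup EG] [NormedSpace ℝ EG] [FiniteDimensional ℝ EG]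
    [NormedAddCommGroup EM] [NormedSpace ℝ EM] [FiniteDimensional ℝ EM]
    [TopologicalSpace G] [ChartedSpace EG G] [IsManifold 𝓘(ℝ, EG) ∞ G]
    [TopologicalSpace M] [ChartedSpace EM M] [IsManifold 𝓘(ℝ, EM) ∞ M]
    (𝒢 : LieGroupoid EG EM G M) (σ : 𝒢.EhresmannConnection) :
    -- the quasi-actions and the basic curvature of `σ` are well defined and smooth
    LieGroupoid.EhresmannConnection.IsQuasiActionA 𝒢 σ.lamA ∧
    LieGroupoid.EhresmannConnection.IsQuasiActionTM 𝒢 σ.lamTM ∧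
    LieGroupoid.EhresmannConnection.IsCurvatureTerm 𝒢 σ.K ∧
    (∀ g h hgh v, 𝒢.r (𝒢.mul g h)
      (transport 𝒢.TU (𝒢.t_mul g h hgh).symm (σ.K g h hgh v)) = σ.curvDefect g h hgh v) ∧
    -- the deformation complex is a right DG module over `(C(G), δ)`
    ∃ δ : ∀ k, 𝒢.CDef k →ₗ[ℝ] 𝒢.CDef (k + 1),
      (∀ k (c : 𝒢.CDef k), (δ k c : 𝒢.RawDef (k + 1)) = 𝒢.deformDiff k c) ∧
      𝒢.IsRightDGModule 𝒢.CDef 𝒢.actDef δ ∧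
      -- the isomorphism `I_σ` of graded right `C(G)`-modules
      ∃ I : ∀ k, 𝒢.CDef k ≃ₗ[ℝ] 𝒢.CAd k,
        (∀ k (c : 𝒢.CDef k), (c : 𝒢.RawDef k) = σ.assemble k (I k c)) ∧
        (∀ k (c : 𝒢.CDef k) (w : 𝒢.CAd k), (c : 𝒢.RawDef k) = σ.assemble k w → w = I k c) ∧
        (∀ {k l m : ℕ} (h : k + l = m) (c : 𝒢.CDef k) (f : 𝒢.C l) (c' : 𝒢.CDef m),
          (c' : 𝒢.RawDef m) = 𝒢.actDef h (c : 𝒢.RawDef k) f →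
            (I m c' : 𝒢.RawAd m) = 𝒢.actAd h (I k c : 𝒢.RawAd k) f) ∧
        -- the unique structure operator compatible with `I_σ`
        ∃ D : ∀ k, 𝒢.CAd k →ₗ[ℝ] 𝒢.CAd (k + 1),
          𝒢.IsRepUpToHomotopyAd D ∧
          (∀ k (c : 𝒢.CDef k), I (k + 1) (δ k c) = D k (I k c)) ∧
          (∀ D' : ∀ k, 𝒢.CAd k →ₗ[ℝ] 𝒢.CAd (k + 1), 𝒢.IsRepUpToHomotopyAd D' →
            (∀ k (c : 𝒢.CDef k), I (k + 1) (δ k c) = D' k (I k c)) → D' = D) ∧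
          -- its explicit form
          (∀ k (w : 𝒢.CAd k), (D k w : 𝒢.RawAd (k + 1)) = σ.structureOp k w) ∧
          -- the isomorphism in cohomology induced by `I_σ`
          ∃ Φ : ∀ k, Cohomology δ k ≃ₗ[ℝ] Cohomology D k,
            ∀ k (c : LinearMap.ker (δ k)) (w : LinearMap.ker (D k)),
              (w : 𝒢.CAd k) = I k (c : 𝒢.CDef k) →
                Φ k (Submodule.Quotient.mk c) = Submodule.Quotient.mk w := by
  have hI : ∀ k (c : 𝒢.CDef k), (c : 𝒢.RawDef k) = σ.assemble k ((σ.assembleEquiv k).symm c) :=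
    fun k c => by
      rw [← LieGroupoid.EhresmannConnection.coe_assembleEquiv, LinearEquiv.apply_symm_apply]
  have hI' : ∀ k (c : 𝒢.CDef k) (w : 𝒢.CAd k), (c : 𝒢.RawDef k) = σ.assemble k w →
      w = (σ.assembleEquiv k).symm c := fun k c w h => by
    rw [LinearEquiv.eq_symm_apply]
    exact Subtype.ext ((σ.coe_assembleEquiv w).trans h.symm)
  have hD : ∀ k (c : 𝒢.CDef k), (σ.assembleEquiv (k + 1)).symm (𝒢.deformD k c) =
      σ.structureD k ((σ.assembleEquiv k).symm c) := fun k c => by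
    rw [LinearEquiv.symm_apply_eq, LieGroupoid.EhresmannConnection.assembleEquiv_structureD,
      LinearEquiv.apply_symm_apply]
  choose Φ hΦ using fun k => exists_cohomology_equiv (fun k => (σ.assembleEquiv k).symm) hD k
  refine ⟨σ.isQuasiActionA, σ.isQuasiActionTM, σ.isCurvatureTerm, σ.r_K, 𝒢.deformD,
    fun _ _ => rfl, σ.isRightDGModule_CDef, fun k => (σ.assembleEquiv k).symm, hI, hI', ?_,
    σ.structureD, σ.isRepUpToHomotopyAd_structureD, hD, fun D' _ hD' => ?_,
    fun k w => σ.coe_structureD w, Φ, hΦ⟩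
  · intro k l m h c f c' hc'
    have := hI' m c' ⟨_, LieGroupoid.actAd_mem h ((σ.assembleEquiv k).symm c).2 f.2⟩
      (by rw [hc', hI k c, σ.assemble_actAd])
    rw [← this]
  -- Uniqueness uses only the intertwining relation: every `w` is the image under `I_σ` of its
  -- assembled cochain.
  · funext k
    refine LinearMap.ext fun w => ?_
    have h1 := hD k (σ.assembleEquiv k w)
    have h2 := hD' k (σ.assembleEquiv k w)
    rw [LinearEquiv.symm_apply_apply] at h1 h2
    exact h2.symm.trans h1
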